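/- Let $M$ be a smooth $n$-dimensional manifold (Hausdorff, second countable, without boundary), let $E\to M$ and $F\to M$ be smooth real vector bundles of finite ranks $d$ and $d'$, and fix a torsion-free connection $\hat\nabla$ on $TM$ and connections $\nabla$ on $E$ and on $F$. For $\omega\in C^\infty(\wedge^k(E^*))$ let $\nabla^j_{X_1,\dots,X_j}\omega$ be the $j$-th covariant derivative, given by $\nabla^0\omega=\omega$ and $$\nabla^{j+1}_{X_0,\dots,X_j}\omega=\nabla_{X_0}\bigl(\nabla^{j}_{X_1,\dots,X_j}\omega\bigr)-\sum_{i=1}^{j}\nabla^{j}_{X_1,\dots,\hat\nabla_{X_0}X_i,\dots,X_j}\omega .$$ For $p\in M$ and $r,k\ge 0$ let $\mathcal U_k^r(E;p)$ be the space of linear functionals on $C^\infty(\wedge^k(E^*))$ spanned by $\omega\mapsto(\nabla^j_{X_1,\dots,X_j}\omega)_p(\alpha)$ with $0\le j\le r$, $X_1,\dots,X_j$ smooth vector fields and $\alpha\in\wedge^k(E_p)$. These spaces are the fibres of a smooth vector bundle $\mathcal U_k^r(E)\to M$, for which coordinates $x$ on an open set of $M$ together with a trivialization of $E$ over it give the local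 frame $\omega\mapsto(\partial_I\omega_K)(p)$, where $I$ runs through the nondecreasing words of length at most $r$ in $\{1,\dots,n\}$, $K$ through the $k$-element subsets of $\{1,\dots,d\}$, and $\omega_K$ is the $K$-th component of $\omega$. For $f\in C^\infty(M)$ and $T\in\mathcal U_k^r(E;p)$ let $(f\lrcorner T)(\omega):=T(f\omega)$. 1. The operation $f\lrcorner$, applied pointwise, makes $C^\infty(\mathcal U_k^r(E))$ into a $C^\infty(M)$-module, and this module is finitely generated and projective. 2. Let $r,k,s,j\ge 0$. For smooth bundle homomorphisms $\mathcal H:\mathcal U_k^r(E)\to\mathcal U_j^s(F)$ covering the identity, each of the two actions $f\cdot\mathcal H=\mathcal H\circ(f\lrcorner)$ and $f\cdot\mathcal H=(f\lrcorner)\circ\mathcal H$ makes $C^\infty(\mathrm{Hom}(\mathcal U_k^r(E),\mathcal U_j^s(F)))$ into a $C^\infty(M)$-module, and for each of them this module is finitely generated and projective. 3. Call $\mathcal H$ as in 2 consistent if, with $\mathcal H^*:C^\infty(\wedge^j(F^*))\to C^\infty(\wedge^k(E^*))$ defined by $(\mathcal H^*\theta)_p(\alpha)=\mathcal H(\alpha)(\theta)$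 for $\alpha\in\wedge^k(E_p)\cong\mathcal U_k^0(E;p)$, one has $\mathcal H(S)(\theta)=S(\mathcal H^*\theta)$ for all $p\in M$, $S\in\mathcal U_k^r(E;p)$ and $\theta\in C^\infty(\wedge^j(F^*))$. For each of the two module structures of 2, the consistent homomorphisms form a sub-bundle in the module sense, that is, a $C^\infty(M)$-submodule which is a direct summand of $C^\infty(\mathrm{Hom}(\mathcal U_k^r(E),\mathcal U_j^s(F)))$. -/

import Mathlib

open Bundle Module
open scoped Manifold ContDiff

noncomputable section

namespace UBundle

/-- `ℝⁿ` with its Euclidean norm. -/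
abbrev Rn (n : ℕ) : Type := EuclideanSpace ℝ (Fin n)

/-- The ring `C^∞(M)`. -/
abbrev Fn (n : ℕ) (M : Type*) [TopologicalSpace M] [ChartedSpace (Rn n) M] : Type _ :=
  C^∞⟮𝓡 n, M; 𝓘(ℝ), ℝ⟯

/-- Smooth vector fields on `M`. -/
abbrev VF (n : ℕ) (M : Type*) [TopologicalSpace M] [ChartedSpace (Rn n) M]
    [IsManifold (𝓡 n) ∞ M] : Type _ :=
  Cₛ^∞⟮𝓡 n; Rn n, (TangentSpace (𝓡 n) : M → Type _)⟯

section Derivatives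

variable {n : ℕ} {M : Type*} [TopologicalSpace M] [ChartedSpace (Rn n) M] [IsManifold (𝓡 n) ∞ M]

theorem contMDiff_lie (X : VF n M) (f : Fn n M) :
    ContMDiff (𝓡 n) 𝓘(ℝ) ∞ (fun p => mvfderiv (𝓡 n) f p (X p)) := by
  have h1 : ContMDiff (𝓡 n).tangent 𝓘(ℝ).tangent ∞ (tangentMap (𝓡 n) 𝓘(ℝ) f) :=
    f.contMDiff.contMDiff_tangentMap (m := ∞) (by simp)
  have h2 := h1.comp X.contMDiff
  intro p
  have h3 := ((contMDiffAt_totalSpace (F := ℝ) (E := TangentSpace 𝓘(ℝ, ℝ))).1 (h2 p)).2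
  simp only [mfld_simps, Function.comp_def] at h3
  exact h3

theorem mdiffAt (f : Fn n M) (p : M) : MDifferentiableAt (𝓡 n) 𝓘(ℝ) f p :=
  f.contMDiff.mdifferentiableAt (by simp)

/-- The derivative `f ↦ X f` of smooth functions along a vector field. -/
def lie (X : VF n M) : Fn n M →ₗ[ℝ] Fn n M where
  toFun f := ⟨fun p => mvfderiv (𝓡 n) f p (X p), contMDiff_lie X f⟩
  map_add' f g := by
    ext p
    change mvfderiv (𝓡 n) (⇑f + ⇑g) p (X p) = mvfderiv (𝓡 n) f p (X p) + mvfderiv (𝓡 n) g p (X p)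
    rw [mvfderiv_add (mdiffAt f p) (mdiffAt g p)]
    rfl
  map_smul' c f := by
    ext p
    change mvfderiv (𝓡 n) ((fun _ : M => c) • ⇑f) p (X p) = c * mvfderiv (𝓡 n) f p (X p)
    rw [mvfderiv_smul mdifferentiableAt_const (mdiffAt f p), mvfderiv_const]
    simp

theorem lie_mul (X : VF n M) (f g : Fn n M) : lie X (f * g) = lie X f * g + f * lie X g := by
  ext p
  change mvfderiv (𝓡 n) (⇑f * ⇑g) p (X p) =
    mvfderiv (𝓡 n) f p (X p) * g p + f p * mvfderiv (𝓡 n) g p (X p)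
  rw [mvfderiv_mul (mdiffAt f p) (mdiffAt g p)]
  simp
  ring

/-- Evaluation of smooth functions at a point. -/
def evalAt (p : M) : Fn n M →ₗ[ℝ] ℝ where
  toFun f := f p
  map_add' _ _ := rfl
  map_smul' _ _ := rfl

end Derivatives

section OneBundle

variable {n : ℕ} {M : Type*} [TopologicalSpace M] [ChartedSpace (Rn n) M] [IsManifold (𝓡 n) ∞ M]
  {d : ℕ} {E : M → Type*} [TopologicalSpace (TotalSpace (Rn d) E)]
  [∀ x, AddCommGroup (E x)] [∀ x, Module ℝ (E x)] [∀ x, TopologicalSpace (E x)]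
  [∀ x, IsTopologicalAddGroup (E x)] [∀ x, ContinuousSMul ℝ (E x)]
  [FiberBundle (Rn d) E] [VectorBundle ℝ (Rn d) E]

/-- The section `∇_X s`. -/
def cov (D : CovariantDerivative (𝓡 n) (Rn d) E) [hD : D.ContMDiffCovariantDerivative ∞]
    (X : VF n M) (s : Cₛ^∞⟮𝓡 n; Rn d, E⟯) : Cₛ^∞⟮𝓡 n; Rn d, E⟯ where
  toFun p := D s p (X p)
  contMDiff_toFun := by
    have h := hD.contMDiff.contMDiff (σ := s) (by simpa using s.contMDiff.contMDiffOn)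
    rw [contMDiffOn_univ] at h
    exact h.clm_bundle_apply X.contMDiff

variable (n d E) in
/-- The space `C^∞(⋀ᵏ(E*))` of smooth sections, an element of `⋀ᵏ(E_p*)` being identified with an
alternating `k`-linear form on `E_p` by the determinant pairing. Smoothness means that the
components in the local trivializations of `E` are smooth. -/
def Form (k : ℕ) : Submodule ℝ (∀ p : M, E p [⋀^Fin k]→ₗ[ℝ] ℝ) where
  carrier := {η | ∀ (p₀ : M) (v : Fin k → Rn d),
    ContMDiffOn (𝓡 n) 𝓘(ℝ) ∞
      (fun p => η p fun i => (trivializationAt (Rn d) E p₀).symm p (v i))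
      (trivializationAt (Rn d) E p₀).baseSet}
  add_mem' := by
    intro η θ hη hθ p₀ v
    exact (hη p₀ v).add (hθ p₀ v)
  zero_mem' := by
    intro p₀ v
    exact contMDiffOn_const
  smul_mem' := by
    intro c η hη p₀ v
    exact contMDiffOn_const.mul (hη p₀ v)

/-- Multiplication of a section of `⋀ᵏ(E*)` by a smooth function. -/
def mulForm {k : ℕ} (f : Fn n M) : Form n d E k →ₗ[ℝ] Form n d E k where
  toFun η := ⟨fun p => f p • η.1 p, fun p₀ v => f.contMDiff.contMDiffOn.mul (η.2 p₀ v)⟩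
  map_add' η θ := by
    ext p v
    exact mul_add _ _ _
  map_smul' c η := by
    ext p v
    exact mul_left_comm _ _ _

variable [ContMDiffVectorBundle ∞ (Rn d) E (𝓡 n)]

theorem contMDiff_apply {k : ℕ} (s : Fin k → Cₛ^∞⟮𝓡 n; Rn d, E⟯) (η : Form n d E k) :
    ContMDiff (𝓡 n) 𝓘(ℝ) ∞ (fun p => η.1 p fun i => s i p) := by
  intro p₀
  let e := trivializationAt (Rn d) E p₀
  let b := (EuclideanSpace.basisFun (Fin d) ℝ).toBasis
  have hp₀ : p₀ ∈ e.baseSet := FiberBundle.mem_baseSet_trivializationAt' p₀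
  have ho : e.baseSet ∈ nhds p₀ := e.open_baseSet.mem_nhds hp₀
  have key : ∀ p ∈ e.baseSet, (η.1 p fun i => s i p) =
      ∑ K : Fin k → Fin d, (∏ i, e.localFrameCoeff (𝓡 n) b (K i) p (s i p)) *
        η.1 p (fun i => e.symm p (b (K i))) := by
    intro p hp
    have h1 : ∀ i, s i p = ∑ m, e.localFrameCoeff (𝓡 n) b m p (s i p) • e.symm p (b m) := by
      intro i
      have := e.eq_sum_localFrameCoeff_smul (I := 𝓡 n) (b := b) (s := fun x => s i x) hp
      refine this.trans (Finset.sum_congr rfl fun m _ => ?_)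
      rw [e.localFrame_apply_of_mem_baseSet b hp]
      simp [Trivialization.basisAt]
    have h2 : (fun i => s i p) =
        fun i => ∑ m, e.localFrameCoeff (𝓡 n) b m p (s i p) • e.symm p (b m) := funext h1
    conv_lhs => rw [h2]
    have h3 := (η.1 p).toMultilinearMap.map_sum
      (fun i m => e.localFrameCoeff (𝓡 n) b m p (s i p) • e.symm p (b m))
    refine h3.trans (Finset.sum_congr rfl fun K _ => ?_)
    exact (η.1 p).toMultilinearMap.map_smul_univ _ _
  have hsm : ContMDiffAt (𝓡 n) 𝓘(ℝ) ∞ (fun p =>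
      ∑ K : Fin k → Fin d, (∏ i, e.localFrameCoeff (𝓡 n) b (K i) p (s i p)) *
        η.1 p (fun i => e.symm p (b (K i)))) p₀ := by
    refine ContMDiffAt.sum fun K _ => ContMDiffAt.mul ?_ ((η.2 p₀ _).contMDiffAt ho)
    refine contMDiffAt_finsetProd fun i _ => ?_
    exact contMDiffAt_localFrameCoeff (e := e) b hp₀ (s i).contMDiff.contMDiffAt (K i)
  exact hsm.congr_of_eventuallyEq (Filter.eventually_of_mem ho key)

/-- The pairing `η ↦ η(s₁, …, s_k)` with sections of `E`. -/
def pair {k : ℕ} (s : Fin k → Cₛ^∞⟮𝓡 n; Rn d, E⟯) : Form n d E k →ₗ[ℝ] Fn n M where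
  toFun η := ⟨fun p => η.1 p fun i => s i p, contMDiff_apply s η⟩
  map_add' _ _ := rfl
  map_smul' _ _ := rfl

variable (D₀ : CovariantDerivative (𝓡 n) (Rn n) (TangentSpace (𝓡 n) : M → Type _))
  [D₀.ContMDiffCovariantDerivative ∞]
  (D : CovariantDerivative (𝓡 n) (Rn d) E) [D.ContMDiffCovariantDerivative ∞]

/-- `higherCov D₀ D j X s η` is the function `(∇ʲ_{X₁,…,X_j} η)(s₁,…,s_k)`, the pairing of the
`j`-th covariant derivative of `η ∈ C^∞(⋀ᵏ(E*))` with `s₁ ∧ … ∧ s_k`. Here `D` is the connection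
`∇` of `E` and `D₀` the connection `∇̂` of `TM`. The recursion is
`∇ʲ⁺¹_{X₀,…,X_j} η = ∇_{X₀}(∇ʲ_{X₁,…,X_j} η) - ∑ᵢ ∇ʲ_{X₁,…,∇̂_{X₀}Xᵢ,…,X_j} η`,
with the induced connection on forms,
`(∇_X θ)(s₁,…,s_k) = X(θ(s₁,…,s_k)) - ∑ₗ θ(s₁,…,∇_X sₗ,…,s_k)`. -/
def higherCov {k : ℕ} : (j : ℕ) → (Fin j → VF n M) → (Fin k → Cₛ^∞⟮𝓡 n; Rn d, E⟯) →
    (Form n d E k →ₗ[ℝ] Fn n M)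
  | 0, _, s => pair s
  | j + 1, X, s =>
      lie (X 0) ∘ₗ higherCov j (Fin.tail X) s
        - ∑ l : Fin k, higherCov j (Fin.tail X) (Function.update s l (cov D (X 0) (s l)))
        - ∑ i : Fin j,
            higherCov j (Function.update (Fin.tail X) i (cov D₀ (X 0) (Fin.tail X i))) s

/-- The functional `η ↦ (∇ʲ_{X₁,…,X_j} η)_p(s₁ ∧ … ∧ s_k)`, that is, the image of
`(X₁(p) ⊗ … ⊗ X_j(p)) ⊠ (s₁(p) ∧ … ∧ s_k(p))` under `Φ_p`. -/
def Phi {k : ℕ} (p : M) (j : ℕ) (X : Fin j → VF n M) (s : Fin k → Cₛ^∞⟮𝓡 n; Rn d, E⟯) :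
    Form n d E k →ₗ[ℝ] ℝ :=
  evalAt p ∘ₗ higherCov D₀ D j X s

/-- The fibre `𝒰_k^r(E; p)`: the image of `⊗^{≤ r}(T_pM) ⊠ ⋀ᵏ(E_p)` under `Φ_p`. -/
def U (r k : ℕ) (p : M) : Submodule ℝ (Form n d E k →ₗ[ℝ] ℝ) :=
  Submodule.span ℝ {T | ∃ j ≤ r, ∃ (X : Fin j → VF n M) (s : Fin k → Cₛ^∞⟮𝓡 n; Rn d, E⟯),
    T = Phi D₀ D p j X s}

theorem Phi_mem {r k j : ℕ} (hj : j ≤ r) (p : M) (X : Fin j → VF n M)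
    (s : Fin k → Cₛ^∞⟮𝓡 n; Rn d, E⟯) : Phi D₀ D p j X s ∈ U D₀ D r k p :=
  Submodule.subset_span ⟨j, hj, X, s, rfl⟩

section Corner

/-- Operators `η ↦ ∑ c · (∇ʲ_X η)(s)` with `j ≤ r` and smooth coefficients `c`. -/
def Op (r k : ℕ) : Submodule (Fn n M) (Form n d E k → Fn n M) :=
  Submodule.span (Fn n M) {P | ∃ j ≤ r, ∃ (X : Fin j → VF n M)
    (s : Fin k → Cₛ^∞⟮𝓡 n; Rn d, E⟯), P = ⇑(higherCov D₀ D j X s)}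

theorem Op_mem {r k j : ℕ} (hj : j ≤ r) (X : Fin j → VF n M)
    (s : Fin k → Cₛ^∞⟮𝓡 n; Rn d, E⟯) : ⇑(higherCov D₀ D j X s) ∈ Op D₀ D r k :=
  Submodule.subset_span ⟨j, hj, X, s, rfl⟩

theorem Op_mono {r r' k : ℕ} (h : r ≤ r') : Op (n := n) (E := E) D₀ D r k ≤ Op D₀ D r' k :=
  Submodule.span_mono fun _ ⟨j, hj, X, s, e⟩ => ⟨j, hj.trans h, X, s, e⟩

theorem higherCov_succ {k j : ℕ} (X₀ : VF n M) (X : Fin j → VF n M)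
    (s : Fin k → Cₛ^∞⟮𝓡 n; Rn d, E⟯) (η : Form n d E k) :
    higherCov D₀ D (j + 1) (Fin.cons X₀ X) s η =
      lie X₀ (higherCov D₀ D j X s η)
        - ∑ l : Fin k, higherCov D₀ D j X (Function.update s l (cov D X₀ (s l))) η
        - ∑ i : Fin j, higherCov D₀ D j (Function.update X i (cov D₀ X₀ (X i))) s η := by
  simp [higherCov]

theorem lie_Op {r k : ℕ} (X₀ : VF n M) {P : Form n d E k → Fn n M} (hP : P ∈ Op D₀ D r k) :
    (fun η => lie X₀ (P η)) ∈ Op D₀ D (r + 1) k := by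
  induction hP using Submodule.span_induction with
  | mem P h =>
    obtain ⟨j, hj, X, s, rfl⟩ := h
    have : (fun η => lie X₀ (higherCov D₀ D j X s η)) =
        ⇑(higherCov D₀ D (j + 1) (Fin.cons X₀ X) s)
        + ∑ l : Fin k, ⇑(higherCov D₀ D j X (Function.update s l (cov D X₀ (s l))))
        + ∑ i : Fin j, ⇑(higherCov D₀ D j (Function.update X i (cov D₀ X₀ (X i))) s) := by
      funext η
      simp only [Pi.add_apply, Finset.sum_apply, higherCov_succ]
      abel
    rw [this]
    refine add_mem (add_mem (Op_mem D₀ D (by omega) _ _) ?_) ?_ <;>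
    exact sum_mem fun _ _ => Op_mem D₀ D (by omega) _ _
  | zero =>
    have : (fun η : Form n d E k => lie X₀ ((0 : Form n d E k → Fn n M) η)) = 0 := by
      funext η
      simp
    rw [this]
    exact zero_mem _
  | add P Q _ _ hP hQ =>
    have : (fun η => lie X₀ ((P + Q) η)) = (fun η => lie X₀ (P η)) + fun η => lie X₀ (Q η) := by
      funext η
      simp
    rw [this]
    exact add_mem hP hQ
  | smul c P hPm hP =>
    have : (fun η => lie X₀ ((c • P) η)) = lie X₀ c • P + c • fun η => lie X₀ (P η) := by
      funext η
      simp [lie_mul]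
    rw [this]
    exact add_mem (Submodule.smul_mem _ _ (Op_mono D₀ D (Nat.le_succ r) hPm))
      (Submodule.smul_mem _ _ hP)

theorem higherCov_mulForm {k : ℕ} (f : Fn n M) (j : ℕ) (X : Fin j → VF n M)
    (s : Fin k → Cₛ^∞⟮𝓡 n; Rn d, E⟯) :
    (fun η => higherCov D₀ D j X s (mulForm f η)) ∈ Op D₀ D j k := by
  induction j generalizing s with
  | zero => exact Submodule.smul_mem _ f (Op_mem D₀ D le_rfl X s)
  | succ j ih =>
    have : (fun η => higherCov D₀ D (j + 1) X s (mulForm f η)) =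
        (fun η => lie (X 0) (higherCov D₀ D j (Fin.tail X) s (mulForm f η)))
        - ∑ l : Fin k, (fun η => higherCov D₀ D j (Fin.tail X)
            (Function.update s l (cov D (X 0) (s l))) (mulForm f η))
        - ∑ i : Fin j, (fun η => higherCov D₀ D j
            (Function.update (Fin.tail X) i (cov D₀ (X 0) (Fin.tail X i))) s (mulForm f η)) := by
      funext η
      simp [higherCov]
    rw [this]
    refine sub_mem (sub_mem (lie_Op D₀ D _ (ih _ _)) ?_) ?_ <;>
    exact sum_mem fun _ _ => Op_mono D₀ D (Nat.le_succ j) (ih _ _)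

theorem Op_apply_mem {r k : ℕ} (p : M) {P : Form n d E k → Fn n M} (hP : P ∈ Op D₀ D r k) :
    ∃ T ∈ U D₀ D r k p, ∀ η, T η = P η p := by
  induction hP using Submodule.span_induction with
  | mem P h =>
    obtain ⟨j, hj, X, s, rfl⟩ := h
    exact ⟨_, Phi_mem D₀ D hj p X s, fun _ => rfl⟩
  | zero => exact ⟨0, zero_mem _, fun _ => rfl⟩
  | add P Q _ _ hP hQ =>
    obtain ⟨T, hT, hT'⟩ := hP
    obtain ⟨S, hS, hS'⟩ := hQ
    exact ⟨T + S, add_mem hT hS, fun η => by simp [hT', hS']⟩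
  | smul c P _ hP =>
    obtain ⟨T, hT, hT'⟩ := hP
    exact ⟨c p • T, Submodule.smul_mem _ _ hT, fun η => by simp [hT']⟩

theorem corner_mem {r k : ℕ} (f : Fn n M) (p : M) (T : Form n d E k →ₗ[ℝ] ℝ)
    (hT : T ∈ U D₀ D r k p) : T ∘ₗ mulForm f ∈ U D₀ D r k p := by
  induction hT using Submodule.span_induction with
  | mem T h =>
    obtain ⟨j, hj, X, s, rfl⟩ := h
    obtain ⟨S, hS, hS'⟩ :=
      Op_apply_mem D₀ D p (Op_mono D₀ D hj (higherCov_mulForm D₀ D f j X s))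
    have : Phi D₀ D p j X s ∘ₗ mulForm f = S := LinearMap.ext fun η => (hS' η).symm
    rwa [this]
  | zero => simp
  | add S T _ _ hS hT =>
    rw [LinearMap.add_comp]
    exact add_mem hS hT
  | smul c T _ hT =>
    rw [LinearMap.smul_comp]
    exact Submodule.smul_mem _ _ hT

end Corner

/-- The action `f⌟` on the fibre: `(f⌟T)(η) = T(f η)`. -/
def corner {r k : ℕ} (f : Fn n M) (p : M) : U D₀ D r k p →ₗ[ℝ] U D₀ D r k p where
  toFun T := ⟨T.1 ∘ₗ mulForm f, corner_mem D₀ D f p T.1 T.2⟩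
  map_add' _ _ := rfl
  map_smul' _ _ := rfl

/-- Indices of the standard basis `x_I ⊠ e_K` of `S^{≤ r}(ℝⁿ) ⊠ ⋀ᵏ(ℝᵈ)`: nondecreasing words `I`
in `{1,…,n}` of length at most `r`, and `k`-element subsets `K` of `{1,…,d}`. -/
abbrev Idx (n d r k : ℕ) : Type :=
  (Σ j : Fin (r + 1), Fin j →o Fin n) × (Fin k ↪o Fin d)

instance (n d r k : ℕ) : Fintype (Idx n d r k) :=
  @Fintype.ofFinite _ (by
    have : ∀ j : Fin (r + 1), Finite (Fin j →o Fin n) := fun j => DFunLike.finite _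
    have : Finite (Fin k ↪o Fin d) := DFunLike.finite _
    infer_instance)

variable (n d E) in
/-- Domain over which both the chart of `M` and the trivialization of `E` at `p₀` are defined. -/
def dom (p₀ : M) : Set M := (chartAt (Rn n) p₀).source ∩ (trivializationAt (Rn d) E p₀).baseSet

/-- The local frame of `𝒰_k^r(E)` over `dom p₀`: the element indexed by `(I, K)` sends `η` to
the partial derivative `∂_I η_K` at `p`, computed in the chart at `p₀`, of the component `η_K` of
`η` in the trivialization of `E` at `p₀`. -/
def frame {r k : ℕ} (p₀ : M) (i : Idx n d r k) (p : M) (η : Form n d E k) : ℝ :=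
  iteratedFDeriv ℝ i.1.1
    (fun x : Rn n => η.1 ((chartAt (Rn n) p₀).symm x) fun l =>
      (trivializationAt (Rn d) E p₀).symm ((chartAt (Rn n) p₀).symm x)
        (EuclideanSpace.single (i.2 l) 1))
    (chartAt (Rn n) p₀ p)
    (fun m => EuclideanSpace.single (i.1.2 m) 1)

/-- `c` is the coordinate vector of `T` in the local frame around `p₀`. -/
def HasCoords {r k : ℕ} (p₀ p : M) (T : Form n d E k →ₗ[ℝ] ℝ) (c : Idx n d r k → ℝ) : Prop :=
  ∀ η, T η = ∑ i, c i * frame p₀ i p η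

/-- The group `C^∞(𝒰_k^r(E))` of smooth sections: in each local frame the coordinates are smooth
functions. -/
def USec (r k : ℕ) : AddSubgroup (∀ p : M, U D₀ D r k p) where
  carrier := {T | ∀ p₀ : M, ∃ a : Idx n d r k → M → ℝ,
    (∀ i, ContMDiffOn (𝓡 n) 𝓘(ℝ) ∞ (a i) (dom n d E p₀)) ∧
    ∀ p ∈ dom n d E p₀, HasCoords p₀ p (T p).1 fun i => a i p}
  add_mem' := by
    intro S T hS hT p₀
    obtain ⟨a, ha, ha'⟩ := hS p₀
    obtain ⟨b, hb, hb'⟩ := hT p₀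
    refine ⟨a + b, fun i => (ha i).add (hb i), fun p hp η => ?_⟩
    have h : ((S + T) p).1 η = (S p).1 η + (T p).1 η := rfl
    rw [h, ha' p hp η, hb' p hp η, ← Finset.sum_add_distrib]
    exact Finset.sum_congr rfl fun i _ => (add_mul _ _ _).symm
  zero_mem' := by
    intro p₀
    refine ⟨0, fun i => contMDiffOn_const, fun p hp η => ?_⟩
    have h : ((0 : ∀ p : M, U D₀ D r k p) p).1 η = 0 := rfl
    rw [h]
    simp
  neg_mem' := by
    intro S hS p₀
    obtain ⟨a, ha, ha'⟩ := hS p₀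
    refine ⟨-a, fun i => (ha i).neg, fun p hp η => ?_⟩
    have h : ((-S) p).1 η = -(S p).1 η := rfl
    rw [h, ha' p hp η, ← Finset.sum_neg_distrib]
    exact Finset.sum_congr rfl fun i _ => (neg_mul _ _).symm

end OneBundle

section TwoBundles

variable {n : ℕ} {M : Type*} [TopologicalSpace M] [ChartedSpace (Rn n) M] [IsManifold (𝓡 n) ∞ M]
  {d : ℕ} {E : M → Type*} [TopologicalSpace (TotalSpace (Rn d) E)]
  [∀ x, AddCommGroup (E x)] [∀ x, Module ℝ (E x)] [∀ x, TopologicalSpace (E x)]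
  [∀ x, IsTopologicalAddGroup (E x)] [∀ x, ContinuousSMul ℝ (E x)]
  [FiberBundle (Rn d) E] [VectorBundle ℝ (Rn d) E] [ContMDiffVectorBundle ∞ (Rn d) E (𝓡 n)]
  {d' : ℕ} {F : M → Type*} [TopologicalSpace (TotalSpace (Rn d') F)]
  [∀ x, AddCommGroup (F x)] [∀ x, Module ℝ (F x)] [∀ x, TopologicalSpace (F x)]
  [∀ x, IsTopologicalAddGroup (F x)] [∀ x, ContinuousSMul ℝ (F x)]
  [FiberBundle (Rn d') F] [VectorBundle ℝ (Rn d') F] [ContMDiffVectorBundle ∞ (Rn d') F (𝓡 n)]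
  (D₀ : CovariantDerivative (𝓡 n) (Rn n) (TangentSpace (𝓡 n) : M → Type _))
  [D₀.ContMDiffCovariantDerivative ∞]
  (D : CovariantDerivative (𝓡 n) (Rn d) E) [D.ContMDiffCovariantDerivative ∞]
  (D' : CovariantDerivative (𝓡 n) (Rn d') F) [D'.ContMDiffCovariantDerivative ∞]

instance homAddCommGroup (r k s j : ℕ) (p : M) :
    AddCommGroup (U D₀ D r k p →ₗ[ℝ] U D₀ D' s j p) :=
  @LinearMap.addCommGroup ℝ ℝ (U D₀ D r k p) (U D₀ D' s j p) _ _ _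
    (Submodule.addCommGroup (U D₀ D' s j p)) _ (Submodule.module _) _

/-- The group `C^∞(Hom(𝒰_k^r(E), 𝒰_j^s(F)))` of smooth sections: in each pair of local frames the
homomorphism is given by a matrix of smooth functions. -/
def HomSec (r k s j : ℕ) : AddSubgroup (∀ p : M, U D₀ D r k p →ₗ[ℝ] U D₀ D' s j p) where
  carrier := {H | ∀ p₀ : M, ∃ A : Idx n d' s j → Idx n d r k → M → ℝ,
    (∀ i' i, ContMDiffOn (𝓡 n) 𝓘(ℝ) ∞ (A i' i) (dom n d E p₀ ∩ dom n d' F p₀)) ∧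
    ∀ p ∈ dom n d E p₀ ∩ dom n d' F p₀, ∀ (S : U D₀ D r k p) (c : Idx n d r k → ℝ),
      HasCoords p₀ p S.1 c → HasCoords p₀ p (H p S).1 fun i' => ∑ i, A i' i p * c i}
  add_mem' := by
    intro G H hG hH p₀
    obtain ⟨A, hA, hA'⟩ := hG p₀
    obtain ⟨B, hB, hB'⟩ := hH p₀
    refine ⟨A + B, fun i' i => (hA i' i).add (hB i' i), fun p hp S c hc η => ?_⟩
    have h : ((G + H) p S).1 η = (G p S).1 η + (H p S).1 η := rfl
    rw [h, hA' p hp S c hc η, hB' p hp S c hc η, ← Finset.sum_add_distrib]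
    refine Finset.sum_congr rfl fun i' _ => ?_
    rw [← add_mul, ← Finset.sum_add_distrib]
    congr 1
    exact Finset.sum_congr rfl fun i _ => (add_mul _ _ _).symm
  zero_mem' := by
    intro p₀
    refine ⟨0, fun i' i => contMDiffOn_const, fun p hp S c hc η => ?_⟩
    have h : ((0 : ∀ p : M, U D₀ D r k p →ₗ[ℝ] U D₀ D' s j p) p S).1 η = 0 := rfl
    rw [h]
    simp
  neg_mem' := by
    intro G hG p₀
    obtain ⟨A, hA, hA'⟩ := hG p₀
    refine ⟨-A, fun i' i => (hA i' i).neg, fun p hp S c hc η => ?_⟩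
    have h : ((-G) p S).1 η = -(G p S).1 η := rfl
    rw [h, hA' p hp S c hc η, ← Finset.sum_neg_distrib]
    refine Finset.sum_congr rfl fun i' _ => ?_
    rw [← neg_mul, ← Finset.sum_neg_distrib]
    congr 1
    exact Finset.sum_congr rfl fun i _ => (neg_mul _ _).symm

/-- A homomorphism `H : 𝒰_k^r(E) → 𝒰_j^s(F)` is consistent if `(H*)* = H`. Here
`H* : C^∞(⋀ʲ(F*)) → C^∞(⋀ᵏ(E*))` is `(H*θ)_p(α) = H(α)(θ)` for `α ∈ ⋀ᵏ(E_p) = 𝒰_k^0(E; p)`, and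
the dual `T*` of an operator `T` is `T*(S) = S ∘ T`. -/
def IsConsistent {r k s j : ℕ} (H : ∀ p : M, U D₀ D r k p →ₗ[ℝ] U D₀ D' s j p) : Prop :=
  ∃ Hstar : Form n d' F j → Form n d E k,
    (∀ (θ : Form n d' F j) (p : M) (t : Fin k → Cₛ^∞⟮𝓡 n; Rn d, E⟯),
      (Hstar θ).1 p (fun i => t i p) =
        (H p ⟨Phi D₀ D p 0 Fin.elim0 t, Phi_mem D₀ D (Nat.zero_le r) p _ t⟩).1 θ) ∧
    ∀ (p : M) (S : U D₀ D r k p) (θ : Form n d' F j), (H p S).1 θ = S.1 (Hstar θ)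

end TwoBundles

end UBundle

end

/-
A second countable `n`-manifold is covered by `n + 1` open sets, each a disjoint union of chart
domains over which the bundles are trivial. Hence a module of sections which has local frames on
these domains is finitely generated and projective.

The action `f⌟` is not fibrewise multiplication by `f`, but it is so up to terms of lower order. On
the graded pieces of the order filtration it is therefore ordinary multiplication, and induction
along the filtration shows that the module and each step of its filtration are finitely generated
and projective, the steps being direct summands. For homomorphisms the degree is the order in the
target under postcomposition, and the order in the source, reversed, under precomposition.

A consistent homomorphism `H` is determined by its restriction to `𝒰_k^0`, because that determines
`H^*`. Every `H^*` lowers orders by `r`: if `n > 0`, the restriction takes its values in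
`𝒰_j^(s-r)` (and vanishes if `s < r`), since differentiating `H^*θ` up to `r` times must still give
functionals of order at most `s`. Conversely each homomorphism `𝒰_k^0 → 𝒰_j^(s-r)` extends to a
consistent one. Restriction to `𝒰_k^0` thus maps the consistent homomorphisms bijectively onto a
filtration step of `Hom(𝒰_k^0, 𝒰_j^s)`, and a complement of that step pulls back to a complement of
the consistent homomorphisms. If `n = 0`, every homomorphism is determined by its restriction to
`𝒰_k^0`, and all are consistent.
-/

noncomputable section

namespace UBundle

section CoveringDimension

open Set Topology

variable {V : Type*} [NormedAddCommGroup V] [NormedSpace ℝ V] [FiniteDimensional ℝ V]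
  {H : Type*} [TopologicalSpace H] {I : ModelWithCorners ℝ V H} [I.Boundaryless]
  {M : Type*} [TopologicalSpace M] [ChartedSpace H M]

theorem exists_mem_nhds_dimH_image_le [IsManifold I 1 M] {V' : Type*} [NormedAddCommGroup V']
    [NormedSpace ℝ V'] {O : Set M} (hO : IsOpen O) {g : M → V'}
    (hg : ContMDiffOn I 𝓘(ℝ, V') 1 g O) {p : M} (hp : p ∈ O) :
    ∃ u ∈ 𝓝 p, dimH (g '' u) ≤ finrank ℝ V := by
  let φ := extChartAt I p
  have hopen : IsOpen (φ.target ∩ φ.symm ⁻¹' O) :=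
    (continuousOn_extChartAt_symm p).isOpen_inter_preimage (isOpen_extChartAt_target p) hO
  have hmem : φ p ∈ φ.target ∩ φ.symm ⁻¹' O :=
    ⟨mem_extChartAt_target p, by simpa [φ] using hp⟩
  obtain ⟨ε, hε, hball⟩ := Metric.isOpen_iff.1 hopen _ hmem
  have hsm : ContDiffOn ℝ 1 (g ∘ φ.symm) (Metric.ball (φ p) ε) := by
    rw [← contMDiffOn_iff_contDiffOn]
    exact hg.comp ((contMDiffOn_extChartAt_symm p).mono fun x hx => (hball hx).1)
      fun x hx => (hball hx).2
  refine ⟨φ.source ∩ φ ⁻¹' Metric.ball (φ p) ε,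
    ((continuousOn_extChartAt p).isOpen_inter_preimage (isOpen_extChartAt_source p)
      Metric.isOpen_ball).mem_nhds ⟨mem_extChartAt_source p, Metric.mem_ball_self hε⟩, ?_⟩
  calc dimH (g '' (φ.source ∩ φ ⁻¹' Metric.ball (φ p) ε))
      ≤ dimH (g ∘ φ.symm '' Metric.ball (φ p) ε) := by
        refine dimH_mono ?_
        rintro _ ⟨q, ⟨hq, hqb⟩, rfl⟩
        exact ⟨φ q, hqb, by simp [φ.left_inv hq]⟩
    _ ≤ dimH (Metric.ball (φ p) ε) := hsm.dimH_image_le (convex_ball _ _) Subset.rfl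
    _ ≤ dimH (univ : Set V) := dimH_mono (subset_univ _)
    _ = finrank ℝ V := Real.dimH_univ_eq_finrank V

theorem dimH_image_le_finrank [SecondCountableTopology M] [IsManifold I 1 M] {V' : Type*}
    [NormedAddCommGroup V'] [NormedSpace ℝ V'] {O : Set M} (hO : IsOpen O) {g : M → V'}
    (hg : ContMDiffOn I 𝓘(ℝ, V') 1 g O) : dimH (g '' O) ≤ finrank ℝ V := by
  choose! u hu hdim using fun p (hp : p ∈ O) => exists_mem_nhds_dimH_image_le hO hg hp
  obtain ⟨t, htO, htc, ht⟩ := TopologicalSpace.countable_cover_nhdsWithin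
    (f := u) (s := O) fun p hp => mem_nhdsWithin_of_mem_nhds (hu p hp)
  calc dimH (g '' O) ≤ dimH (⋃ p ∈ t, g '' u p) := by
        rw [← image_iUnion₂]
        exact dimH_mono (image_mono ht)
    _ ≤ finrank ℝ V := by
        rw [dimH_bUnion htc]
        exact iSup₂_le fun p hp => hdim p (htO hp)

theorem eq_inv_vandermonde_mulVec_of_exp_mul_eq {N : ℕ} {x y v : Fin N → ℝ} {c : ℝ}
    (hx : Function.Injective x) (hc : 0 < c)
    (h : ∀ a, Real.exp (∑ m : Fin N, x a ^ (m : ℕ) * v m) * y a = c) :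
    v = (Matrix.vandermonde x)⁻¹.mulVec fun a => Real.log c - Real.log (y a) := by
  have hlog : (Matrix.vandermonde x).mulVec v = fun a => Real.log c - Real.log (y a) := by
    funext a
    have hy : y a ≠ 0 := fun h0 => hc.ne (by simpa [h0] using h a)
    rw [← h a, Real.log_mul (Real.exp_pos _).ne' hy, Real.log_exp, add_sub_cancel_right]
    rfl
  have hdet : IsUnit (Matrix.vandermonde x).det :=
    (Matrix.det_vandermonde_ne_zero_iff.2 hx).isUnit
  rw [← hlog, Matrix.mulVec_mulVec, Matrix.nonsing_inv_mul _ hdet, Matrix.one_mulVec]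

variable [SecondCountableTopology M]

/-- Take `w i = exp (∑ vₘ iᵐ)`. If more than `finrank V + 1` of the weighted functions share the
value `c` at `p`, then inverting a Vandermonde matrix recovers `v` from `(p, log c)`, so that `v`
lies in one of countably many `C¹` images of a manifold of smaller dimension. -/
theorem exists_weights_card_le [IsManifold I 1 M] {φ : ℕ → M → ℝ}
    (hφ : ∀ i, ContMDiff I 𝓘(ℝ) 1 (φ i)) :
    ∃ w : ℕ → ℝ, (∀ i, 0 < w i) ∧ ∀ (s : Finset ℕ) (p : M) (c : ℝ), 0 < c →
      (∀ i ∈ s, w i * φ i p = c) → s.card ≤ finrank ℝ V + 1 := by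
  let N := finrank ℝ V + 2
  let vdm : (Fin N → ℕ) → Matrix (Fin N) (Fin N) ℝ :=
    fun e => Matrix.vandermonde fun a => (e a : ℝ)
  let O : (Fin N → ℕ) → Set (M × ℝ) := fun e => {z | ∀ a, 0 < φ (e a) z.1}
  let g : (Fin N → ℕ) → M × ℝ → (Fin N → ℝ) :=
    fun e z => (vdm e)⁻¹.mulVec fun a => z.2 - Real.log (φ (e a) z.1)
  have hO : ∀ e, IsOpen (O e) := by
    intro e
    simp only [O, ofPred_forall]
    exact isOpen_iInter_of_finite fun a =>
      isOpen_lt continuous_const ((hφ (e a)).continuous.comp continuous_fst)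
  have hg : ∀ e, ContMDiffOn (I.prod 𝓘(ℝ)) 𝓘(ℝ, Fin N → ℝ) 1 (g e) (O e) := by
    intro e
    refine (vdm e)⁻¹.mulVecLin.toContinuousLinearMap.contMDiff.comp_contMDiffOn
      (contMDiffOn_pi_space.2 fun a z hz => ?_)
    have hlog : ContMDiffAt 𝓘(ℝ) 𝓘(ℝ) 1 Real.log (φ (e a) z.1) :=
      (Real.contDiffAt_log.2 (hz a).ne').contMDiffAt
    exact (contMDiffAt_snd.sub (hlog.comp z
      ((hφ (e a)).contMDiffAt.comp z contMDiffAt_fst))).contMDiffWithinAt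
  have hdim : dimH (⋃ e, g e '' O e) < finrank ℝ (Fin N → ℝ) := by
    rw [dimH_iUnion]
    refine (iSup_le fun e => dimH_image_le_finrank (hO e) (hg e)).trans_lt ?_
    simp only [finrank_fin_fun, Module.finrank_prod, finrank_self, N]
    exact_mod_cast Nat.lt_succ_self _
  obtain ⟨v, hv⟩ := (dense_compl_of_dimH_lt_finrank hdim).nonempty
  refine ⟨fun i => Real.exp (∑ m : Fin N, (i : ℝ) ^ (m : ℕ) * v m), fun i => Real.exp_pos _,
    fun s p c hc h => not_lt.1 fun hlt => hv ?_⟩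
  obtain ⟨s', hs', hcard⟩ := Finset.exists_subset_card_eq (show N ≤ s.card from hlt)
  let e : Fin N ↪o ℕ := s'.orderEmbOfFin hcard
  have he : ∀ a, Real.exp (∑ m : Fin N, (e a : ℝ) ^ (m : ℕ) * v m) * φ (e a) p = c :=
    fun a => h _ (hs' (s'.orderEmbOfFin_mem hcard a))
  exact mem_iUnion.2 ⟨e, (p, Real.log c),
    fun a => pos_of_mul_pos_right (hc.trans_eq (he a).symm) (Real.exp_pos _).le,
    (eq_inv_vandermonde_mulVec_of_exp_mul_eq (Nat.cast_injective.comp e.injective) hc he).symm⟩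

/-- The points at which the functions with index in `S` are positive and exceed all the others. -/
def dominated {X : Type*} (ψ : ℕ → X → ℝ) (S : Finset ℕ) : Set X :=
  {p | ∀ i ∈ S, 0 < ψ i p ∧ ∀ j ∉ S, ψ j p < ψ i p}

section Dominated

variable {X : Type*} {ψ : ℕ → X → ℝ} {S S' : Finset ℕ}

theorem isOpen_dominated [TopologicalSpace X] (hc : ∀ i, Continuous (ψ i))
    (hlf : LocallyFinite fun i => Function.support (ψ i)) : IsOpen (dominated ψ S) := by
  rw [isOpen_iff_mem_nhds]
  intro p hp
  obtain ⟨t, ht, hfin⟩ := hlf p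
  have hpos : ∀ᶠ q in 𝓝 p, ∀ i ∈ S, 0 < ψ i q :=
    (Filter.eventually_all_finset S).2 fun i hi =>
      (hc i).continuousAt.eventually_const_lt (hp i hi).1
  have hlt : ∀ᶠ q in 𝓝 p, ∀ i ∈ S, ∀ j ∈ hfin.toFinset, j ∉ S → ψ j q < ψ i q := by
    refine (Filter.eventually_all_finset S).2 fun i hi =>
      (Filter.eventually_all_finset _).2 fun j _ => Filter.eventually_imp_distrib_left.2 fun hj =>
        (hc j).continuousAt.eventually_lt (hc i).continuousAt ((hp i hi).2 j hj)
  filter_upwards [hpos, hlt, ht] with q hqpos hqlt hqt i hi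
  refine ⟨hqpos i hi, fun j hj => ?_⟩
  by_cases hjq : ψ j q = 0
  · exact hjq.trans_lt (hqpos i hi)
  · exact hqlt i hi j (hfin.mem_toFinset.2 ⟨q, hjq, hqt⟩) hj

theorem disjoint_dominated (hcard : S.card = S'.card) (hne : S ≠ S') :
    Disjoint (dominated ψ S) (dominated ψ S') := by
  rw [Set.disjoint_left]
  intro p hp hp'
  obtain ⟨i, hi, hi'⟩ :=
    Finset.not_subset.1 fun h => hne (Finset.eq_of_subset_of_card_le h hcard.ge)
  obtain ⟨j, hj, hj'⟩ :=
    Finset.not_subset.1 fun h => hne (Finset.eq_of_subset_of_card_le h hcard.le).symm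
  exact lt_asymm ((hp i hi).2 j hj') ((hp' j hj).2 i hi')

/-- The set in question consists of the indices at which the maximum of `ψ` is attained. -/
theorem exists_mem_dominated {p : X} (h0 : ∀ i, 0 ≤ ψ i p) (hfin : {i | ψ i p ≠ 0}.Finite)
    (hne : ∃ i, ψ i p ≠ 0) :
    ∃ S c, S.Nonempty ∧ p ∈ dominated ψ S ∧ 0 < c ∧ ∀ i ∈ S, ψ i p = c := by
  obtain ⟨m, hm, hmax⟩ := hfin.toFinset.exists_max_image (fun i => ψ i p)
    (hne.imp fun _ => hfin.mem_toFinset.2)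
  have hmpos : 0 < ψ m p := (h0 m).lt_of_ne' (hfin.mem_toFinset.1 hm)
  have hle : ∀ j, ψ j p ≤ ψ m p := by
    intro j
    by_cases hj : ψ j p = 0
    · exact hj.trans_le (h0 m)
    · exact hmax j (hfin.mem_toFinset.2 hj)
  have hS : ∀ j, j ∈ hfin.toFinset.filter (fun i => ψ i p = ψ m p) ↔ ψ j p = ψ m p := by
    intro j
    simp only [Finset.mem_filter, hfin.mem_toFinset, mem_ofPred_eq, and_iff_right_iff_imp]
    exact fun h => h ▸ hmpos.ne'
  refine ⟨_, ψ m p, ⟨m, (hS m).2 rfl⟩, fun i hi => ?_, hmpos, fun i => (hS i).1⟩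
  rw [(hS i).1 hi]
  exact ⟨hmpos, fun j hj => (hle j).lt_of_ne fun h => hj ((hS j).2 h)⟩

end Dominated

/-- A disjoint union of open sets, each contained in a member of the cover `dom`, encoded by its
union and a locally constant choice of such members. -/
structure Selection {X ι : Type*} [TopologicalSpace X] (dom : ι → Set X) where
  carrier : Set X
  index : X → ι
  isOpen_carrier : IsOpen carrier
  mem_dom : ∀ p ∈ carrier, p ∈ dom (index p)
  eventually_index_eq : ∀ p ∈ carrier, ∀ᶠ q in 𝓝 p, index q = index p

theorem exists_selection_carrier_eq_iUnion {X ι κ : Type*} [TopologicalSpace X] [Nonempty ι]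
    {dom : ι → Set X} {U : κ → Set X} (hU : ∀ k, IsOpen (U k))
    (hdisj : Pairwise (Function.onFun Disjoint U)) (hsub : ∀ k, ∃ i, U k ⊆ dom i) :
    ∃ s : Selection dom, s.carrier = ⋃ k, U k := by
  classical
  choose x hx using hsub
  let σ : X → ι := fun p => if h : ∃ k, p ∈ U k then x h.choose else Classical.arbitrary ι
  have hσ : ∀ k, ∀ p ∈ U k, σ p = x k := by
    intro k p hp
    have h : ∃ k, p ∈ U k := ⟨k, hp⟩
    have hk : h.choose = k := hdisj.eq (not_disjoint_iff.2 ⟨p, h.choose_spec, hp⟩)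
    simp only [σ, dif_pos h, hk]
  refine ⟨⟨⋃ k, U k, σ, isOpen_iUnion hU, fun p hp => ?_, fun p hp => ?_⟩, rfl⟩
  · obtain ⟨k, hk⟩ := mem_iUnion.1 hp
    exact hσ k p hk ▸ hx k hk
  · obtain ⟨k, hk⟩ := mem_iUnion.1 hp
    filter_upwards [(hU k).mem_nhds hk] with q hq
    rw [hσ k p hk, hσ k q hq]

/-- The Lebesgue covering dimension of a manifold is at most its dimension. -/
theorem exists_selection_cover [T2Space M] [IsManifold I ∞ M] {ι : Type*} [Nonempty ι]
    {dom : ι → Set M} (hdom : ∀ i, IsOpen (dom i)) (hcover : ⋃ i, dom i = univ) :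
    ∃ s : Fin (finrank ℝ V + 1) → Selection dom, ⋃ c, (s c).carrier = univ := by
  have : LocallyCompactSpace H := I.locallyCompactSpace
  have : LocallyCompactSpace M := ChartedSpace.locallyCompactSpace H M
  obtain ⟨x, hx⟩ : ∃ x : ℕ → ι, ⋃ i, dom (x i) = univ := by
    obtain ⟨t, ht, hcov⟩ := isLindelof_univ.elim_countable_subcover dom hdom hcover.ge
    obtain rfl | hne := t.eq_empty_or_nonempty
    · exact ⟨fun _ => Classical.arbitrary ι, univ_subset_iff.1 (hcov.trans (by simp))⟩
    · obtain ⟨x, rfl⟩ := ht.exists_eq_range hne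
      exact ⟨x, univ_subset_iff.1 (by simpa using hcov)⟩
  obtain ⟨f, hf⟩ := SmoothPartitionOfUnity.exists_isSubordinate I isClosed_univ
    (fun i => dom (x i)) (fun i => hdom _) hx.ge
  obtain ⟨w, hw, hgen⟩ :=
    exists_weights_card_le (φ := fun i => f i) fun i => (f i).contMDiff.of_le (by simp)
  let ψ : ℕ → M → ℝ := fun i p => w i * f i p
  have hψ : ∀ i p, ψ i p ≠ 0 ↔ f i p ≠ 0 := fun i p => by simp [ψ, (hw i).ne']
  have hlf : LocallyFinite fun i => Function.support (ψ i) :=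
    f.locallyFinite.subset fun i p => (hψ i p).1
  have hopen : ∀ S, IsOpen (dominated ψ S) := fun S =>
    isOpen_dominated (fun i => continuous_const.mul (f i).contMDiff.continuous) hlf
  have hsel : ∀ c : Fin (finrank ℝ V + 1), ∃ s : Selection dom,
      s.carrier = ⋃ S : {S : Finset ℕ // S.card = c + 1}, dominated ψ S := by
    refine fun c => exists_selection_carrier_eq_iUnion (fun S => hopen S.1)
      (fun S S' hne => disjoint_dominated (S.2.trans S'.2.symm) (Subtype.coe_injective.ne hne))
      fun ⟨S, hS⟩ => ?_
    obtain ⟨i, hi⟩ := Finset.card_pos.1 (by lia : 0 < S.card)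
    exact ⟨x i, fun p hp => hf i (subset_closure ((hψ i p).1 (hp i hi).1.ne'))⟩
  choose s hs using hsel
  refine ⟨s, eq_univ_of_forall fun p => ?_⟩
  obtain ⟨i, hi⟩ := f.exists_pos_of_mem (mem_univ p)
  obtain ⟨S, c, hne, hp, hc, hS⟩ := exists_mem_dominated (ψ := ψ) (p := p)
    (fun i => mul_nonneg (hw i).le (f.nonneg i p)) (hlf.point_finite p) ⟨i, (hψ i p).2 hi.ne'⟩
  have hcard := hgen S p c hc hS
  have hpos := hne.card_pos
  refine mem_iUnion.2 ⟨⟨S.card - 1, by lia⟩, ?_⟩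
  rw [hs]
  exact mem_iUnion.2 ⟨⟨S, by simp only; lia⟩, hp⟩

end CoveringDimension

section FiniteProjective

variable {R P : Type*} [Ring R] [AddCommGroup P] [Module R P] {K L N : Submodule R P}

/-- The quotient `L / N` is finitely generated and projective; this is expressed by a finite dual
basis of `L` modulo `N`. -/
def FiniteProjectiveMod (L N : Submodule R P) : Prop :=
  ∃ (ι : Type) (_ : Finite ι) (α : L →ₗ[R] ι → R) (β : (ι → R) →ₗ[R] L),
    ∀ x : L, (x - β (α x) : P) ∈ N ∧ ((x : P) ∈ N → α x = 0)

namespace FiniteProjectiveMod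

theorem refl (L : Submodule R P) : FiniteProjectiveMod L L :=
  ⟨Empty, inferInstance, 0, 0, fun x => by simp⟩

theorem trans (hKL : FiniteProjectiveMod K L) (hLN : FiniteProjectiveMod L N) (hL : L ≤ K)
    (hN : N ≤ L) : FiniteProjectiveMod K N := by
  obtain ⟨ι, _, α, β, h⟩ := hKL
  obtain ⟨ι', _, α', β', h'⟩ := hLN
  let ρ : K →ₗ[R] L := (K.subtype - K.subtype ∘ₗ β ∘ₗ α).codRestrict L fun x => (h x).1
  let e := LinearEquiv.sumArrowLequivProdArrow ι ι' R R
  refine ⟨ι ⊕ ι', inferInstance, e.symm.toLinearMap ∘ₗ α.prod (α' ∘ₗ ρ),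
    β.coprod (Submodule.inclusion hL ∘ₗ β') ∘ₗ e.toLinearMap, fun x => ⟨?_, fun hx => ?_⟩⟩
  · have hρ : (ρ x : P) = x - β (α x) := rfl
    simpa [hρ, sub_sub] using (h' (ρ x)).1
  · have hα : α x = 0 := (h x).2 (hN hx)
    have hρ : (ρ x : P) = x := by
      change (x : P) - β (α x) = x
      simp [hα]
    simp [hα, (h' (ρ x)).2 (hρ.symm ▸ hx)]

theorem exists_isCompl (h : FiniteProjectiveMod ⊤ N) : ∃ Q, IsCompl N Q := by
  obtain ⟨ι, _, α, β, h⟩ := h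
  let ρ : P →ₗ[R] N := (LinearMap.id - Submodule.subtype ⊤ ∘ₗ β ∘ₗ α ∘ₗ
    Submodule.topEquiv.symm.toLinearMap).codRestrict N fun x => (h ⟨x, trivial⟩).1
  refine ⟨_, LinearMap.isCompl_of_proj (f := ρ) fun x => Subtype.ext ?_⟩
  have hα : α ⟨x, trivial⟩ = 0 := (h ⟨x, trivial⟩).2 x.2
  change (x : P) - β (α ⟨x, trivial⟩) = x
  simp [hα]

theorem finite_projective (h : FiniteProjectiveMod (⊤ : Submodule R P) ⊥) :
    Module.Finite R P ∧ Module.Projective R P := by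
  obtain ⟨ι, _, α, β, h⟩ := h
  have hβα : β ∘ₗ α = LinearMap.id :=
    LinearMap.ext fun x => Subtype.ext (sub_eq_zero.1 ((Submodule.mem_bot R).1 (h x).1)).symm
  have hfin : Module.Finite R (⊤ : Submodule R P) :=
    Module.Finite.of_surjective β fun x => ⟨α x, LinearMap.congr_fun hβα x⟩
  have hproj : Module.Projective R (⊤ : Submodule R P) := Module.Projective.of_split α β hβα
  exact ⟨Module.Finite.equiv Submodule.topEquiv, Module.Projective.of_equiv Submodule.topEquiv⟩

end FiniteProjectiveMod

theorem exists_isCompl_of_bijOn {Q : Type*} [AddCommGroup Q] [Module R Q] (f : P →ₗ[R] Q)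
    {S S' : Submodule R Q} (hS : IsCompl S S') (hf : Set.BijOn f N S) : ∃ N', IsCompl N N' := by
  refine ⟨S'.comap f, Submodule.disjoint_def.2 fun x hx hx' => ?_,
    codisjoint_iff.2 (eq_top_iff.2 fun x _ => ?_)⟩
  · have h0 : f x = 0 := Submodule.disjoint_def.1 hS.disjoint _ (hf.mapsTo hx) hx'
    exact hf.injOn hx N.zero_mem (h0.trans (map_zero f).symm)
  · obtain ⟨q, hq, q', hq', h⟩ := Submodule.mem_sup.1 (hS.sup_eq_top ▸ Submodule.mem_top (x := f x))
    obtain ⟨y, hy, rfl⟩ := hf.surjOn hq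
    refine Submodule.mem_sup.2 ⟨y, hy, x - y, ?_, add_sub_cancel y x⟩
    rwa [Submodule.mem_comap, map_sub, ← h, add_sub_cancel_left]

end FiniteProjective

section GradedCoords

variable {n : ℕ} {M : Type*} [TopologicalSpace M] [ChartedSpace (Rn n) M]

section Selection

variable [T2Space M] [SecondCountableTopology M] [IsManifold (𝓡 n) ∞ M]

theorem exists_eq_one_tsupport_subset {K O : Set M} (hK : IsClosed K) (hO : IsOpen O)
    (hKO : K ⊆ O) : ∃ χ : Fn n M, (∀ p ∈ K, χ p = 1) ∧ tsupport χ ⊆ O := by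
  have : LocallyCompactSpace M := ChartedSpace.locallyCompactSpace (Rn n) M
  obtain ⟨χ, h0, h1, -⟩ := exists_contMDiffMap_zero_one_nhds_of_isClosed (n := ⊤) (𝓡 n)
    hO.isClosed_compl hK (Set.disjoint_compl_left_iff_subset.2 hKO)
  refine ⟨χ, fun p hp => h1.self_of_nhdsSet p hp, fun p hp => by_contra fun hpO => ?_⟩
  exact notMem_tsupport_iff_eventuallyEq.2 (h0.filter_mono (nhds_le_nhdsSet hpO)) hp

theorem exists_selection_bump {dom : M → Set M} (hdom : ∀ p, IsOpen (dom p))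
    (hmem : ∀ p, p ∈ dom p) :
    ∃ (s : Fin (n + 1) → Selection dom) (χ ξ : Fin (n + 1) → Fn n M),
      (∀ c, tsupport (χ c) ⊆ (s c).carrier) ∧ (∀ c, tsupport (ξ c) ⊆ (s c).carrier) ∧
      ∑ c, χ c * ξ c = 1 := by
  have : LocallyCompactSpace M := ChartedSpace.locallyCompactSpace (Rn n) M
  obtain hM | hM := isEmpty_or_nonempty M
  · exact ⟨fun _ => ⟨∅, id, isOpen_empty, by simp, by simp⟩, 0, 0, fun _ p => isEmptyElim p,
      fun _ p => isEmptyElim p, ContMDiffMap.ext fun p => isEmptyElim p⟩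
  obtain ⟨s, hs⟩ : ∃ s : Fin (n + 1) → Selection dom, ⋃ c, (s c).carrier = Set.univ :=
    finrank_euclideanSpace_fin (𝕜 := ℝ) (n := n) ▸ exists_selection_cover (I := 𝓡 n) hdom
      (Set.eq_univ_of_forall fun p => Set.mem_iUnion.2 ⟨p, hmem p⟩)
  obtain ⟨ρ, hρ⟩ := SmoothPartitionOfUnity.exists_isSubordinate (𝓡 n) isClosed_univ
    (fun c => (s c).carrier) (fun c => (s c).isOpen_carrier) hs.ge
  choose χ hχ1 hχ using fun c =>
    exists_eq_one_tsupport_subset (n := n) (isClosed_tsupport (ρ c)) (s c).isOpen_carrier (hρ c)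
  refine ⟨s, χ, fun c => ρ c, hχ, hρ, ContMDiffMap.ext fun p => ?_⟩
  have hmul : ∀ c, χ c p * ρ c p = ρ c p := by
    intro c
    by_cases hp : p ∈ tsupport (ρ c)
    · rw [hχ1 c p hp, one_mul]
    · rw [image_eq_zero_of_notMem_tsupport hp, mul_zero]
  calc (∑ c, χ c * ρ c : Fn n M) p = ∑ c, χ c p * ρ c p := map_sum (evalAt p) _ _
    _ = 1 := by
      rw [Finset.sum_congr rfl fun c _ => hmul c, ← finsum_eq_sum_of_fintype]
      exact ρ.sum_eq_one (Set.mem_univ p)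

end Selection

/-- Local smooth coordinates on a module over the smooth functions on `M`, graded in such a way that
functions act on the leading coordinates by multiplication. Here `coord p₀ p T` is the coordinate
vector of `T` at `p` in the chart around `p₀`; it is meaningful for `p ∈ dom p₀`. -/
structure GradedCoords (n : ℕ) (M : Type*) [TopologicalSpace M] [ChartedSpace (Rn n) M]
    (P : Type*) [AddCommGroup P] [Module (Fn n M) P] (ι : Type) where
  dom : M → Set M
  isOpen_dom : ∀ p, IsOpen (dom p)
  mem_dom : ∀ p, p ∈ dom p
  deg : ι → ℕ
  coord : M → M → P →+ (ι → ℝ)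
  contMDiffOn_coord : ∀ p₀ T i,
    ContMDiffOn (𝓡 n) 𝓘(ℝ) ∞ (fun p => coord p₀ p T i) (dom p₀)
  coord_smul : ∀ (f : Fn n M) (T : P) {p₀ p : M}, p ∈ dom p₀ → ∀ i,
    (∀ i', deg i < deg i' → coord p₀ p T i' = 0) → coord p₀ p (f • T) i = f p * coord p₀ p T i
  coord_eq_zero_congr : ∀ (t : ℕ) (T : P) {p p₀ p₁ : M}, p ∈ dom p₀ → p ∈ dom p₁ →
    (∀ i, t ≤ deg i → coord p₀ p T i = 0) → ∀ i, t ≤ deg i → coord p₁ p T i = 0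
  eq_zero_of_coord : ∀ T, (∀ p, coord p p T = 0) → T = 0
  exists_coord_eq : ∀ (s : Selection dom) (a : ι → Fn n M), (∀ i, tsupport (a i) ⊆ s.carrier) →
    ∃ T, (∀ p ∈ s.carrier, coord (s.index p) p T = fun i => a i p) ∧
      ∀ p ∉ s.carrier, coord p p T = 0

namespace GradedCoords

variable {P : Type*} [AddCommGroup P] [Module (Fn n M) P] {ι : Type} (C : GradedCoords n M P ι)

/-- The submodule of elements whose coordinates of degree at least `t` vanish. -/
def filt (t : ℕ) : Submodule (Fn n M) P where
  carrier := {T | ∀ p p₀, p ∈ C.dom p₀ → ∀ i, t ≤ C.deg i → C.coord p₀ p T i = 0}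
  add_mem' := by
    intro T T' hT hT' p p₀ hp i hi
    rw [map_add, Pi.add_apply, hT p p₀ hp i hi, hT' p p₀ hp i hi, add_zero]
  zero_mem' := fun p p₀ _ i _ => by rw [map_zero, Pi.zero_apply]
  smul_mem' := by
    intro f T hT p p₀ hp i hi
    rw [C.coord_smul f T hp i fun i' hi' => hT p p₀ hp i' (hi.trans hi'.le), hT p p₀ hp i hi,
      mul_zero]

variable {C} {t : ℕ}

theorem filt_le_filt_succ : C.filt t ≤ C.filt (t + 1) :=
  fun _ hT p p₀ hp i hi => hT p p₀ hp i (Nat.le_of_succ_le hi)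

theorem mem_filt_of_exists {T : P}
    (h : ∀ p, ∃ p₀, p ∈ C.dom p₀ ∧ ∀ i, t ≤ C.deg i → C.coord p₀ p T i = 0) : T ∈ C.filt t := by
  intro p p₁ hp₁
  obtain ⟨p₀, hp₀, h0⟩ := h p
  exact C.coord_eq_zero_congr t T hp₀ hp₁ h0

theorem coord_smul_of_mem_filt {T : P} (hT : T ∈ C.filt (t + 1)) (f : Fn n M) {p₀ p : M}
    (hp : p ∈ C.dom p₀) {i : ι} (hi : t ≤ C.deg i) :
    C.coord p₀ p (f • T) i = f p * C.coord p₀ p T i :=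
  C.coord_smul f T hp i fun i' hi' => hT p p₀ hp i' (hi.trans_lt hi')

variable (C) in
theorem filt_zero : C.filt 0 = ⊥ :=
  eq_bot_iff.2 fun T hT => C.eq_zero_of_coord T fun p =>
    funext fun i => hT p p (C.mem_dom p) i (Nat.zero_le _)

variable (C) in
theorem exists_filt_eq_top [Finite ι] : ∃ m, ∀ t, m ≤ t → C.filt t = ⊤ := by
  obtain ⟨m, hm⟩ := (Set.finite_range C.deg).bddAbove
  refine ⟨m + 1, fun t ht => eq_top_iff.2 fun T _ p p₀ _ i hi => ?_⟩
  have := hm ⟨i, rfl⟩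
  lia

section Layer

variable (s : Selection C.dom) {χ ξ : Fn n M}

theorem contMDiff_mul_coord (hχ : tsupport χ ⊆ s.carrier) (T : P) (i : ι) :
    ContMDiff (𝓡 n) 𝓘(ℝ) ∞ fun p => χ p * C.coord (s.index p) p T i := by
  refine contMDiff_of_tsupport fun p hp => ?_
  have hps : p ∈ s.carrier := hχ (closure_mono (Function.support_mul_subset_left _ _) hp)
  refine (χ.contMDiff.contMDiffAt.mul ((C.contMDiffOn_coord (s.index p) T i).contMDiffAt
    ((C.isOpen_dom _).mem_nhds (s.mem_dom p hps)))).congr_of_eventuallyEq ?_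
  filter_upwards [s.eventually_index_eq p hps] with q hq
  rw [hq]
  rfl

/-- The coordinates of degree `t` of the elements of `C.filt (t + 1)`, multiplied by `χ` to extend
them to `M`. -/
def leadingCoord (hχ : tsupport χ ⊆ s.carrier) (t : ℕ) :
    C.filt (t + 1) →ₗ[Fn n M] ({i // C.deg i = t} → Fn n M) where
  toFun T i := ⟨_, contMDiff_mul_coord s hχ T i⟩
  map_add' T T' := by
    ext i p
    exact (congrArg (χ p * ·) (congrFun (map_add _ _ _) _)).trans (mul_add _ _ _)
  map_smul' f T := by
    ext i p
    change χ p * C.coord (s.index p) p (f • (T : P)) i =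
      f p * (χ p * C.coord (s.index p) p (T : P) i)
    by_cases hp : p ∈ s.carrier
    · rw [coord_smul_of_mem_filt T.2 f (s.mem_dom p hp) i.2.ge, mul_left_comm]
    · rw [image_eq_zero_of_notMem_tsupport fun h => hp (hχ h), zero_mul, zero_mul, mul_zero]

theorem leadingCoord_apply (hχ : tsupport χ ⊆ s.carrier) (T : C.filt (t + 1))
    (i : {i // C.deg i = t}) (p : M) :
    leadingCoord s hχ t T i p = χ p * C.coord (s.index p) p (T : P) i :=
  rfl

theorem leadingCoord_eq_zero (hχ : tsupport χ ⊆ s.carrier) {T : C.filt (t + 1)}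
    (hT : (T : P) ∈ C.filt t) : leadingCoord s hχ t T = 0 := by
  ext i p
  rw [leadingCoord_apply]
  by_cases hp : p ∈ s.carrier
  · rw [hT p _ (s.mem_dom p hp) _ i.2.ge, mul_zero]
    rfl
  · rw [image_eq_zero_of_notMem_tsupport fun h => hp (hχ h), zero_mul]
    rfl

theorem exists_mem_filt_coord_eq_single [DecidableEq ι] (hξ : tsupport ξ ⊆ s.carrier)
    (i : {i // C.deg i = t}) : ∃ ε : C.filt (t + 1),
      (∀ p ∈ s.carrier, C.coord (s.index p) p ε = Pi.single i.1 (ξ p)) := by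
  obtain ⟨ε, hε, hε0⟩ := C.exists_coord_eq s (Pi.single i.1 ξ) fun i' => by
    obtain rfl | h := eq_or_ne i' i
    · rwa [Pi.single_eq_same]
    · rw [Pi.single_eq_of_ne h]
      exact (tsupport_eq_empty_iff.2 rfl).trans_subset (Set.empty_subset _)
  have hε' : ∀ p ∈ s.carrier, C.coord (s.index p) p ε = Pi.single i.1 (ξ p) := by
    intro p hp
    rw [hε p hp]
    ext i'
    exact Pi.apply_single (fun _ (f : Fn n M) => f p) (fun _ => rfl) i.1 ξ i'
  refine ⟨⟨ε, mem_filt_of_exists fun p => ?_⟩, hε'⟩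
  by_cases hp : p ∈ s.carrier
  · refine ⟨_, s.mem_dom p hp, fun i' hi' => ?_⟩
    rw [hε' p hp, Pi.single_eq_of_ne]
    rintro rfl
    exact hi'.not_gt (Nat.lt_succ_of_le i.2.le)
  · exact ⟨p, C.mem_dom p, fun i' _ => congrFun (hε0 p hp) i'⟩

theorem smul_sub_sum_leadingCoord_smul_mem_filt [Fintype ι] [DecidableEq ι]
    (hχ : tsupport χ ⊆ s.carrier) {ε : {i // C.deg i = t} → C.filt (t + 1)}
    (hε : ∀ i, ∀ p ∈ s.carrier, C.coord (s.index p) p (ε i : P) = Pi.single i.1 (ξ p))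
    (T : C.filt (t + 1)) :
    ((χ * ξ) • T - ∑ i, leadingCoord s hχ t T i • ε i : C.filt (t + 1)).1 ∈ C.filt t := by
  have hcoord : ∀ p p₀, p ∈ C.dom p₀ → ∀ i, t ≤ C.deg i →
      C.coord p₀ p ((χ * ξ) • T - ∑ i, leadingCoord s hχ t T i • ε i : C.filt (t + 1)) i =
        χ p * (ξ p * C.coord p₀ p (T : P) i -
          ∑ i', C.coord (s.index p) p (T : P) i'.1 * C.coord p₀ p (ε i' : P) i) := by
    intro p p₀ hp i hi
    simp only [AddSubgroupClass.coe_sub, Submodule.coe_smul, Submodule.coe_sum, map_sub, map_sum,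
      Pi.sub_apply, Finset.sum_apply, coord_smul_of_mem_filt (Subtype.prop _) _ hp hi,
      leadingCoord_apply, ContMDiffMap.coe_mul, Pi.mul_apply, mul_sub, Finset.mul_sum, mul_assoc]
  refine mem_filt_of_exists fun p => ?_
  by_cases hp : p ∈ s.carrier
  · refine ⟨_, s.mem_dom p hp, fun i hi => ?_⟩
    rw [hcoord p _ (s.mem_dom p hp) i hi]
    simp only [hε _ p hp]
    obtain h | h := eq_or_ne (C.deg i) t
    · rw [Finset.sum_eq_single ⟨i, h⟩ _ (by simp), Pi.single_eq_same, mul_comm (ξ p), sub_self,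
        mul_zero]
      rintro i' - hne
      rw [Pi.single_eq_of_ne fun h' => hne (Subtype.ext h'.symm), mul_zero]
    · rw [T.2 p _ (s.mem_dom p hp) i (hi.lt_of_ne' h), Finset.sum_eq_zero, mul_zero, sub_zero,
        mul_zero]
      rintro i' -
      rw [Pi.single_eq_of_ne fun h' => h ((congrArg C.deg h').trans i'.2), mul_zero]
  · refine ⟨p, C.mem_dom p, fun i hi => ?_⟩
    rw [hcoord p p (C.mem_dom p) i hi, image_eq_zero_of_notMem_tsupport fun h => hp (hχ h),
      zero_mul]

end Layer

variable [Finite ι] [T2Space M] [SecondCountableTopology M] [IsManifold (𝓡 n) ∞ M]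

variable (C) in
theorem finiteProjectiveMod_filt_succ (t : ℕ) :
    FiniteProjectiveMod (C.filt (t + 1)) (C.filt t) := by
  classical
  have := Fintype.ofFinite ι
  obtain ⟨s, χ, ξ, hχ, hξ, hsum⟩ := exists_selection_bump (n := n) C.isOpen_dom C.mem_dom
  choose ε hε using fun c => exists_mem_filt_coord_eq_single (t := t) (s c) (hξ c)
  let α : C.filt (t + 1) →ₗ[Fn n M] (Fin (n + 1) × {i // C.deg i = t} → Fn n M) :=
    LinearMap.pi fun a => LinearMap.proj a.2 ∘ₗ leadingCoord (s a.1) (hχ a.1) t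
  refine ⟨_, inferInstance, α, Fintype.linearCombination (Fn n M) fun a => ε a.1 a.2,
    fun T => ⟨?_, fun hT => ?_⟩⟩
  · have h : T - Fintype.linearCombination (Fn n M) (fun a => ε a.1 a.2) (α T) =
        ∑ c, ((χ c * ξ c) • T - ∑ i, leadingCoord (s c) (hχ c) t T i • ε c i) := by
      rw [Finset.sum_sub_distrib, ← Finset.sum_smul, hsum, one_smul,
        Fintype.linearCombination_apply, Fintype.sum_prod_type]
      rfl
    rw [← AddSubgroupClass.coe_sub, h, Submodule.coe_sum]
    exact sum_mem fun c _ => smul_sub_sum_leadingCoord_smul_mem_filt (s c) (hχ c) (hε c) T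
  · ext1 a
    exact congrFun (leadingCoord_eq_zero (s a.1) (hχ a.1) hT) a.2

variable (C) in
theorem finiteProjectiveMod_top_filt (t : ℕ) : FiniteProjectiveMod ⊤ (C.filt t) := by
  obtain ⟨m, hm⟩ := C.exists_filt_eq_top
  refine Nat.decreasingInduction' (P := fun t => FiniteProjectiveMod ⊤ (C.filt t))
    (fun k _ _ ih => ih.trans (C.finiteProjectiveMod_filt_succ k) le_top filt_le_filt_succ)
    (le_max_right m t) ?_
  rw [hm _ (le_max_left m t)]
  exact FiniteProjectiveMod.refl ⊤

theorem finite_projective (C : GradedCoords n M P ι) :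
    Module.Finite (Fn n M) P ∧ Module.Projective (Fn n M) P :=
  FiniteProjectiveMod.finite_projective (C.filt_zero ▸ C.finiteProjectiveMod_top_filt 0)

variable (C) in
theorem exists_isCompl_filt (t : ℕ) : ∃ Q, IsCompl (C.filt t) Q :=
  (C.finiteProjectiveMod_top_filt t).exists_isCompl

end GradedCoords

end GradedCoords

section IteratedDerivatives

variable {V W : Type*} [NormedAddCommGroup V] [NormedSpace ℝ V] [NormedAddCommGroup W]
  [NormedSpace ℝ W] {f : V → W} {x : V} {j : ℕ}

theorem differentiableAt_iteratedFDeriv (hf : ContDiffAt ℝ ∞ f x) (j : ℕ) :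
    DifferentiableAt ℝ (iteratedFDeriv ℝ j f) x :=
  (hf.iteratedFDeriv_right (m := ∞) (i := j) (mod_cast le_top)).differentiableAt (by simp)

theorem contDiffAt_iteratedFDeriv_apply (hf : ContDiffAt ℝ ∞ f x) (v : Fin j → V) :
    ContDiffAt ℝ ∞ (fun y => iteratedFDeriv ℝ j f y v) x :=
  ((ContinuousMultilinearMap.apply ℝ (fun _ : Fin j => V) W v).contDiff.contDiffAt).comp x
    (hf.iteratedFDeriv_right (m := ∞) (i := j) (mod_cast le_top))

theorem iteratedFDeriv_add_two_apply (hf : ∀ᶠ y in nhds x, ContDiffAt ℝ ∞ f y)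
    (v : Fin (j + 2) → V) : iteratedFDeriv ℝ (j + 2) f x v =
      fderiv ℝ (fderiv ℝ fun y => iteratedFDeriv ℝ j f y (Fin.tail (Fin.tail v))) x
        (v 0) (v 1) := by
  have hx := hf.self_of_nhds
  have hfirst : (fun y => iteratedFDeriv ℝ (j + 1) f y (Fin.tail v)) =ᶠ[nhds x]
      fun y => fderiv ℝ (fun y => iteratedFDeriv ℝ j f y (Fin.tail (Fin.tail v))) y (v 1) := by
    filter_upwards [hf] with y hy
    exact (differentiableAt_iteratedFDeriv hy j).iteratedFDeriv_succ_apply_left'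
  have hdiff := ((contDiffAt_iteratedFDeriv_apply hx (Fin.tail (Fin.tail v))).fderiv_right
    (m := ∞) (by simp)).differentiableAt (by simp)
  rw [(differentiableAt_iteratedFDeriv hx _).iteratedFDeriv_succ_apply_left', hfirst.fderiv_eq,
    fderiv_clm_apply hdiff (differentiableAt_const _)]
  simp

theorem iteratedFDeriv_comp_swap_zero_one (hf : ∀ᶠ y in nhds x, ContDiffAt ℝ ∞ f y)
    (v : Fin (j + 2) → V) :
    iteratedFDeriv ℝ (j + 2) f x (v ∘ Equiv.swap 0 1) = iteratedFDeriv ℝ (j + 2) f x v := by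
  have htail : Fin.tail (Fin.tail (v ∘ Equiv.swap 0 1)) = Fin.tail (Fin.tail v) := by
    funext m
    simp only [Fin.tail, Function.comp_apply]
    rw [Equiv.swap_apply_of_ne_of_ne] <;> simp [Fin.ext_iff]
  have hsymm := (contDiffAt_iteratedFDeriv_apply hf.self_of_nhds
    (Fin.tail (Fin.tail v))).isSymmSndFDerivAt
    (by rw [minSmoothness_of_isRCLikeNormedField]; exact ENat.LEInfty.out)
  rw [iteratedFDeriv_add_two_apply hf, iteratedFDeriv_add_two_apply hf, htail]
  simpa using hsymm (v 1) (v 0)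

theorem iteratedFDeriv_comp_swap_castSucc_succ (hf : ∀ᶠ y in nhds x, ContDiffAt ℝ ∞ f y)
    (i : Fin j) (v : Fin (j + 1) → V) :
    iteratedFDeriv ℝ (j + 1) f x (v ∘ Equiv.swap i.castSucc i.succ) =
      iteratedFDeriv ℝ (j + 1) f x v := by
  induction j generalizing x with
  | zero => exact i.elim0
  | succ j ih =>
    induction i using Fin.cases with
    | zero => exact iteratedFDeriv_comp_swap_zero_one hf v
    | succ i =>
      have hhead : (v ∘ Equiv.swap i.succ.castSucc i.succ.succ) 0 = v 0 := by
        simp only [Function.comp_apply]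
        rw [Equiv.swap_apply_of_ne_of_ne] <;> simp [Fin.ext_iff]
      have htail : Fin.tail (v ∘ Equiv.swap i.succ.castSucc i.succ.succ) =
          Fin.tail v ∘ Equiv.swap i.castSucc i.succ := by
        funext m
        simp only [Fin.tail, Function.comp_apply]
        rw [← Fin.succ_castSucc, ← (Fin.succ_injective (j + 1)).map_swap]
      have hx := differentiableAt_iteratedFDeriv hf.self_of_nhds (j + 1)
      rw [hx.iteratedFDeriv_succ_apply_left', hx.iteratedFDeriv_succ_apply_left', hhead, htail]
      congr 1
      refine Filter.EventuallyEq.fderiv_eq ?_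
      filter_upwards [hf.eventually_nhds] with y hy
      exact ih hy i _

theorem iteratedFDeriv_comp_perm (hf : ∀ᶠ y in nhds x, ContDiffAt ℝ ∞ f y) (v : Fin j → V)
    (σ : Equiv.Perm (Fin j)) :
    iteratedFDeriv ℝ j f x (v ∘ σ) = iteratedFDeriv ℝ j f x v := by
  cases j with
  | zero => congr 1; ext m; exact m.elim0
  | succ j =>
    have hσ : σ ∈ Submonoid.closure (Set.range fun i : Fin j => Equiv.swap i.castSucc i.succ) := by
      rw [Equiv.Perm.mclosure_swap_castSucc_succ]
      trivial
    induction hσ using Submonoid.closure_induction generalizing v with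
    | one => rfl
    | mul σ τ _ _ hσ hτ => rw [Equiv.Perm.coe_mul, ← Function.comp_assoc, hτ, hσ]
    | mem σ h =>
      obtain ⟨i, rfl⟩ := h
      exact iteratedFDeriv_comp_swap_castSucc_succ hf i v

theorem iteratedFDeriv_exp_sub_const (L : V →L[ℝ] ℝ) (c : ℝ) (x : V) (v : Fin j → V) :
    iteratedFDeriv ℝ j (fun y => Real.exp (L y - c)) x v =
      (∏ m, L (v m)) * Real.exp (L x - c) := by
  induction j generalizing x with
  | zero => simp
  | succ j ih =>
    have hsmooth : ContDiff ℝ ∞ fun y => Real.exp (L y - c) :=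
      (L.contDiff.sub contDiff_const).exp
    have hderiv : HasFDerivAt (fun y => Real.exp (L y - c)) (Real.exp (L x - c) • L) x :=
      (L.hasFDerivAt.sub_const c).exp
    rw [(differentiableAt_iteratedFDeriv hsmooth.contDiffAt j).iteratedFDeriv_succ_apply_left']
    simp only [ih]
    rw [(hderiv.const_mul _).fderiv, Fin.prod_univ_succ]
    simp only [Fin.tail, smul_apply, smul_eq_mul]
    ring

end IteratedDerivatives

section LocalExtension

variable {n : ℕ} {M : Type*} [TopologicalSpace M] [ChartedSpace (Rn n) M]

section StdFrame

variable {d : ℕ} {E : M → Type*} [TopologicalSpace (TotalSpace (Rn d) E)]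
  [∀ x, AddCommGroup (E x)] [∀ x, TopologicalSpace (E x)] [FiberBundle (Rn d) E]

/-- The standard basis of `ℝᵈ`. -/
abbrev stdBasis (d : ℕ) : Basis (Fin d) ℝ (Rn d) := (EuclideanSpace.basisFun (Fin d) ℝ).toBasis

variable [∀ x, Module ℝ (E x)]

/-- The local frame of `E` around `p₀`, the image of the standard basis of `ℝᵈ` under the
trivialization of `E` at `p₀`. -/
abbrev stdFrame (p₀ : M) (m : Fin d) (p : M) : E p :=
  (trivializationAt (Rn d) E p₀).symm p (EuclideanSpace.single m 1)

theorem localFrame_stdBasis_apply [VectorBundle ℝ (Rn d) E] {p₀ p : M}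
    (hp : p ∈ (trivializationAt (Rn d) E p₀).baseSet) (m : Fin d) :
    (trivializationAt (Rn d) E p₀).localFrame (stdBasis d) m p = stdFrame p₀ m p := by
  rw [Trivialization.localFrame_apply_of_mem_baseSet _ _ hp]
  simp [Trivialization.basisAt, stdBasis]

theorem exists_smooth_coeffs_eq_sum_stdFrame [VectorBundle ℝ (Rn d) E]
    [ContMDiffVectorBundle ∞ (Rn d) E (𝓡 n)] (p₀ : M) (s : Cₛ^∞⟮𝓡 n; Rn d, E⟯) :
    ∃ a : Fin d → M → ℝ,
      (∀ m, ContMDiffOn (𝓡 n) 𝓘(ℝ) ∞ (a m) (trivializationAt (Rn d) E p₀).baseSet) ∧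
      ∀ p ∈ (trivializationAt (Rn d) E p₀).baseSet, s p = ∑ m, a m p • stdFrame p₀ m p := by
  let e := trivializationAt (Rn d) E p₀
  have : ContMDiffVectorBundle 1 (Rn d) E (𝓡 n) :=
    ContMDiffVectorBundle.of_le (n := ∞) (by simp)
  refine ⟨fun m p => e.localFrameCoeff (𝓡 n) (stdBasis d) m p (s p), fun m p hp =>
    (contMDiffAt_localFrameCoeff (e := e) _ hp s.contMDiff.contMDiffAt m).contMDiffWithinAt,
    fun p hp => ?_⟩
  refine (e.eq_sum_localFrameCoeff_smul (I := 𝓡 n) (b := stdBasis d) (s := fun x => s x) hp).trans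
    (Finset.sum_congr rfl fun m _ => ?_)
  rw [localFrame_stdBasis_apply hp]

end StdFrame

variable [T2Space M] [IsManifold (𝓡 n) ∞ M]

theorem exists_eventuallyEq_one_tsupport_subset {q : M} {u : Set M} (hu : u ∈ nhds q) :
    ∃ χ : Fn n M, χ =ᶠ[nhds q] 1 ∧ tsupport χ ⊆ u := by
  obtain ⟨f, -, hf⟩ := (SmoothBumpFunction.nhds_basis_tsupport (I := 𝓡 n) q).mem_iff.1 hu
  exact ⟨⟨f, f.contMDiff⟩, f.eventuallyEq_one, hf⟩

theorem exists_fn_eventuallyEq {g : M → ℝ} {u : Set M} (hu : IsOpen u)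
    (hg : ContMDiffOn (𝓡 n) 𝓘(ℝ) ∞ g u) {q : M} (hq : q ∈ u) :
    ∃ f : Fn n M, f =ᶠ[nhds q] g := by
  obtain ⟨χ, hχ, hsupp⟩ := exists_eventuallyEq_one_tsupport_subset (n := n) (hu.mem_nhds hq)
  refine ⟨⟨fun p => χ p * g p, contMDiff_of_tsupport fun p hp => ?_⟩, ?_⟩
  · have : p ∈ u := hsupp (closure_mono (Function.support_mul_subset_left _ _) hp)
    exact χ.contMDiff.contMDiffAt.mul (hg.contMDiffAt (hu.mem_nhds this))
  · filter_upwards [hχ] with p hp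
    change χ p * g p = g p
    rw [hp, Pi.one_apply, one_mul]

variable {d : ℕ} {E : M → Type*} [TopologicalSpace (TotalSpace (Rn d) E)]
  [∀ x, AddCommGroup (E x)] [∀ x, Module ℝ (E x)] [∀ x, TopologicalSpace (E x)]
  [FiberBundle (Rn d) E] [VectorBundle ℝ (Rn d) E]
  [ContMDiffVectorBundle ∞ (Rn d) E (𝓡 n)]

theorem exists_section_eventuallyEq_stdFrame {p₀ q : M}
    (hq : q ∈ (trivializationAt (Rn d) E p₀).baseSet) (m : Fin d) :
    ∃ s : Cₛ^∞⟮𝓡 n; Rn d, E⟯, ∀ᶠ p in nhds q, s p = stdFrame p₀ m p := by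
  let e := trivializationAt (Rn d) E p₀
  obtain ⟨χ, hχ, hsupp⟩ :=
    exists_eventuallyEq_one_tsupport_subset (n := n) (e.open_baseSet.mem_nhds hq)
  have hs := ContMDiffOn.smul_section_of_tsupport (I := 𝓡 n) (F := Rn d) (V := E)
    (χ.contMDiff.contMDiffOn (s := e.baseSet)) e.open_baseSet hsupp
    (s := e.localFrame (stdBasis d) m) fun p hp =>
      (contMDiffAt_localFrame_of_mem (I := 𝓡 n) ∞ e (stdBasis d) m hp).contMDiffWithinAt
  refine ⟨⟨_, hs⟩, ?_⟩
  filter_upwards [hχ, e.open_baseSet.mem_nhds hq] with p hp hpe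
  change χ p • e.localFrame (stdBasis d) m p = _
  rw [hp, localFrame_stdBasis_apply hpe, Pi.one_apply, one_smul]

theorem exists_section_eventuallyEq_symm {p₀ q : M}
    (hq : q ∈ (trivializationAt (Rn d) E p₀).baseSet) (v : Rn d) :
    ∃ s : Cₛ^∞⟮𝓡 n; Rn d, E⟯, ∀ᶠ p in nhds q, s p = (trivializationAt (Rn d) E p₀).symm p v := by
  let e := trivializationAt (Rn d) E p₀
  choose s hs using fun m => exists_section_eventuallyEq_stdFrame (n := n) (E := E) hq m
  refine ⟨∑ m, v m • s m, ?_⟩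
  filter_upwards [Filter.eventually_all.2 hs, e.open_baseSet.mem_nhds hq] with p hp hpe
  have hsum : (∑ m, v m • s m) p = ∑ m, v m • s m p := by
    have := congrFun (map_sum (ContMDiffSection.coeAddHom (𝓡 n) (Rn d) ∞ E)
      (fun m => v m • s m) Finset.univ) p
    rwa [Finset.sum_apply] at this
  rw [hsum, ← e.symmₗ_apply (R := ℝ) hpe]
  conv_rhs => rw [← (stdBasis d).sum_repr v, map_sum]
  refine Finset.sum_congr rfl fun m _ => ?_
  rw [hp m, map_smul, e.symmₗ_apply hpe]
  simp [stdBasis, e]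

theorem exists_section_apply_eq (p : M) (v : E p) : ∃ s : Cₛ^∞⟮𝓡 n; Rn d, E⟯, s p = v := by
  let e := trivializationAt (Rn d) E p
  have hp : p ∈ e.baseSet := FiberBundle.mem_baseSet_trivializationAt' p
  obtain ⟨s, hs⟩ := exists_section_eventuallyEq_symm (n := n) (E := E) hp (e.linearMapAt ℝ p v)
  refine ⟨s, hs.self_of_nhds.trans ?_⟩
  rw [← e.symmₗ_apply (R := ℝ) hp, e.symmₗ_linearMapAt hp]

end LocalExtension

section LocalFrame

variable {n : ℕ} {M : Type*} [TopologicalSpace M] [ChartedSpace (Rn n) M]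
  {d : ℕ} {E : M → Type*} [TopologicalSpace (TotalSpace (Rn d) E)]
  [∀ x, TopologicalSpace (E x)] [FiberBundle (Rn d) E] {k j r : ℕ} {p₀ p : M}

theorem isOpen_dom (p₀ : M) : IsOpen (dom n d E p₀) :=
  (chartAt (Rn n) p₀).open_source.inter (trivializationAt (Rn d) E p₀).open_baseSet

theorem mem_dom_self (p₀ : M) : p₀ ∈ dom n d E p₀ :=
  ⟨mem_chart_source _ p₀, FiberBundle.mem_baseSet_trivializationAt' p₀⟩

variable [∀ x, AddCommGroup (E x)] [∀ x, Module ℝ (E x)]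

/-- The component `η_K`, read in the chart at `p₀`; the word `K` is arbitrary. -/
def component (p₀ : M) (K : Fin k → Fin d) (η : Form n d E k) : Rn n → ℝ := fun x =>
  η.1 ((chartAt (Rn n) p₀).symm x) fun l => stdFrame p₀ (K l) ((chartAt (Rn n) p₀).symm x)

theorem component_add (K : Fin k → Fin d) (η θ : Form n d E k) :
    component p₀ K (η + θ) = component p₀ K η + component p₀ K θ := rfl

theorem component_smul (K : Fin k → Fin d) (c : ℝ) (η : Form n d E k) :
    component p₀ K (c • η) = c • component p₀ K η := rfl

theorem component_comp_perm (K : Fin k → Fin d) (η : Form n d E k) (σ : Equiv.Perm (Fin k)) :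
    component p₀ (K ∘ σ) η = Equiv.Perm.sign σ • component p₀ K η :=
  funext fun x => (η.1 ((chartAt (Rn n) p₀).symm x)).map_perm
    (fun l => stdFrame p₀ (K l) ((chartAt (Rn n) p₀).symm x)) σ

theorem component_eq_zero {K : Fin k → Fin d} (hK : ¬ Function.Injective K) (η : Form n d E k) :
    component p₀ K η = 0 :=
  funext fun _ => AlternatingMap.map_eq_zero_of_not_injective _ _ fun h =>
    hK fun _ _ hab => h (congrArg (fun m => stdFrame p₀ m _) hab)

/-- The partial derivative `∂_w η_K` at `p` for an arbitrary word `w`. -/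
def partialDeriv (p₀ : M) (K : Fin k → Fin d) (w : Fin j → Fin n) (p : M) (η : Form n d E k) :
    ℝ :=
  iteratedFDeriv ℝ j (component p₀ K η) (chartAt (Rn n) p₀ p)
    fun m => EuclideanSpace.single (w m) 1

theorem partialDeriv_zero (hp : p ∈ dom n d E p₀) (K : Fin k → Fin d) (w : Fin 0 → Fin n)
    (η : Form n d E k) : partialDeriv p₀ K w p η = η.1 p fun l => stdFrame p₀ (K l) p := by
  have hcongr : ∀ x, x = p → (η.1 x fun l => stdFrame p₀ (K l) x) =
      η.1 p fun l => stdFrame p₀ (K l) p := by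
    rintro x rfl
    rfl
  exact hcongr _ ((chartAt (Rn n) p₀).left_inv hp.1)

variable [IsManifold (𝓡 n) ∞ M]

theorem eventually_contDiffAt_component (hp : p ∈ dom n d E p₀) (K : Fin k → Fin d)
    (η : Form n d E k) :
    ∀ᶠ y in nhds (chartAt (Rn n) p₀ p), ContDiffAt ℝ ∞ (component p₀ K η) y := by
  let φ := chartAt (Rn n) p₀
  let u := φ.target ∩ φ.symm ⁻¹' (trivializationAt (Rn d) E p₀).baseSet
  have hu : IsOpen u := φ.isOpen_inter_preimage_symm (trivializationAt (Rn d) E p₀).open_baseSet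
  have hs : ContDiffOn ℝ ∞ (component p₀ K η) u := by
    rw [← contMDiffOn_iff_contDiffOn]
    exact (η.2 p₀ fun l => EuclideanSpace.single (K l) 1).comp
      ((contMDiffOn_chart_symm (x := p₀) (n := ∞)).mono fun x hx => hx.1) fun x hx => hx.2
  have hpu : φ p ∈ u := ⟨φ.map_source hp.1, by simpa [φ.left_inv hp.1] using hp.2⟩
  filter_upwards [hu.mem_nhds hpu] with y hy
  exact hs.contDiffAt (hu.mem_nhds hy)

theorem contDiffAt_component (hp : p ∈ dom n d E p₀) (K : Fin k → Fin d) (η : Form n d E k) :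
    ContDiffAt ℝ ∞ (component p₀ K η) (chartAt (Rn n) p₀ p) :=
  (eventually_contDiffAt_component hp K η).self_of_nhds

theorem contMDiffAt_partialDeriv (hp : p ∈ dom n d E p₀) (K : Fin k → Fin d) (w : Fin j → Fin n)
    (η : Form n d E k) : ContMDiffAt (𝓡 n) 𝓘(ℝ) ∞ (fun q => partialDeriv p₀ K w q η) p :=
  (contDiffAt_iteratedFDeriv_apply (contDiffAt_component hp K η) _).contMDiffAt.comp p
    (contMDiffAt_of_mem_maximalAtlas (n := ∞) (IsManifold.chart_mem_maximalAtlas p₀) hp.1)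

open Classical in
/-- The functional `η ↦ ∂_w η_K (p)`, with the junk value `0` outside the domain of the frame,
where `∂_w` need not be additive. -/
def partialDerivL (p₀ : M) (K : Fin k → Fin d) (w : Fin j → Fin n) (p : M) :
    Form n d E k →ₗ[ℝ] ℝ :=
  if hp : p ∈ dom n d E p₀ then
    have hsmooth (η : Form n d E k) : ContDiffAt ℝ j (component p₀ K η) (chartAt (Rn n) p₀ p) :=
      (contDiffAt_component hp K η).of_le (mod_cast le_top)
    { toFun := partialDeriv p₀ K w p
      map_add' := fun η θ => by
        rw [partialDeriv, component_add, iteratedFDeriv_add_apply (hsmooth η) (hsmooth θ)]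
        rfl
      map_smul' := fun c η => by
        rw [partialDeriv, component_smul, iteratedFDeriv_const_smul_apply (hsmooth η)]
        rfl }
  else 0

theorem partialDerivL_apply (hp : p ∈ dom n d E p₀) (K : Fin k → Fin d) (w : Fin j → Fin n)
    (η : Form n d E k) : partialDerivL p₀ K w p η = partialDeriv p₀ K w p η := by
  simp [partialDerivL, hp]

theorem partialDerivL_comp_perm (hp : p ∈ dom n d E p₀) (K : Fin k → Fin d) (w : Fin j → Fin n)
    (σ : Equiv.Perm (Fin j)) :
    (partialDerivL p₀ K (w ∘ σ) p : Form n d E k →ₗ[ℝ] ℝ) = partialDerivL p₀ K w p := by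
  ext η
  rw [partialDerivL_apply hp, partialDerivL_apply hp]
  exact iteratedFDeriv_comp_perm (eventually_contDiffAt_component hp K η)
    (fun m => EuclideanSpace.single (w m) 1) σ

theorem partialDerivL_comp_perm_left (hp : p ∈ dom n d E p₀) (K : Fin k → Fin d)
    (w : Fin j → Fin n) (σ : Equiv.Perm (Fin k)) :
    (partialDerivL p₀ (K ∘ σ) w p : Form n d E k →ₗ[ℝ] ℝ) =
      Equiv.Perm.sign σ • partialDerivL p₀ K w p := by
  ext η
  have hsmul (ε : ℤˣ) : (ε • partialDerivL p₀ K w p : Form n d E k →ₗ[ℝ] ℝ) η =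
      ε • partialDeriv p₀ K w p η := by
    rw [← partialDerivL_apply hp]
    rfl
  rw [partialDerivL_apply hp, hsmul, partialDeriv, component_comp_perm, partialDeriv]
  obtain h | h := Int.units_eq_one_or (Equiv.Perm.sign σ)
  · rw [h, one_smul, one_smul]
  · rw [h, Units.neg_smul, one_smul, Units.neg_smul, one_smul, iteratedFDeriv_neg_apply]
    rfl

theorem partialDerivL_eq_zero (hp : p ∈ dom n d E p₀) {K : Fin k → Fin d}
    (hK : ¬ Function.Injective K) (w : Fin j → Fin n) :
    (partialDerivL p₀ K w p : Form n d E k →ₗ[ℝ] ℝ) = 0 := by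
  ext η
  have hzero : iteratedFDeriv ℝ j (0 : Rn n → ℝ) (chartAt (Rn n) p₀ p) = 0 := by
    rw [Pi.zero_def, iteratedFDeriv_fun_zero]
    rfl
  rw [partialDerivL_apply hp, partialDeriv, component_eq_zero hK, hzero]
  rfl

/-- The members of the local frame `frame` as linear functionals, with the junk value `0` outside
the domain of the frame. -/
def frameL (p₀ : M) (i : Idx n d r k) (p : M) : Form n d E k →ₗ[ℝ] ℝ :=
  partialDerivL p₀ i.2 i.1.2 p

theorem frameL_apply (hp : p ∈ dom n d E p₀) (i : Idx n d r k) (η : Form n d E k) :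
    frameL p₀ i p η = frame p₀ i p η := partialDerivL_apply hp _ _ η

theorem partialDerivL_mem_span_frameL (hp : p ∈ dom n d E p₀) (hj : j ≤ r) (K : Fin k → Fin d)
    (w : Fin j → Fin n) : (partialDerivL p₀ K w p : Form n d E k →ₗ[ℝ] ℝ) ∈
      Submodule.span ℝ (Set.range fun i : Idx n d r k => frameL p₀ i p) := by
  by_cases hK : Function.Injective K
  · have hsort : StrictMono (K ∘ Tuple.sort K) :=
      (Tuple.monotone_sort K).strictMono_of_injective (hK.comp (Tuple.sort K).injective)
    let i : Idx n d r k := Prod.mk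
      (Sigma.mk ⟨j, Nat.lt_succ_of_le hj⟩ ⟨w ∘ Tuple.sort w, Tuple.monotone_sort w⟩)
      (OrderEmbedding.ofStrictMono _ hsort)
    have hi : (frameL p₀ i p : Form n d E k →ₗ[ℝ] ℝ) =
        Equiv.Perm.sign (Tuple.sort K) • partialDerivL p₀ K w p := by
      rw [← partialDerivL_comp_perm_left hp,
        ← partialDerivL_comp_perm hp (K ∘ Tuple.sort K) w (Tuple.sort w)]
      rfl
    rw [← inv_smul_eq_iff] at hi
    rw [← hi, Units.smul_def]
    exact zsmul_mem (Submodule.subset_span (Set.mem_range_self i)) _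
  · rw [partialDerivL_eq_zero hp hK]
    exact zero_mem _

theorem mfderiv_chartAt_symm (hp : p ∈ (chartAt (Rn n) p₀).source) (v : Rn n) :
    mfderiv (𝓡 n) 𝓘(ℝ, Rn n) (chartAt (Rn n) p₀) p
      ((trivializationAt (Rn n) (TangentSpace (𝓡 n)) p₀).symm p v) = v := by
  let e := trivializationAt (Rn n) (TangentSpace (𝓡 n)) p₀
  have hb : p ∈ e.baseSet := hp
  have hext : (extChartAt (𝓡 n) p₀ : M → Rn n) = chartAt (Rn n) p₀ := by
    ext1 q
    simp [extChartAt]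
  have he := TangentBundle.continuousLinearMapAt_trivializationAt (I := 𝓡 n) hp
  have hinv := e.continuousLinearMapAt_symmL (R := ℝ) hb v
  rw [hext] at he
  rw [he] at hinv
  rw [← Trivialization.symmL_apply (R := ℝ) _ hb]
  exact hinv

theorem mvfderiv_partialDeriv (hp : p ∈ dom n d E p₀) (K : Fin k → Fin d) (w : Fin j → Fin n)
    (η : Form n d E k) (m : Fin n) :
    mvfderiv (𝓡 n) (fun q => partialDeriv p₀ K w q η) p
        (stdFrame (E := TangentSpace (𝓡 n)) p₀ m p) =
      partialDeriv p₀ K (Fin.cons m w : Fin (j + 1) → Fin n) p η := by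
  let G : Rn n → ℝ := fun x =>
    iteratedFDeriv ℝ j (component p₀ K η) x fun m => EuclideanSpace.single (w m) 1
  have hG : ContDiffAt ℝ ∞ G (chartAt (Rn n) p₀ p) :=
    contDiffAt_iteratedFDeriv_apply (contDiffAt_component hp K η) _
  have hφ : MDifferentiableAt (𝓡 n) 𝓘(ℝ, Rn n) (chartAt (Rn n) p₀) p :=
    (contMDiffAt_of_mem_maximalAtlas (n := ∞)
      (IsManifold.chart_mem_maximalAtlas p₀) hp.1).mdifferentiableAt (by simp)
  have hchain := mvfderiv_comp_apply (g := G) (f := chartAt (Rn n) p₀) p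
    (hG.differentiableAt (by simp)).mdifferentiableAt hφ
    (stdFrame (E := TangentSpace (𝓡 n)) p₀ m p)
  rw [mfderiv_chartAt_symm hp.1] at hchain
  refine hchain.trans ?_
  rw [partialDeriv, (differentiableAt_iteratedFDeriv
    (contDiffAt_component hp K η) j).iteratedFDeriv_succ_apply_left']
  change (mfderiv 𝓘(ℝ, Rn n) 𝓘(ℝ) G _) _ = _
  rw [mfderiv_eq_fderiv]
  rfl

end LocalFrame

section LocalOperators

variable {n : ℕ} {M : Type*} [TopologicalSpace M] [ChartedSpace (Rn n) M]
  {d : ℕ} {E : M → Type*} [TopologicalSpace (TotalSpace (Rn d) E)]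
  [∀ x, AddCommGroup (E x)] [∀ x, Module ℝ (E x)] [∀ x, TopologicalSpace (E x)]
  [FiberBundle (Rn d) E] {k r j : ℕ} {p₀ p : M}

theorem mvfderiv_congr_of_eventuallyEq {f g : M → ℝ} {p : M} (h : f =ᶠ[nhds p] g)
    (v : TangentSpace (𝓡 n) p) : mvfderiv (𝓡 n) f p v = mvfderiv (𝓡 n) g p v :=
  DFunLike.congr_fun (h.mfderiv_eq (I := 𝓡 n) (I' := 𝓘(ℝ))) v

/-- Differential operators of order at most `r` with values in functions, written over `dom p₀` as
combinations of the partial derivatives of components with coefficients smooth there. -/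
def localOp (p₀ : M) (r k : ℕ) : Submodule ℝ (Form n d E k → M → ℝ) :=
  Submodule.span ℝ {R | ∃ a : M → ℝ, ContMDiffOn (𝓡 n) 𝓘(ℝ) ∞ a (dom n d E p₀) ∧
    ∃ j ≤ r, ∃ (w : Fin j → Fin n) (K : Fin k → Fin d),
      R = fun η p => a p * partialDeriv p₀ K w p η}

theorem mul_partialDeriv_mem_localOp {a : M → ℝ}
    (ha : ContMDiffOn (𝓡 n) 𝓘(ℝ) ∞ a (dom n d E p₀)) (hj : j ≤ r) (w : Fin j → Fin n)
    (K : Fin k → Fin d) :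
    (fun η p => a p * partialDeriv p₀ K w p η : Form n d E k → M → ℝ) ∈ localOp p₀ r k :=
  Submodule.subset_span ⟨a, ha, j, hj, w, K, rfl⟩

theorem localOp_mono {r' : ℕ} (h : r ≤ r') :
    (localOp p₀ r k : Submodule ℝ (Form n d E k → M → ℝ)) ≤ localOp p₀ r' k :=
  Submodule.span_mono fun _ ⟨a, ha, j, hj, w, K, e⟩ => ⟨a, ha, j, hj.trans h, w, K, e⟩

variable [IsManifold (𝓡 n) ∞ M]

theorem contMDiffAt_of_mem_localOp {R : Form n d E k → M → ℝ} (hR : R ∈ localOp p₀ r k)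
    (hp : p ∈ dom n d E p₀) (η : Form n d E k) : ContMDiffAt (𝓡 n) 𝓘(ℝ) ∞ (R η) p := by
  induction hR using Submodule.span_induction with
  | mem R h =>
    obtain ⟨a, ha, j, _, w, K, rfl⟩ := h
    exact (ha.contMDiffAt ((isOpen_dom p₀).mem_nhds hp)).mul (contMDiffAt_partialDeriv hp K w η)
  | zero => exact contMDiffAt_const
  | add R S _ _ hR hS => exact hR.add hS
  | smul c R _ hR => exact contMDiffAt_const.mul hR

theorem mdifferentiableAt_of_mem_localOp {R : Form n d E k → M → ℝ} (hR : R ∈ localOp p₀ r k)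
    (hp : p ∈ dom n d E p₀) (η : Form n d E k) : MDifferentiableAt (𝓡 n) 𝓘(ℝ) (R η) p :=
  (contMDiffAt_of_mem_localOp hR hp η).mdifferentiableAt (by simp)

theorem exists_mem_span_frameL_of_mem_localOp (hp : p ∈ dom n d E p₀) {R : Form n d E k → M → ℝ}
    (hR : R ∈ localOp p₀ r k) :
    ∃ S ∈ Submodule.span ℝ (Set.range fun i : Idx n d r k => frameL (E := E) p₀ i p),
      ∀ η, S η = R η p := by
  induction hR using Submodule.span_induction with
  | mem R h =>
    obtain ⟨a, _, j, hj, w, K, rfl⟩ := h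
    exact ⟨_, Submodule.smul_mem _ (a p) (partialDerivL_mem_span_frameL hp hj K w), fun η => by
      rw [LinearMap.smul_apply, partialDerivL_apply hp, smul_eq_mul]⟩
  | zero => exact ⟨0, zero_mem _, fun _ => rfl⟩
  | add R S _ _ hR hS =>
    obtain ⟨R', hR', hRR'⟩ := hR
    obtain ⟨S', hS', hSS'⟩ := hS
    exact ⟨_, add_mem hR' hS', fun η => congrArg₂ (· + ·) (hRR' η) (hSS' η)⟩
  | smul c R _ hR =>
    obtain ⟨R', hR', hRR'⟩ := hR
    exact ⟨_, Submodule.smul_mem _ c hR', fun η => congrArg (c * ·) (hRR' η)⟩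

section Derivative

variable [T2Space M]

theorem contMDiffOn_mvfderiv_apply (X : VF n M) {u : Set M} (hu : IsOpen u) {a : M → ℝ}
    (ha : ContMDiffOn (𝓡 n) 𝓘(ℝ) ∞ a u) :
    ContMDiffOn (𝓡 n) 𝓘(ℝ) ∞ (fun p => mvfderiv (𝓡 n) a p (X p)) u := by
  intro p hp
  obtain ⟨f, hf⟩ := exists_fn_eventuallyEq hu ha hp
  refine (((contMDiff_lie X f) p).congr_of_eventuallyEq ?_).contMDiffWithinAt
  filter_upwards [hf.eventuallyEq_nhds] with q hq
  exact mvfderiv_congr_of_eventuallyEq hq.symm (X q)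

theorem exists_mvfderiv_mul_partialDeriv_eq (X : VF n M) {a : M → ℝ}
    (ha : ContMDiffOn (𝓡 n) 𝓘(ℝ) ∞ a (dom n d E p₀)) (w : Fin j → Fin n) (K : Fin k → Fin d)
    (hj : j ≤ r) :
    ∃ R' ∈ (localOp p₀ (r + 1) k : Submodule ℝ (Form n d E k → M → ℝ)),
      ∀ η, ∀ p ∈ dom n d E p₀,
        mvfderiv (𝓡 n) (fun q => a q * partialDeriv p₀ K w q η) p (X p) = R' η p := by
  obtain ⟨c, hc, hX⟩ := exists_smooth_coeffs_eq_sum_stdFrame p₀ X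
  have hD : IsOpen (dom n d E p₀) := isOpen_dom p₀
  refine ⟨(∑ m : Fin n, fun η p => (a p * c m p) *
      partialDeriv p₀ K (Fin.cons m w : Fin (j + 1) → Fin n) p η) +
      fun η p => mvfderiv (𝓡 n) a p (X p) * partialDeriv p₀ K w p η, ?_, fun η p hp => ?_⟩
  · exact add_mem
      (sum_mem fun m _ => mul_partialDeriv_mem_localOp
        (ha.mul ((hc m).mono fun q hq => hq.1)) (by lia) _ K)
      (mul_partialDeriv_mem_localOp (contMDiffOn_mvfderiv_apply X hD ha) (by lia) w K)
  · have hleibniz := DFunLike.congr_fun (mvfderiv_mul (I := 𝓡 n)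
      ((ha.contMDiffAt (hD.mem_nhds hp)).mdifferentiableAt (by simp))
      ((contMDiffAt_partialDeriv hp K w η).mdifferentiableAt (by simp))) (X p)
    have hpartial : mvfderiv (𝓡 n) (fun q => partialDeriv p₀ K w q η) p (X p) =
        ∑ m, c m p * partialDeriv p₀ K (Fin.cons m w : Fin (j + 1) → Fin n) p η := by
      rw [hX p hp.1, map_sum]
      refine Finset.sum_congr rfl fun m _ => ?_
      rw [map_smul, mvfderiv_partialDeriv hp, smul_eq_mul]
    refine hleibniz.trans ?_
    change a p * mvfderiv (𝓡 n) (fun q => partialDeriv p₀ K w q η) p (X p) +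
      partialDeriv p₀ K w p η * mvfderiv (𝓡 n) a p (X p) = _
    simp only [hpartial, Pi.add_apply, Finset.sum_apply, Finset.mul_sum, mul_assoc,
      mul_comm (mvfderiv (𝓡 n) a p (X p))]

theorem exists_mvfderiv_eq_of_mem_localOp (X : VF n M) {R : Form n d E k → M → ℝ}
    (hR : R ∈ localOp p₀ r k) :
    ∃ R' ∈ (localOp p₀ (r + 1) k : Submodule ℝ (Form n d E k → M → ℝ)),
      ∀ η, ∀ p ∈ dom n d E p₀, mvfderiv (𝓡 n) (R η) p (X p) = R' η p := by
  induction hR using Submodule.span_induction with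
  | mem R h =>
    obtain ⟨a, ha, j, hj, w, K, rfl⟩ := h
    exact exists_mvfderiv_mul_partialDeriv_eq X ha w K hj
  | zero => exact ⟨0, zero_mem _, fun _ p _ => DFunLike.congr_fun mvfderiv_zero (X p)⟩
  | add R S hRm hSm hR hS =>
    obtain ⟨R', hR', hRR'⟩ := hR
    obtain ⟨S', hS', hSS'⟩ := hS
    refine ⟨R' + S', add_mem hR' hS', fun η p hp => ?_⟩
    change mvfderiv (𝓡 n) (R η + S η) p (X p) = R' η p + S' η p
    rw [mvfderiv_add (mdifferentiableAt_of_mem_localOp hRm hp η)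
      (mdifferentiableAt_of_mem_localOp hSm hp η), ← hRR' η p hp, ← hSS' η p hp]
    rfl
  | smul c R hRm hR =>
    obtain ⟨R', hR', hRR'⟩ := hR
    refine ⟨c • R', Submodule.smul_mem _ _ hR', fun η p hp => ?_⟩
    change mvfderiv (𝓡 n) ((fun _ : M => c) • R η) p (X p) = c * R' η p
    rw [mvfderiv_smul mdifferentiableAt_const (mdifferentiableAt_of_mem_localOp hRm hp η),
      mvfderiv_const, ← hRR' η p hp]
    simp

end Derivative

variable [∀ x, IsTopologicalAddGroup (E x)] [∀ x, ContinuousSMul ℝ (E x)]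
  [VectorBundle ℝ (Rn d) E] [ContMDiffVectorBundle ∞ (Rn d) E (𝓡 n)]

theorem exists_mem_localOp_eq_pair (p₀ : M) (s : Fin k → Cₛ^∞⟮𝓡 n; Rn d, E⟯) :
    ∃ R ∈ (localOp p₀ 0 k : Submodule ℝ (Form n d E k → M → ℝ)), ∀ η, ∀ p ∈ dom n d E p₀,
      pair s η p = R η p := by
  choose a ha hs using fun i => exists_smooth_coeffs_eq_sum_stdFrame (n := n) p₀ (s i)
  refine ⟨∑ K : Fin k → Fin d, fun η p => (∏ i, a i (K i) p) * partialDeriv p₀ K Fin.elim0 p η,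
    sum_mem fun K _ => mul_partialDeriv_mem_localOp (fun p hp => ?_) le_rfl _ K, fun η p hp => ?_⟩
  · exact (contMDiffAt_finsetProd fun i _ => ((ha i (K i)).mono fun q hq => hq.2).contMDiffAt
      ((isOpen_dom p₀).mem_nhds hp)).contMDiffWithinAt
  · rw [Finset.sum_apply, Finset.sum_apply]
    calc η.1 p (fun i => s i p)
        = η.1 p fun i => ∑ m, a i m p • stdFrame p₀ m p :=
          congrArg _ (funext fun i => hs i p hp.2)
      _ = ∑ K : Fin k → Fin d, η.1 p fun i => a i (K i) p • stdFrame p₀ (K i) p :=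
          (η.1 p).toMultilinearMap.map_sum fun i m => a i m p • stdFrame p₀ m p
      _ = ∑ K : Fin k → Fin d, (∏ i, a i (K i) p) * partialDeriv p₀ K Fin.elim0 p η :=
          Finset.sum_congr rfl fun K _ => by
            rw [partialDeriv_zero hp]
            exact (η.1 p).toMultilinearMap.map_smul_univ _ _

variable [T2Space M] (D₀ : CovariantDerivative (𝓡 n) (Rn n) (TangentSpace (𝓡 n) : M → Type _))
  [D₀.ContMDiffCovariantDerivative ∞]
  (D : CovariantDerivative (𝓡 n) (Rn d) E) [D.ContMDiffCovariantDerivative ∞]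

theorem exists_mem_localOp_eq_higherCov (p₀ : M) (j : ℕ) (X : Fin j → VF n M)
    (s : Fin k → Cₛ^∞⟮𝓡 n; Rn d, E⟯) :
    ∃ R ∈ (localOp p₀ j k : Submodule ℝ (Form n d E k → M → ℝ)), ∀ η, ∀ p ∈ dom n d E p₀,
      higherCov D₀ D j X s η p = R η p := by
  induction j generalizing s with
  | zero => exact exists_mem_localOp_eq_pair p₀ s
  | succ j ih =>
    obtain ⟨R, hR, hRX⟩ := ih (Fin.tail X) s
    obtain ⟨R', hR', hRR'⟩ := exists_mvfderiv_eq_of_mem_localOp (X 0) hR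
    choose A hA hAX using fun l => ih (Fin.tail X) (Function.update s l (cov D (X 0) (s l)))
    choose B hB hBX using fun i : Fin j =>
      ih (Function.update (Fin.tail X) i (cov D₀ (X 0) (Fin.tail X i))) s
    refine ⟨R' - ∑ l, A l - ∑ i, B i, ?_, fun η p hp => ?_⟩
    · exact sub_mem (sub_mem hR' (sum_mem fun l _ => localOp_mono (Nat.le_succ j) (hA l)))
        (sum_mem fun i _ => localOp_mono (Nat.le_succ j) (hB i))
    · have hlie : lie (X 0) (higherCov D₀ D j (Fin.tail X) s η) p = R' η p := by
        rw [← hRR' η p hp]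
        refine mvfderiv_congr_of_eventuallyEq ?_ (X 0 p)
        filter_upwards [(isOpen_dom p₀).mem_nhds hp] with q hq
        exact hRX η q hq
      change evalAt p (higherCov D₀ D (j + 1) X s η) = _
      simp only [higherCov, LinearMap.sub_apply, LinearMap.comp_apply, LinearMap.sum_apply, map_sub,
        map_sum]
      simp only [evalAt, LinearMap.coe_mk, AddHom.coe_mk, Pi.sub_apply, Finset.sum_apply, hlie,
        hAX _ η p hp, hBX _ η p hp]

theorem U_le_span_frameL (hp : p ∈ dom n d E p₀) : U D₀ D r k p ≤
    Submodule.span ℝ (Set.range fun i : Idx n d r k => frameL p₀ i p) := by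
  refine Submodule.span_le.2 ?_
  rintro T ⟨j, hj, X, s, rfl⟩
  obtain ⟨R, hR, hRX⟩ := exists_mem_localOp_eq_higherCov D₀ D p₀ j X s
  obtain ⟨S, hS, hSR⟩ := exists_mem_span_frameL_of_mem_localOp hp (localOp_mono hj hR)
  have hPhi : Phi D₀ D p j X s = S := LinearMap.ext fun η => (hRX η p hp).trans (hSR η).symm
  rwa [SetLike.mem_coe, hPhi]

theorem exists_mem_Op_eventuallyEq_partialDeriv {q : M} (hq : q ∈ dom n d E p₀)
    (w : Fin j → Fin n) (K : Fin k → Fin d) :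
    ∃ P ∈ Op D₀ D j k, ∀ᶠ p in nhds q, ∀ η, P η p = partialDeriv p₀ K w p η := by
  induction j with
  | zero =>
    choose s hs using fun l => exists_section_eventuallyEq_stdFrame (n := n) hq.2 (K l)
    refine ⟨_, Op_mem D₀ D le_rfl Fin.elim0 s, ?_⟩
    filter_upwards [Filter.eventually_all.2 hs, (isOpen_dom p₀).mem_nhds hq] with p hp hpd η
    change η.1 p (fun i => s i p) = _
    rw [partialDeriv_zero hpd, funext hp]
  | succ j ih =>
    obtain ⟨P, hP, hPw⟩ := ih (Fin.tail w)
    obtain ⟨X, hX⟩ := exists_section_eventuallyEq_stdFrame (n := n)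
      (E := (TangentSpace (𝓡 n) : M → Type _)) (p₀ := p₀) (q := q) hq.1 (w 0)
    refine ⟨_, lie_Op D₀ D X hP, ?_⟩
    filter_upwards [hPw.eventually_nhds, hX, (isOpen_dom p₀).mem_nhds hq] with p hp hXp hpd η
    have hlie : lie X (P η) p =
        mvfderiv (𝓡 n) (fun q => partialDeriv p₀ K (Fin.tail w) q η) p (X p) := by
      refine mvfderiv_congr_of_eventuallyEq ?_ (X p)
      filter_upwards [hp] with q hq using hq η
    rw [hlie, hXp, mvfderiv_partialDeriv hpd, Fin.cons_self_tail]

theorem partialDerivL_mem_U (hp : p ∈ dom n d E p₀) (hj : j ≤ r) (w : Fin j → Fin n)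
    (K : Fin k → Fin d) : partialDerivL p₀ K w p ∈ U D₀ D r k p := by
  obtain ⟨P, hP, hPw⟩ := exists_mem_Op_eventuallyEq_partialDeriv D₀ D hp w K
  obtain ⟨T, hT, hTP⟩ := Op_apply_mem D₀ D p (Op_mono D₀ D hj hP)
  have hw : partialDerivL p₀ K w p = T := LinearMap.ext fun η => by
    rw [partialDerivL_apply hp, hTP, hPw.self_of_nhds]
  rwa [hw]

theorem frameL_mem_U (hp : p ∈ dom n d E p₀) (i : Idx n d r k) : frameL p₀ i p ∈ U D₀ D r k p :=
  partialDerivL_mem_U D₀ D hp (Nat.le_of_lt_succ i.1.1.2) _ _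

end LocalOperators

section Minors

variable {n : ℕ} {M : Type*} [TopologicalSpace M] [ChartedSpace (Rn n) M] {d k : ℕ}

theorem contMDiffAt_det {ι : Type*} [Fintype ι] [DecidableEq ι] {A : M → Matrix ι ι ℝ} {p : M}
    (hA : ∀ a b, ContMDiffAt (𝓡 n) 𝓘(ℝ) ∞ (fun q => A q a b) p) :
    ContMDiffAt (𝓡 n) 𝓘(ℝ) ∞ (fun q => (A q).det) p := by
  simp only [Matrix.det_apply']
  exact ContMDiffAt.sum fun σ _ =>
    contMDiffAt_const.mul (contMDiffAt_finsetProd fun i _ => hA (σ i) i)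

/-- The minor of a `k × d` matrix, given by its rows, with column set `K`. -/
def minor (K : Fin k ↪o Fin d) : Rn d [⋀^Fin k]→ₗ[ℝ] ℝ :=
  Matrix.detRowAlternating.compLinearMap
    { toFun := fun v b => v (K b)
      map_add' := fun _ _ => rfl
      map_smul' := fun _ _ => rfl }

theorem minor_apply (K : Fin k ↪o Fin d) (v : Fin k → Rn d) :
    minor K v = (Matrix.of fun a b => v a (K b)).det := rfl

theorem orderEmbedding_eq_of_range_subset {K K' : Fin k ↪o Fin d}
    (h : Set.range K ⊆ Set.range K') : K = K' := by
  refine OrderEmbedding.range_inj.1 (Set.eq_of_subset_of_ncard_le h ?_)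
  rw [Set.ncard_range_of_injective K'.injective, Set.ncard_range_of_injective K.injective]

theorem minor_single (K K' : Fin k ↪o Fin d) :
    minor K' (fun a => EuclideanSpace.single (K a) 1) = if K = K' then 1 else 0 := by
  rw [minor_apply]
  split_ifs with hK
  · subst hK
    have hone : (Matrix.of fun a b => (EuclideanSpace.single (K a) (1 : ℝ) : Rn d) (K b)) = 1 := by
      ext a b
      simp [Matrix.one_apply, eq_comm]
    rw [hone, Matrix.det_one]
  · obtain ⟨_, ⟨a, rfl⟩, ha⟩ := Set.not_subset.1 (mt orderEmbedding_eq_of_range_subset hK)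
    exact Matrix.det_eq_zero_of_row_eq_zero a fun b => by
      simpa [Pi.single_apply] using fun hb => ha ⟨b, hb⟩

end Minors

section WordExponent

variable {n r : ℕ}

/-- The exponent vector of the monomial `∏ m, X (w m)`. -/
def wordExp {j : ℕ} (w : Fin j → Fin n) : Fin n →₀ ℕ := ∑ m, Finsupp.single (w m) 1

theorem monomial_wordExp {j : ℕ} (w : Fin j → Fin n) (a : ℝ) :
    MvPolynomial.monomial (wordExp w) a = MvPolynomial.C a * ∏ m, MvPolynomial.X (w m) := by
  rw [← mul_one a, ← MvPolynomial.C_mul_monomial, wordExp, MvPolynomial.monomial_sum_one, mul_one]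
  rfl

theorem toMultiset_wordExp {j : ℕ} (w : Fin j → Fin n) :
    Finsupp.toMultiset (wordExp w) = (List.ofFn w : Multiset (Fin n)) := by
  rw [wordExp, map_sum, ← Multiset.sum_map_singleton (List.ofFn w : Multiset (Fin n)),
    Multiset.map_coe, Multiset.sum_coe, List.map_ofFn, List.sum_ofFn]
  simp only [Finsupp.toMultiset_single, one_smul, Function.comp_apply]

theorem wordExp_injective : Function.Injective
    fun I : Σ j : Fin (r + 1), Fin j →o Fin n => wordExp (I.2 : Fin I.1 → Fin n) := by
  rintro ⟨⟨j, hj⟩, w⟩ ⟨⟨j', hj'⟩, w'⟩ h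
  have hperm : (List.ofFn (w : Fin j → Fin n)).Perm (List.ofFn (w' : Fin j' → Fin n)) := by
    rw [← Multiset.coe_eq_coe, ← toMultiset_wordExp, ← toMultiset_wordExp]
    exact congrArg _ h
  have hlist := hperm.eq_of_sortedLE (List.sortedLE_ofFn_iff.2 w.monotone)
    (List.sortedLE_ofFn_iff.2 w'.monotone)
  obtain rfl : j = j' := by simpa using congrArg List.length hlist
  congr 1
  exact OrderHom.ext _ _ (List.ofFn_injective hlist)

end WordExponent

section Independence

variable {n : ℕ} {M : Type*} [TopologicalSpace M] [ChartedSpace (Rn n) M] [IsManifold (𝓡 n) ∞ M]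
  {d : ℕ} {E : M → Type*} [TopologicalSpace (TotalSpace (Rn d) E)]
  [∀ x, AddCommGroup (E x)] [∀ x, Module ℝ (E x)] [∀ x, TopologicalSpace (E x)]
  [FiberBundle (Rn d) E] [VectorBundle ℝ (Rn d) E] {k r : ℕ} {p₀ p : M}

theorem linearMapAt_stdFrame (hp : p ∈ (trivializationAt (Rn d) E p₀).baseSet) (m : Fin d) :
    (trivializationAt (Rn d) E p₀).linearMapAt ℝ p (stdFrame p₀ m p) =
      EuclideanSpace.single m 1 := by
  rw [stdFrame, ← Trivialization.symmₗ_apply (R := ℝ) _ hp, Trivialization.linearMapAt_symmₗ _ hp]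

variable [T2Space M] [ContMDiffVectorBundle ∞ (Rn d) E (𝓡 n)]

theorem contMDiffAt_transition {p₁ q : M} (hq : q ∈ (trivializationAt (Rn d) E p₀).baseSet)
    (hq₁ : q ∈ (trivializationAt (Rn d) E p₁).baseSet) (v : Rn d) (m : Fin d) :
    ContMDiffAt (𝓡 n) 𝓘(ℝ) ∞ (fun p => ((trivializationAt (Rn d) E p₀).linearMapAt ℝ p
      ((trivializationAt (Rn d) E p₁).symm p v)) m) q := by
  let e := trivializationAt (Rn d) E p₀
  obtain ⟨s, hs⟩ := exists_section_eventuallyEq_symm (n := n) (E := E) hq₁ v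
  obtain ⟨a, ha, hsa⟩ := exists_smooth_coeffs_eq_sum_stdFrame (n := n) p₀ s
  refine ((ha m).contMDiffAt (e.open_baseSet.mem_nhds hq)).congr_of_eventuallyEq ?_
  filter_upwards [hs, e.open_baseSet.mem_nhds hq] with p hp hpe
  simp only [← hp, hsa p hpe, map_sum, map_smul, linearMapAt_stdFrame hpe]
  simp [Pi.single_apply]

theorem exists_form_eventuallyEq_smul_minor (hp : p ∈ dom n d E p₀) (K : Fin k ↪o Fin d)
    {h : M → ℝ} (hh : ContMDiffOn (𝓡 n) 𝓘(ℝ) ∞ h (dom n d E p₀)) :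
    ∃ η : Form n d E k, ∀ᶠ q in nhds p,
      η.1 q = h q • (minor K).compLinearMap ((trivializationAt (Rn d) E p₀).linearMapAt ℝ q) := by
  let e := trivializationAt (Rn d) E p₀
  have hD : IsOpen (dom n d E p₀) := isOpen_dom p₀
  obtain ⟨χ, hχ, hχD⟩ := exists_eventuallyEq_one_tsupport_subset (n := n) (hD.mem_nhds hp)
  refine ⟨⟨fun q => (χ q * h q) • (minor K).compLinearMap (e.linearMapAt ℝ q),
    fun p₁ v q hq => ContMDiffAt.contMDiffWithinAt ?_⟩, ?_⟩
  · by_cases hqs : q ∈ tsupport χ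
    · refine (χ.contMDiff.contMDiffAt.mul (hh.contMDiffAt (hD.mem_nhds (hχD hqs)))).mul ?_
      exact contMDiffAt_det (A := fun q => Matrix.of fun a b =>
        (e.linearMapAt ℝ q ((trivializationAt (Rn d) E p₁).symm q (v a))) (K b)) fun a b =>
        contMDiffAt_transition (hχD hqs).2 hq (v a) (K b)
    · refine (contMDiffAt_const (c := (0 : ℝ))).congr_of_eventuallyEq ?_
      filter_upwards [(isClosed_tsupport χ).isOpen_compl.mem_nhds hqs] with q' hq'
      simp [image_eq_zero_of_notMem_tsupport hq']
  · filter_upwards [hχ] with q hq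
    simp [hq, e]

theorem exists_form_component_eventuallyEq_exp (hp : p ∈ dom n d E p₀) (K : Fin k ↪o Fin d)
    (L : Rn n →L[ℝ] ℝ) :
    ∃ η : Form n d E k, ∀ K' : Fin k ↪o Fin d,
      component p₀ K' η =ᶠ[nhds (chartAt (Rn n) p₀ p)] (if K' = K then (1 : ℝ) else 0) •
        fun x => Real.exp (L x - L (chartAt (Rn n) p₀ p)) := by
  let φ := chartAt (Rn n) p₀
  have hsmooth : ContMDiffOn (𝓡 n) 𝓘(ℝ) ∞ (fun q => Real.exp (L (φ q) - L (φ p)))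
      (dom n d E p₀) := by
    have hexp : ContDiff ℝ ∞ fun x => Real.exp (L x - L (φ p)) :=
      (L.contDiff.sub contDiff_const).exp
    exact hexp.contMDiff.comp_contMDiffOn
      ((contMDiffOn_chart (x := p₀) (n := ∞)).mono fun q hq => hq.1)
  obtain ⟨η, hη⟩ := exists_form_eventuallyEq_smul_minor hp K hsmooth
  have hsymm : Filter.Tendsto φ.symm (nhds (φ p)) (nhds p) := by
    simpa only [φ.left_inv hp.1] using (φ.continuousAt_symm (φ.map_source hp.1)).tendsto
  refine ⟨η, fun K' => ?_⟩
  filter_upwards [hsymm.eventually hη, hsymm.eventually ((isOpen_dom (E := E) p₀).mem_nhds hp),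
    φ.open_target.mem_nhds (φ.map_source hp.1)] with x hηx hx hxφ
  have hminor : minor K (fun l => (trivializationAt (Rn d) E p₀).linearMapAt ℝ (φ.symm x)
      (stdFrame p₀ (K' l) (φ.symm x))) = if K' = K then 1 else 0 :=
    (congrArg _ (funext fun l => linearMapAt_stdFrame hx.2 (K' l))).trans (minor_single K' K)
  change η.1 (φ.symm x) (fun l => stdFrame p₀ (K' l) (φ.symm x)) = _
  rw [hηx, AlternatingMap.smul_apply, AlternatingMap.compLinearMap_apply, hminor,
    φ.right_inv hxφ, smul_eq_mul, mul_comm]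
  rfl

theorem exists_form_frame_eq_prod (hp : p ∈ dom n d E p₀) (K : Fin k ↪o Fin d) (ξ : Fin n → ℝ) :
    ∃ η : Form n d E k, ∀ {r : ℕ} (i : Idx n d r k), frame p₀ i p η =
      if i.2 = K then ∏ m, ξ (i.1.2 m) else 0 := by
  let φ := chartAt (Rn n) p₀
  let L : Rn n →L[ℝ] ℝ := ∑ m, ξ m • EuclideanSpace.proj m
  have hL : ∀ m, L (EuclideanSpace.single m 1) = ξ m := fun m => by simp [L]
  obtain ⟨η, hη⟩ := exists_form_component_eventuallyEq_exp hp K L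
  have hexp : ContDiff ℝ ∞ fun x => Real.exp (L x - L (φ p)) :=
    (L.contDiff.sub contDiff_const).exp
  refine ⟨η, fun {r} i => ?_⟩
  change partialDeriv p₀ i.2 i.1.2 p η = _
  rw [partialDeriv, ((hη i.2).iteratedFDeriv ℝ _).self_of_nhds,
    iteratedFDeriv_const_smul_apply (hexp.contDiffAt.of_le (mod_cast le_top))]
  change (if i.2 = K then (1 : ℝ) else 0) *
    iteratedFDeriv ℝ _ (fun x => Real.exp (L x - L (φ p))) (φ p) _ = _
  rw [iteratedFDeriv_exp_sub_const]
  simp [hL]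

/-- Testing a linear relation on forms with exponential components turns its coefficients into those
of a polynomial that vanishes identically. -/
theorem linearIndependent_frameL (hp : p ∈ dom n d E p₀) :
    LinearIndependent ℝ fun i : Idx n d r k => (frameL p₀ i p : Form n d E k →ₗ[ℝ] ℝ) := by
  classical
  rw [Fintype.linearIndependent_iff]
  rintro c hc ⟨I₀, K⟩
  let Q : MvPolynomial (Fin n) ℝ := ∑ i : Idx n d r k,
    if i.2 = K then MvPolynomial.monomial (wordExp (i.1.2 : Fin i.1.1 → Fin n)) (c i) else 0
  have hQ : Q = 0 := by
    refine MvPolynomial.funext fun ξ => ?_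
    obtain ⟨η, hη⟩ := exists_form_frame_eq_prod hp K ξ
    have hcη := LinearMap.congr_fun hc η
    simp only [LinearMap.sum_apply, LinearMap.smul_apply, smul_eq_mul, frameL_apply hp, hη,
      LinearMap.zero_apply] at hcη
    rw [map_zero, ← hcη, map_sum]
    refine Finset.sum_congr rfl fun i _ => ?_
    split_ifs with hi
    · simp [monomial_wordExp]
    · simp
  have hcoeff := congrArg (MvPolynomial.coeff (wordExp (I₀.2 : Fin I₀.1 → Fin n))) hQ
  rw [MvPolynomial.coeff_sum, Finset.sum_eq_single (I₀, K)] at hcoeff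
  · simpa using hcoeff
  · rintro ⟨I, K'⟩ _ hI
    by_cases hK : K' = K
    · subst hK
      rw [if_pos rfl, MvPolynomial.coeff_monomial, if_neg]
      exact fun h => hI (congrArg (·, K') (wordExp_injective h))
    · simp [hK]
  · simp

end Independence

section SmoothSections

theorem exists_dual_system {𝕜 V ι : Type*} [Field 𝕜] [AddCommMonoid V] [Module 𝕜 V] [Finite ι]
    [DecidableEq ι] {f : ι → V →ₗ[𝕜] 𝕜} (hf : LinearIndependent 𝕜 f) :
    ∃ v : ι → V, ∀ i l, f i (v l) = if l = i then 1 else 0 := by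
  cases nonempty_fintype ι
  have hsurj : LinearMap.range (LinearMap.pi f) = ⊤ := by
    by_contra hne
    obtain ⟨g, hg0, hg⟩ := Submodule.exists_le_ker_of_lt_top _ (lt_top_iff_ne_top.2 hne)
    have hrel : ∑ i, g (Pi.single i 1) • f i = 0 := LinearMap.ext fun v => by
      have hv : g (LinearMap.pi f v) = 0 := hg ⟨v, rfl⟩
      rw [← Finset.univ_sum_single (LinearMap.pi f v), map_sum] at hv
      rw [LinearMap.sum_apply, LinearMap.zero_apply, ← hv]
      refine Finset.sum_congr rfl fun i _ => ?_
      have hsingle : Pi.single i (f i v) = f i v • Pi.single i (1 : 𝕜) := by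
        rw [← Pi.single_smul, smul_eq_mul, mul_one]
      rw [LinearMap.pi_apply, hsingle, map_smul, LinearMap.smul_apply, smul_eq_mul, smul_eq_mul,
        mul_comm]
    exact hg0 <| LinearMap.pi_ext' fun i => LinearMap.ext_ring <| by
      simpa using Fintype.linearIndependent_iff.1 hf _ hrel i
  choose v hv using fun l : ι => LinearMap.range_eq_top.1 hsurj (Pi.single l 1)
  refine ⟨v, fun i l => ?_⟩
  rw [← LinearMap.pi_apply f, hv, Pi.single_apply]
  simp only [eq_comm]

variable {n : ℕ} {M : Type*} [TopologicalSpace M] [ChartedSpace (Rn n) M]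

theorem contMDiffAt_of_mulVec_eventuallyEq {ι : Type*} [Fintype ι] [DecidableEq ι]
    {B : M → Matrix ι ι ℝ} {b c : M → ι → ℝ} {q : M}
    (hB : ∀ l i, ContMDiffAt (𝓡 n) 𝓘(ℝ) ∞ (fun p => B p l i) q)
    (hb : ∀ l, ContMDiffAt (𝓡 n) 𝓘(ℝ) ∞ (fun p => b p l) q) (hdet : (B q).det ≠ 0)
    (hc : ∀ᶠ p in nhds q, (B p).mulVec (c p) = b p) (i : ι) :
    ContMDiffAt (𝓡 n) 𝓘(ℝ) ∞ (fun p => c p i) q := by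
  have hdetB := contMDiffAt_det hB
  have hcramer : ContMDiffAt (𝓡 n) 𝓘(ℝ) ∞ (fun p => (B p).cramer (b p) i) q := by
    simp only [Matrix.cramer_apply]
    refine contMDiffAt_det fun l i' => ?_
    simp only [Matrix.updateCol_apply]
    split_ifs
    · exact hb l
    · exact hB l i'
  have hinv : ContMDiffAt (𝓡 n) 𝓘(ℝ) ∞ (fun p => ((B p).det)⁻¹) q :=
    (contDiffAt_inv ℝ hdet).contMDiffAt.comp q hdetB
  refine (hinv.mul hcramer).congr_of_eventuallyEq ?_
  filter_upwards [hc, hdetB.continuousAt.eventually_ne hdet] with p hp hpdet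
  have hsolve : (B p).cramer (b p) i = (B p).det * c p i := by
    rw [← hp, Matrix.cramer_eq_adjugate_mulVec, Matrix.mulVec_mulVec, Matrix.adjugate_mul,
      Matrix.smul_mulVec, Matrix.one_mulVec]
    rfl
  rw [Pi.mul_apply, hsolve, inv_mul_cancel_left₀ hpdet]

variable [IsManifold (𝓡 n) ∞ M]
  {d : ℕ} {E : M → Type*} [TopologicalSpace (TotalSpace (Rn d) E)]
  [∀ x, AddCommGroup (E x)] [∀ x, Module ℝ (E x)] [∀ x, TopologicalSpace (E x)]
  [FiberBundle (Rn d) E] {r k : ℕ} {p₀ p : M}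

theorem contMDiffAt_frame (hp : p ∈ dom n d E p₀) (i : Idx n d r k) (η : Form n d E k) :
    ContMDiffAt (𝓡 n) 𝓘(ℝ) ∞ (fun q => frame p₀ i q η) p :=
  contMDiffAt_partialDeriv hp _ _ η

variable [∀ x, IsTopologicalAddGroup (E x)] [∀ x, ContinuousSMul ℝ (E x)]
  [VectorBundle ℝ (Rn d) E] [ContMDiffVectorBundle ∞ (Rn d) E (𝓡 n)]
  (D₀ : CovariantDerivative (𝓡 n) (Rn n) (TangentSpace (𝓡 n) : M → Type _))
  [D₀.ContMDiffCovariantDerivative ∞]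
  (D : CovariantDerivative (𝓡 n) (Rn d) E) [D.ContMDiffCovariantDerivative ∞]

theorem contMDiff_apply_of_mem_USec {T : ∀ p : M, U D₀ D r k p} (hT : T ∈ USec D₀ D r k)
    (η : Form n d E k) : ContMDiff (𝓡 n) 𝓘(ℝ) ∞ fun p => (T p).1 η := by
  intro q
  obtain ⟨a, ha, hTa⟩ := hT q
  have hq : q ∈ dom n d E q := mem_dom_self q
  have hD : dom n d E q ∈ nhds q := (isOpen_dom q).mem_nhds hq
  have hsum : ContMDiffAt (𝓡 n) 𝓘(ℝ) ∞ (fun p => ∑ i, a i p * frame q i p η) q :=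
    ContMDiffAt.sum fun i _ => ((ha i).contMDiffAt hD).mul (contMDiffAt_frame hq i η)
  refine hsum.congr_of_eventuallyEq ?_
  filter_upwards [hD] with p hp using hTa p hp η

variable [T2Space M]

/-- The basis of the fibre of `𝒰_k^r(E)` at `p` given by the local frame around `p₀`. -/
def frameBasis (hp : p ∈ dom n d E p₀) : Basis (Idx n d r k) ℝ (U D₀ D r k p) :=
  Basis.mk (v := fun i => ⟨frameL p₀ i p, frameL_mem_U D₀ D hp i⟩)
    (LinearIndependent.of_comp (U D₀ D r k p).subtype (linearIndependent_frameL hp)) (by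
      rintro ⟨T, hT⟩ -
      obtain ⟨c, rfl⟩ :=
        (Submodule.mem_span_range_iff_exists_fun ℝ).1 (U_le_span_frameL D₀ D hp hT)
      refine (Submodule.mem_span_range_iff_exists_fun ℝ).2 ⟨c, Subtype.ext ?_⟩
      simp)

theorem coe_frameBasis (hp : p ∈ dom n d E p₀) (i : Idx n d r k) :
    (frameBasis D₀ D hp i : Form n d E k →ₗ[ℝ] ℝ) = frameL p₀ i p := by
  simp [frameBasis]

open Classical in
/-- Coordinates in the local frame around `p₀`, with the junk value `0` outside its domain, so that
they are additive everywhere. -/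
def frameCoord (p₀ p : M) : U D₀ D r k p →ₗ[ℝ] (Idx n d r k → ℝ) :=
  if hp : p ∈ dom n d E p₀ then (frameBasis D₀ D hp).equivFun.toLinearMap else 0

theorem frameCoord_eq_repr (hp : p ∈ dom n d E p₀) (T : U D₀ D r k p) (i : Idx n d r k) :
    frameCoord D₀ D p₀ p T i = (frameBasis D₀ D hp).repr T i := by
  simp [frameCoord, hp]

theorem sum_frameCoord_smul (hp : p ∈ dom n d E p₀) (T : U D₀ D r k p) :
    ∑ i, frameCoord D₀ D p₀ p T i • frameBasis D₀ D hp i = T := by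
  simp only [frameCoord_eq_repr D₀ D hp]
  exact (frameBasis D₀ D hp).sum_repr T

theorem frameCoord_sum_smul (hp : p ∈ dom n d E p₀) (c : Idx n d r k → ℝ) :
    frameCoord D₀ D p₀ p (∑ i, c i • frameBasis D₀ D hp i) = c := by
  funext i
  rw [frameCoord_eq_repr D₀ D hp, Basis.repr_sum_self]

theorem frameCoord_frameBasis (hp : p ∈ dom n d E p₀) (i i' : Idx n d r k) [Decidable (i = i')] :
    frameCoord D₀ D p₀ p (frameBasis D₀ D hp i) i' = if i = i' then 1 else 0 := by
  rw [frameCoord_eq_repr D₀ D hp, Basis.repr_self, Finsupp.single_apply]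

theorem frameCoord_injective (hp : p ∈ dom n d E p₀) :
    Function.Injective (frameCoord (r := r) (k := k) D₀ D p₀ p) := fun S T h => by
  rw [← sum_frameCoord_smul D₀ D hp S, ← sum_frameCoord_smul D₀ D hp T, h]

theorem sum_smul_frameBasis_apply (hp : p ∈ dom n d E p₀) (c : Idx n d r k → ℝ)
    (η : Form n d E k) :
    (∑ i, c i • frameBasis D₀ D hp i).1 η = ∑ i, c i * frame p₀ i p η := by
  rw [Submodule.coe_sum, LinearMap.sum_apply]
  refine Finset.sum_congr rfl fun i _ => ?_
  rw [Submodule.coe_smul, coe_frameBasis, LinearMap.smul_apply, frameL_apply hp, smul_eq_mul]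

theorem apply_eq_sum_frameCoord (hp : p ∈ dom n d E p₀) (T : U D₀ D r k p) (η : Form n d E k) :
    T.1 η = ∑ i, frameCoord D₀ D p₀ p T i * frame p₀ i p η := by
  rw [← sum_smul_frameBasis_apply D₀ D hp, sum_frameCoord_smul]

theorem hasCoords_iff (hp : p ∈ dom n d E p₀) (T : U D₀ D r k p) (c : Idx n d r k → ℝ) :
    HasCoords p₀ p T.1 c ↔ frameCoord D₀ D p₀ p T = c := by
  constructor
  · intro h
    have hT : T = ∑ i, c i • frameBasis D₀ D hp i := by
      refine Subtype.ext (LinearMap.ext fun η => ?_)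
      rw [sum_smul_frameBasis_apply]
      exact h η
    rw [hT, frameCoord_sum_smul]
  · rintro rfl
    exact apply_eq_sum_frameCoord D₀ D hp T

theorem contMDiffAt_frameCoord {T : ∀ p : M, U D₀ D r k p}
    (hT : ∀ η, ContMDiff (𝓡 n) 𝓘(ℝ) ∞ fun p => (T p).1 η) (hp : p ∈ dom n d E p₀)
    (i : Idx n d r k) : ContMDiffAt (𝓡 n) 𝓘(ℝ) ∞ (fun q => frameCoord D₀ D p₀ q (T q) i) p := by
  classical
  obtain ⟨η, hη⟩ := exists_dual_system (linearIndependent_frameL (r := r) (k := k) hp)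
  let B : M → Matrix (Idx n d r k) (Idx n d r k) ℝ := fun q => Matrix.of fun l i =>
    frame p₀ i q (η l)
  have hB : B p = 1 := by
    ext l i
    change frame p₀ i p (η l) = _
    rw [← frameL_apply hp, hη, Matrix.one_apply]
  refine contMDiffAt_of_mulVec_eventuallyEq (B := B) (b := fun q l => (T q).1 (η l))
    (fun l i => contMDiffAt_frame hp i (η l)) (fun l => hT (η l) p)
    (by rw [hB, Matrix.det_one]; exact one_ne_zero) ?_ i
  filter_upwards [(isOpen_dom p₀).mem_nhds hp] with q hq
  funext l
  rw [apply_eq_sum_frameCoord D₀ D hq]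
  exact Finset.sum_congr rfl fun i _ => mul_comm _ _

theorem mem_USec_iff {T : ∀ p : M, U D₀ D r k p} :
    T ∈ USec D₀ D r k ↔ ∀ η, ContMDiff (𝓡 n) 𝓘(ℝ) ∞ fun p => (T p).1 η :=
  ⟨contMDiff_apply_of_mem_USec D₀ D, fun hT p₀ =>
    ⟨fun i p => frameCoord D₀ D p₀ p (T p) i, fun i _ hq =>
      (contMDiffAt_frameCoord D₀ D hT hq i).contMDiffWithinAt, fun _ hp =>
      (hasCoords_iff D₀ D hp _ _).2 rfl⟩⟩

theorem contMDiffOn_frameCoord {T : ∀ p : M, U D₀ D r k p} (hT : T ∈ USec D₀ D r k) (p₀ : M)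
    (i : Idx n d r k) :
    ContMDiffOn (𝓡 n) 𝓘(ℝ) ∞ (fun p => frameCoord D₀ D p₀ p (T p) i) (dom n d E p₀) := fun _ hq =>
  (contMDiffAt_frameCoord D₀ D ((mem_USec_iff D₀ D).1 hT) hq i).contMDiffWithinAt

theorem exists_mem_USec_of_mem_Op {P : Form n d E k → Fn n M} (hP : P ∈ Op D₀ D r k) :
    ∃ T ∈ USec D₀ D r k, ∀ p η, (T p).1 η = P η p := by
  choose T hT hTP using fun p => Op_apply_mem D₀ D p hP
  refine ⟨fun p => ⟨T p, hT p⟩, (mem_USec_iff D₀ D).2 fun η => ?_, hTP⟩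
  exact (P η).contMDiff.congr fun p => hTP p η

theorem exists_mem_Op_eventuallyEq_sum_frame {q : M} (hq : q ∈ dom n d E p₀)
    (f : Idx n d r k → Fn n M) :
    ∃ P ∈ Op D₀ D r k, ∀ᶠ p in nhds q, ∀ η, P η p = ∑ i, f i p * frame p₀ i p η := by
  choose P hP hPi using fun i : Idx n d r k =>
    exists_mem_Op_eventuallyEq_partialDeriv D₀ D hq i.1.2 i.2
  refine ⟨∑ i, f i • P i, sum_mem fun i _ => Submodule.smul_mem _ _
    (Op_mono D₀ D (Nat.le_of_lt_succ i.1.1.2) (hP i)), ?_⟩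
  filter_upwards [Filter.eventually_all.2 hPi] with p hp η
  rw [Finset.sum_apply]
  change evalAt p (∑ i, (f i • P i) η) = _
  rw [map_sum]
  exact Finset.sum_congr rfl fun i _ => congrArg (f i p * ·) (hp i η)

theorem exists_mem_Op_eventuallyEq {T : ∀ p : M, U D₀ D r k p} (hT : T ∈ USec D₀ D r k) (q : M) :
    ∃ P ∈ Op D₀ D r k, ∀ᶠ p in nhds q, ∀ η, (T p).1 η = P η p := by
  have hq : q ∈ dom n d E q := mem_dom_self q
  choose f hf using fun i : Idx n d r k =>
    exists_fn_eventuallyEq (isOpen_dom q) (contMDiffOn_frameCoord D₀ D hT q i) hq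
  obtain ⟨P, hP, hPf⟩ := exists_mem_Op_eventuallyEq_sum_frame D₀ D hq f
  refine ⟨P, hP, ?_⟩
  filter_upwards [hPf, Filter.eventually_all.2 hf, (isOpen_dom q).mem_nhds hq] with p hPp hfp hp η
  rw [hPp, apply_eq_sum_frameCoord D₀ D hp]
  exact Finset.sum_congr rfl fun i _ => congrArg (· * _) (hfp i).symm

theorem exists_mem_Op_apply_eq (T : U D₀ D r k p) : ∃ P ∈ Op D₀ D r k, ∀ η, T.1 η = P η p := by
  obtain ⟨P, hP, hPT⟩ := exists_mem_Op_eventuallyEq_sum_frame D₀ D (mem_dom_self p)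
    fun i => algebraMap ℝ (Fn n M) (frameCoord D₀ D p p T i)
  exact ⟨P, hP, fun η =>
    (apply_eq_sum_frameCoord D₀ D (mem_dom_self p) T η).trans (hPT.self_of_nhds η).symm⟩

end SmoothSections

section Filtration

variable {n : ℕ} {M : Type*} [TopologicalSpace M] [ChartedSpace (Rn n) M]

theorem contMDiff_of_tsupport_subset {ι : Type*} [Finite ι] {W : Set M} {a : ι → Fn n M}
    (ha : ∀ i, tsupport (a i) ⊆ W) {g : M → ℝ}
    (hW : ∀ p ∈ W, ContMDiffAt (𝓡 n) 𝓘(ℝ) ∞ g p) (h0 : ∀ p, (∀ i, a i p = 0) → g p = 0) :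
    ContMDiff (𝓡 n) 𝓘(ℝ) ∞ g := by
  intro q
  by_cases hq : q ∈ W
  · exact hW q hq
  · have hvanish : ∀ i, ∀ᶠ p in nhds q, a i p = 0 := fun i =>
      notMem_tsupport_iff_eventuallyEq.1 fun h => hq (ha i h)
    refine (contMDiffAt_const (c := (0 : ℝ))).congr_of_eventuallyEq ?_
    filter_upwards [Filter.eventually_all.2 hvanish] with p hp using h0 p hp

variable [IsManifold (𝓡 n) ∞ M]
  {d : ℕ} {E : M → Type*} [TopologicalSpace (TotalSpace (Rn d) E)]
  [∀ x, AddCommGroup (E x)] [∀ x, Module ℝ (E x)] [∀ x, TopologicalSpace (E x)]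
  [FiberBundle (Rn d) E]
  [∀ x, IsTopologicalAddGroup (E x)] [∀ x, ContinuousSMul ℝ (E x)]
  [VectorBundle ℝ (Rn d) E] [ContMDiffVectorBundle ∞ (Rn d) E (𝓡 n)]
  (D₀ : CovariantDerivative (𝓡 n) (Rn n) (TangentSpace (𝓡 n) : M → Type _))
  [D₀.ContMDiffCovariantDerivative ∞]
  (D : CovariantDerivative (𝓡 n) (Rn d) E) [D.ContMDiffCovariantDerivative ∞]
  {r k : ℕ} {p₀ p : M}

/-- The functionals of order less than `t`; those of order `0` are not of order less than `0`. -/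
def ULt (t k : ℕ) (p : M) : Submodule ℝ (Form n d E k →ₗ[ℝ] ℝ) :=
  match t with
  | 0 => ⊥
  | t + 1 => U D₀ D t k p

/-- The differential operators of order less than `t`. -/
def OpLt (t k : ℕ) : Submodule (Fn n M) (Form n d E k → Fn n M) :=
  match t with
  | 0 => ⊥
  | t + 1 => Op D₀ D t k

theorem U_mono {r r' : ℕ} (h : r ≤ r') : U D₀ D r k p ≤ U D₀ D r' k p :=
  Submodule.span_mono fun _ ⟨j, hj, X, s, e⟩ => ⟨j, hj.trans h, X, s, e⟩

theorem OpLt_mono {t t' : ℕ} (h : t ≤ t') : OpLt D₀ D t k ≤ OpLt D₀ D t' k := by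
  match t, t', h with
  | 0, _, _ => exact bot_le
  | t + 1, t' + 1, h => exact Op_mono D₀ D (Nat.le_of_succ_le_succ h)

theorem lie_mem_OpLt {t : ℕ} (X : VF n M) {P : Form n d E k → Fn n M} (hP : P ∈ OpLt D₀ D t k) :
    (fun η => lie X (P η)) ∈ OpLt D₀ D (t + 1) k := by
  match t with
  | 0 =>
    obtain rfl : P = 0 := hP
    simp only [Pi.zero_apply, map_zero]
    exact zero_mem _
  | t + 1 => exact lie_Op D₀ D X hP

theorem OpLt_apply_mem {t : ℕ} (p : M) {P : Form n d E k → Fn n M} (hP : P ∈ OpLt D₀ D t k) :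
    ∃ T ∈ ULt D₀ D t k p, ∀ η, T η = P η p := by
  match t with
  | 0 =>
    obtain rfl : P = 0 := hP
    exact ⟨0, zero_mem _, fun _ => rfl⟩
  | t + 1 => exact Op_apply_mem D₀ D p hP

theorem higherCov_mulForm_sub_mem_OpLt (f : Fn n M) (j : ℕ) (X : Fin j → VF n M)
    (s : Fin k → Cₛ^∞⟮𝓡 n; Rn d, E⟯) :
    (fun η => higherCov D₀ D j X s (mulForm f η)) - f • ⇑(higherCov D₀ D j X s) ∈
      OpLt D₀ D j k := by
  induction j generalizing s with
  | zero => exact sub_eq_zero.2 rfl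
  | succ j ih =>
    let R : (Fin j → VF n M) → (Fin k → Cₛ^∞⟮𝓡 n; Rn d, E⟯) → Form n d E k → Fn n M :=
      fun X s => (fun η => higherCov D₀ D j X s (mulForm f η)) - f • ⇑(higherCov D₀ D j X s)
    have hR (X s η) : higherCov D₀ D j X s (mulForm f η) =
        R X s η + f * higherCov D₀ D j X s η := by simp [R]
    have hrec : (fun η => higherCov D₀ D (j + 1) X s (mulForm f η)) -
        f • ⇑(higherCov D₀ D (j + 1) X s) =
        lie (X 0) f • ⇑(higherCov D₀ D j (Fin.tail X) s)
        + (fun η => lie (X 0) (R (Fin.tail X) s η))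
        - ∑ l : Fin k, R (Fin.tail X) (Function.update s l (cov D (X 0) (s l)))
        - ∑ i : Fin j, R (Function.update (Fin.tail X) i (cov D₀ (X 0) (Fin.tail X i))) s := by
      funext η
      simp only [Pi.sub_apply, Pi.add_apply, Pi.smul_apply, smul_eq_mul, Finset.sum_apply,
        higherCov, LinearMap.sub_apply, LinearMap.comp_apply, LinearMap.sum_apply, hR, map_add,
        lie_mul, Finset.sum_add_distrib, ← Finset.mul_sum]
      ring
    rw [hrec]
    refine sub_mem (sub_mem (add_mem (Submodule.smul_mem _ _ (Op_mem D₀ D le_rfl _ _))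
      (lie_mem_OpLt D₀ D _ (ih _ _))) ?_) ?_ <;>
    exact sum_mem fun _ _ => OpLt_mono D₀ D (Nat.le_succ j) (ih _ _)

theorem comp_mulForm_sub_smul_mem_ULt (f : Fn n M) {t : ℕ} {T : Form n d E k →ₗ[ℝ] ℝ}
    (hT : T ∈ U D₀ D t k p) : T ∘ₗ mulForm f - f p • T ∈ ULt D₀ D t k p := by
  let L : (Form n d E k →ₗ[ℝ] ℝ) →ₗ[ℝ] Form n d E k →ₗ[ℝ] ℝ :=
    LinearMap.lcomp ℝ ℝ (mulForm f) - f p • LinearMap.id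
  refine Submodule.span_le (p := (ULt D₀ D t k p).comap L) |>.2 ?_ hT
  rintro _ ⟨j, hj, X, s, rfl⟩
  obtain ⟨S, hS, hSX⟩ := OpLt_apply_mem D₀ D p
    (OpLt_mono D₀ D hj (higherCov_mulForm_sub_mem_OpLt D₀ D f j X s))
  have hLS : L (Phi D₀ D p j X s) = S := LinearMap.ext fun η => (hSX η).symm
  exact Submodule.mem_comap.2 (hLS.symm ▸ hS)

theorem exists_corner_eq_smul_add (f : Fn n M) {t : ℕ} {T : U D₀ D r k p}
    (hT : T.1 ∈ U D₀ D t k p) :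
    ∃ R : U D₀ D r k p, R.1 ∈ ULt D₀ D t k p ∧ corner D₀ D f p T = f p • T + R :=
  ⟨⟨T.1 ∘ₗ mulForm f - f p • T.1,
      sub_mem (corner_mem D₀ D f p T.1 T.2) (Submodule.smul_mem _ _ T.2)⟩,
    comp_mulForm_sub_smul_mem_ULt D₀ D f hT, Subtype.ext (add_sub_cancel _ _).symm⟩

theorem corner_one : corner (r := r) (k := k) D₀ D (1 : Fn n M) p = LinearMap.id := by
  refine LinearMap.ext fun T => Subtype.ext (LinearMap.ext fun η => congrArg T.1 ?_)
  ext q v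
  exact one_mul _

theorem corner_mul (f g : Fn n M) : corner (r := r) (k := k) D₀ D (f * g) p =
    corner D₀ D f p ∘ₗ corner D₀ D g p := by
  refine LinearMap.ext fun T => Subtype.ext (LinearMap.ext fun η => congrArg T.1 ?_)
  ext q v
  change f q * g q * _ = g q * (f q * _)
  ring

theorem corner_add (f g : Fn n M) : corner (r := r) (k := k) D₀ D (f + g) p =
    corner D₀ D f p + corner D₀ D g p := by
  refine LinearMap.ext fun T => Subtype.ext (LinearMap.ext fun η => ?_)
  refine (congrArg T.1 ?_).trans (map_add T.1 (mulForm f η) (mulForm g η))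
  ext q v
  exact add_mul _ _ _

theorem corner_zero : corner (r := r) (k := k) D₀ D (0 : Fn n M) p = 0 := by
  refine LinearMap.ext fun T => Subtype.ext (LinearMap.ext fun η => ?_)
  refine (congrArg T.1 ?_).trans (map_zero T.1)
  ext q v
  exact zero_mul _

variable [T2Space M]

theorem frameCoord_eq_zero_of_mem_U (hp : p ∈ dom n d E p₀) {t : ℕ} {T : U D₀ D r k p}
    (hT : T.1 ∈ U D₀ D t k p) {i : Idx n d r k} (hi : t < i.1.1) :
    frameCoord D₀ D p₀ p T i = 0 := by
  classical
  have htr : t < r := hi.trans_le (Nat.le_of_lt_succ i.1.1.2)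
  obtain ⟨c, hc⟩ := (Submodule.mem_span_range_iff_exists_fun ℝ).1 (U_le_span_frameL D₀ D hp hT)
  let incl : Idx n d t k → Idx n d r k := fun i' =>
    (⟨i'.1.1.castLE (Nat.succ_le_succ htr.le), i'.1.2⟩, i'.2)
  have hTc : T = ∑ i', c i' • frameBasis D₀ D hp (incl i') := by
    refine Subtype.ext ?_
    rw [← hc, Submodule.coe_sum]
    refine Finset.sum_congr rfl fun i' _ => ?_
    rw [Submodule.coe_smul, coe_frameBasis]
    rfl
  rw [hTc, map_sum, Finset.sum_apply]
  refine Finset.sum_eq_zero fun i' _ => ?_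
  have hne : incl i' ≠ i := by
    rintro rfl
    exact hi.not_ge (Nat.le_of_lt_succ i'.1.1.2)
  rw [map_smul, Pi.smul_apply, frameCoord_frameBasis, if_neg hne, smul_zero]

theorem mem_ULt_iff (hp : p ∈ dom n d E p₀) {t : ℕ} {T : U D₀ D r k p} :
    T.1 ∈ ULt D₀ D t k p ↔ ∀ i : Idx n d r k, t ≤ i.1.1 → frameCoord D₀ D p₀ p T i = 0 := by
  constructor
  · intro hT i hi
    match t with
    | 0 =>
      obtain rfl : T = 0 := Subtype.ext hT
      rw [map_zero, Pi.zero_apply]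
    | t + 1 => exact frameCoord_eq_zero_of_mem_U D₀ D hp hT hi
  · intro h
    rw [← sum_frameCoord_smul D₀ D hp T, Submodule.coe_sum]
    refine sum_mem fun i _ => ?_
    rw [Submodule.coe_smul, coe_frameBasis]
    by_cases hi : t ≤ i.1.1
    · rw [h i hi, zero_smul]
      exact zero_mem _
    · match t with
      | 0 => exact absurd (Nat.zero_le _) hi
      | t + 1 =>
        exact Submodule.smul_mem _ _
          (partialDerivL_mem_U D₀ D hp (Nat.le_of_lt_succ (not_le.1 hi)) _ _)

theorem frameCoord_corner (hp : p ∈ dom n d E p₀) (f : Fn n M) {T : U D₀ D r k p}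
    {i : Idx n d r k}
    (h : ∀ i' : Idx n d r k, (i.1.1 : ℕ) < i'.1.1 → frameCoord D₀ D p₀ p T i' = 0) :
    frameCoord D₀ D p₀ p (corner D₀ D f p T) i = f p * frameCoord D₀ D p₀ p T i := by
  have hT : T.1 ∈ U D₀ D i.1.1 k p := (mem_ULt_iff D₀ D hp (t := i.1.1 + 1)).2 h
  obtain ⟨R, hR, hTR⟩ := exists_corner_eq_smul_add D₀ D f hT
  rw [hTR, map_add, map_smul, Pi.add_apply, (mem_ULt_iff D₀ D hp).1 hR i le_rfl, add_zero]
  rfl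

theorem corner_mem_USec (f : Fn n M) {T : ∀ p : M, U D₀ D r k p} (hT : T ∈ USec D₀ D r k) :
    (fun p => corner D₀ D f p (T p)) ∈ USec D₀ D r k :=
  (mem_USec_iff D₀ D).2 fun η => (mem_USec_iff D₀ D).1 hT (mulForm f η)

/-- The module structure on the sections of `𝒰_k^r(E)` given by `f⌟`. -/
instance cornerModule : Module (Fn n M) (USec D₀ D r k) where
  smul f T := ⟨fun p => corner D₀ D f p (T.1 p), corner_mem_USec D₀ D f T.2⟩
  one_smul T := Subtype.ext <| funext fun p => LinearMap.congr_fun (corner_one D₀ D) (T.1 p)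
  mul_smul f g T := Subtype.ext <| funext fun p => LinearMap.congr_fun (corner_mul D₀ D f g) (T.1 p)
  smul_zero f := Subtype.ext <| funext fun p => map_zero (corner D₀ D f p)
  smul_add f S T := Subtype.ext <| funext fun p => map_add (corner D₀ D f p) (S.1 p) (T.1 p)
  add_smul f g T := Subtype.ext <| funext fun p => LinearMap.congr_fun (corner_add D₀ D f g) (T.1 p)
  zero_smul T := Subtype.ext <| funext fun p => LinearMap.congr_fun (corner_zero D₀ D) (T.1 p)

open Classical in
/-- The local frame of `𝒰_k^r(E)` around `p₀`, with the junk value `0` outside its domain. -/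
def frameU (p₀ : M) (i : Idx n d r k) (p : M) : U D₀ D r k p :=
  if hp : p ∈ dom n d E p₀ then frameBasis D₀ D hp i else 0

theorem frameU_of_mem (hp : p ∈ dom n d E p₀) (i : Idx n d r k) :
    frameU D₀ D p₀ i p = frameBasis D₀ D hp i := dif_pos hp

theorem sum_frameCoord_smul_frameU (hp : p ∈ dom n d E p₀) (T : U D₀ D r k p) :
    ∑ i, frameCoord D₀ D p₀ p T i • frameU D₀ D p₀ i p = T := by
  simp only [frameU_of_mem D₀ D hp]
  exact sum_frameCoord_smul D₀ D hp T

theorem frameCoord_frameU (hp : p ∈ dom n d E p₀) (i i' : Idx n d r k) [Decidable (i = i')] :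
    frameCoord D₀ D p₀ p (frameU D₀ D p₀ i p) i' = if i = i' then 1 else 0 := by
  rw [frameU_of_mem D₀ D hp, frameCoord_frameBasis]

theorem frameU_apply (hp : p ∈ dom n d E p₀) (i : Idx n d r k) (η : Form n d E k) :
    (frameU D₀ D p₀ i p).1 η = frame p₀ i p η := by
  rw [frameU_of_mem D₀ D hp, coe_frameBasis, frameL_apply hp]

theorem frameU_mem_ULt (p₀ p : M) {i : Idx n d r k} {t : ℕ} (hi : i.1.1 < t) :
    (frameU D₀ D p₀ i p).1 ∈ ULt D₀ D t k p := by
  classical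
  by_cases hp : p ∈ dom n d E p₀
  · refine (mem_ULt_iff D₀ D hp).2 fun i' hi' => ?_
    rw [frameCoord_frameU D₀ D hp, if_neg]
    rintro rfl
    exact hi.not_ge hi'
  · rw [frameU, dif_neg hp]
    exact zero_mem _

theorem exists_mem_USec_eventuallyEq_frameU (i : Idx n d r k) {q : M} (hq : q ∈ dom n d E p₀) :
    ∃ T ∈ USec D₀ D r k, ∀ᶠ p in nhds q, T p = frameU D₀ D p₀ i p := by
  obtain ⟨P, hP, hPi⟩ := exists_mem_Op_eventuallyEq_partialDeriv D₀ D hq i.1.2 i.2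
  obtain ⟨T, hT, hTP⟩ :=
    exists_mem_USec_of_mem_Op D₀ D (Op_mono D₀ D (Nat.le_of_lt_succ i.1.1.2) hP)
  refine ⟨T, hT, ?_⟩
  filter_upwards [hPi, (isOpen_dom p₀).mem_nhds hq] with p hPp hp
  refine Subtype.ext (LinearMap.ext fun η => ?_)
  rw [hTP, hPp, frameU_apply D₀ D hp]
  rfl

/-- The family of functionals with coordinates `a` in the frames selected by `s`; it vanishes
outside the supports of `a`. -/
def glueU (s : Selection (dom n d E)) (a : Idx n d r k → Fn n M) (p : M) : U D₀ D r k p :=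
  ∑ i, a i p • frameU D₀ D (s.index p) i p

variable {s : Selection (dom n d E)} {a : Idx n d r k → Fn n M}

theorem frameCoord_glueU (hp : p ∈ s.carrier) :
    frameCoord D₀ D (s.index p) p (glueU D₀ D s a p) = fun i => a i p := by
  simp only [glueU, frameU_of_mem D₀ D (s.mem_dom p hp), frameCoord_sum_smul]

theorem glueU_eq_zero (ha : ∀ i, a i p = 0) : glueU D₀ D s a p = 0 :=
  Finset.sum_eq_zero fun i _ => by rw [ha, zero_smul]

theorem glueU_mem_USec (ha : ∀ i, tsupport (a i) ⊆ s.carrier) : glueU D₀ D s a ∈ USec D₀ D r k := by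
  refine (mem_USec_iff D₀ D).2 fun η =>
    contMDiff_of_tsupport_subset ha (fun q hq => ?_) fun p hp => ?_
  · have hsum : ContMDiffAt (𝓡 n) 𝓘(ℝ) ∞ (fun p => ∑ i, a i p * frame (s.index q) i p η) q :=
      ContMDiffAt.sum fun i _ =>
        (a i).contMDiff.contMDiffAt.mul (contMDiffAt_frame (s.mem_dom q hq) i η)
    refine hsum.congr_of_eventuallyEq ?_
    filter_upwards [s.eventually_index_eq q hq, s.isOpen_carrier.mem_nhds hq] with p hpq hps
    rw [apply_eq_sum_frameCoord D₀ D (s.mem_dom p hps), frameCoord_glueU D₀ D hps, hpq]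
  · rw [glueU_eq_zero D₀ D hp]
    rfl

/-- The local frames of `𝒰_k^r(E)` as coordinates on its module of sections, graded by the length
of words. -/
def uCoords : GradedCoords n M (USec D₀ D r k) (Idx n d r k) where
  dom := dom n d E
  isOpen_dom := isOpen_dom
  mem_dom := mem_dom_self
  deg i := i.1.1
  coord p₀ p :=
    { toFun T := frameCoord D₀ D p₀ p (T.1 p)
      map_zero' := map_zero _
      map_add' S T := map_add _ (S.1 p) (T.1 p) }
  contMDiffOn_coord p₀ T i := contMDiffOn_frameCoord D₀ D T.2 p₀ i
  coord_smul f _ _ _ hp _ h := frameCoord_corner D₀ D hp f h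
  coord_eq_zero_congr _ _ _ _ _ hp₀ hp₁ h := (mem_ULt_iff D₀ D hp₁).1 ((mem_ULt_iff D₀ D hp₀).2 h)
  eq_zero_of_coord _ h := Subtype.ext <| funext fun p =>
    frameCoord_injective D₀ D (mem_dom_self p) ((h p).trans (map_zero (frameCoord D₀ D p p)).symm)
  exists_coord_eq s a ha := by
    refine ⟨⟨_, glueU_mem_USec D₀ D ha⟩, fun p hp => frameCoord_glueU D₀ D hp, fun p hp => ?_⟩
    change frameCoord D₀ D p p (glueU D₀ D s a p) = 0
    rw [glueU_eq_zero D₀ D fun i => image_eq_zero_of_notMem_tsupport fun h => hp (ha i h), map_zero]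

end Filtration

section HomModules

variable {n : ℕ} {M : Type*} [TopologicalSpace M] [ChartedSpace (Rn n) M]
  {d : ℕ} {E : M → Type*} [TopologicalSpace (TotalSpace (Rn d) E)]
  [∀ x, TopologicalSpace (E x)] [FiberBundle (Rn d) E]
  {d' : ℕ} {F : M → Type*} [TopologicalSpace (TotalSpace (Rn d') F)]
  [∀ x, TopologicalSpace (F x)] [FiberBundle (Rn d') F]

variable (n d E d' F) in
/-- The common domain of the frames of both bundles around `p₀`. -/
def dom₂ (p₀ : M) : Set M := dom n d E p₀ ∩ dom n d' F p₀

theorem isOpen_dom₂ (p₀ : M) : IsOpen (dom₂ n d E d' F p₀) := (isOpen_dom p₀).inter (isOpen_dom p₀)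

theorem mem_dom₂_self (p₀ : M) : p₀ ∈ dom₂ n d E d' F p₀ := ⟨mem_dom_self p₀, mem_dom_self p₀⟩

variable [T2Space M] [IsManifold (𝓡 n) ∞ M]
  [∀ x, AddCommGroup (E x)] [∀ x, Module ℝ (E x)]
  [∀ x, AddCommGroup (F x)] [∀ x, Module ℝ (F x)]
  [∀ x, IsTopologicalAddGroup (E x)] [∀ x, ContinuousSMul ℝ (E x)]
  [VectorBundle ℝ (Rn d) E] [ContMDiffVectorBundle ∞ (Rn d) E (𝓡 n)]
  [∀ x, IsTopologicalAddGroup (F x)] [∀ x, ContinuousSMul ℝ (F x)]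
  [VectorBundle ℝ (Rn d') F] [ContMDiffVectorBundle ∞ (Rn d') F (𝓡 n)]
  (D₀ : CovariantDerivative (𝓡 n) (Rn n) (TangentSpace (𝓡 n) : M → Type _))
  [D₀.ContMDiffCovariantDerivative ∞]
  (D : CovariantDerivative (𝓡 n) (Rn d) E) [D.ContMDiffCovariantDerivative ∞]
  (D' : CovariantDerivative (𝓡 n) (Rn d') F) [D'.ContMDiffCovariantDerivative ∞]
  {r k s j : ℕ} {p₀ p : M}

/-- The matrix entries of a homomorphism in the local frames around `p₀`. -/
def homCoord (p₀ p : M) (H : U D₀ D r k p →ₗ[ℝ] U D₀ D' s j p)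
    (x : Idx n d' s j × Idx n d r k) : ℝ :=
  frameCoord D₀ D' p₀ p (H (frameU D₀ D p₀ x.2 p)) x.1

theorem frameCoord_apply (hp : p ∈ dom n d E p₀) (H : U D₀ D r k p →ₗ[ℝ] U D₀ D' s j p)
    (S : U D₀ D r k p) (i' : Idx n d' s j) : frameCoord D₀ D' p₀ p (H S) i' =
      ∑ i, homCoord D₀ D D' p₀ p H (i', i) * frameCoord D₀ D p₀ p S i := by
  conv_lhs => rw [← sum_frameCoord_smul_frameU D₀ D hp S]
  rw [map_sum, map_sum, Finset.sum_apply]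
  refine Finset.sum_congr rfl fun i _ => ?_
  rw [map_smul, map_smul, Pi.smul_apply, smul_eq_mul, mul_comm]
  rfl

theorem eq_zero_of_homCoord_eq_zero (hp : p ∈ dom₂ n d E d' F p₀)
    {H : U D₀ D r k p →ₗ[ℝ] U D₀ D' s j p} (h : ∀ x, homCoord D₀ D D' p₀ p H x = 0) : H = 0 := by
  refine LinearMap.ext fun S => frameCoord_injective D₀ D' hp.2 (funext fun i' => ?_)
  rw [frameCoord_apply D₀ D D' hp.1, LinearMap.zero_apply, map_zero]
  exact Finset.sum_eq_zero fun i _ => by rw [h, zero_mul]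

theorem apply_mem_USec_of_mem_HomSec {H : ∀ p : M, U D₀ D r k p →ₗ[ℝ] U D₀ D' s j p}
    (hH : H ∈ HomSec D₀ D D' r k s j) {T : ∀ p : M, U D₀ D r k p} (hT : T ∈ USec D₀ D r k) :
    (fun p => H p (T p)) ∈ USec D₀ D' s j := by
  refine (mem_USec_iff D₀ D').2 fun θ q => ?_
  obtain ⟨A, hA, hHA⟩ := hH q
  obtain ⟨a, ha, hTa⟩ := hT q
  have hq : q ∈ dom₂ n d E d' F q := mem_dom₂_self q
  have hD : dom₂ n d E d' F q ∈ nhds q := (isOpen_dom₂ q).mem_nhds hq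
  have hDE : dom n d E q ∈ nhds q := (isOpen_dom q).mem_nhds hq.1
  have hsum : ContMDiffAt (𝓡 n) 𝓘(ℝ) ∞
      (fun p => ∑ i', (∑ i, A i' i p * a i p) * frame q i' p θ) q :=
    ContMDiffAt.sum fun i' _ => (ContMDiffAt.sum fun i _ =>
      ((hA i' i).contMDiffAt hD).mul ((ha i).contMDiffAt hDE)).mul (contMDiffAt_frame hq.2 i' θ)
  refine hsum.congr_of_eventuallyEq ?_
  filter_upwards [hD] with p hp using hHA p hp _ _ (hTa p hp.1) θ

theorem contMDiffOn_homCoord {H : ∀ p : M, U D₀ D r k p →ₗ[ℝ] U D₀ D' s j p}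
    (hH : ∀ T ∈ USec D₀ D r k, (fun p => H p (T p)) ∈ USec D₀ D' s j) (p₀ : M)
    (x : Idx n d' s j × Idx n d r k) : ContMDiffOn (𝓡 n) 𝓘(ℝ) ∞
      (fun p => homCoord D₀ D D' p₀ p (H p) x) (dom₂ n d E d' F p₀) := by
  intro q hq
  obtain ⟨T, hT, hTx⟩ := exists_mem_USec_eventuallyEq_frameU D₀ D x.2 hq.1
  have hsmooth := contMDiffAt_frameCoord D₀ D' ((mem_USec_iff D₀ D').1 (hH T hT)) hq.2 x.1
  refine (hsmooth.congr_of_eventuallyEq ?_).contMDiffWithinAt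
  filter_upwards [hTx] with p hp
  rw [hp]
  rfl

theorem mem_HomSec_iff {H : ∀ p : M, U D₀ D r k p →ₗ[ℝ] U D₀ D' s j p} :
    H ∈ HomSec D₀ D D' r k s j ↔
      ∀ T ∈ USec D₀ D r k, (fun p => H p (T p)) ∈ USec D₀ D' s j := by
  refine ⟨fun hH T hT => apply_mem_USec_of_mem_HomSec D₀ D D' hH hT, fun h p₀ =>
    ⟨fun i' i p => homCoord D₀ D D' p₀ p (H p) (i', i),
      fun i' i => contMDiffOn_homCoord D₀ D D' h p₀ (i', i), fun p hp S c hc => ?_⟩⟩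
  rw [hasCoords_iff D₀ D hp.1] at hc
  rw [hasCoords_iff D₀ D' hp.2]
  funext i'
  rw [frameCoord_apply D₀ D D' hp.1, hc]

theorem comp_corner_mem_HomSec (f : Fn n M) {H : ∀ p : M, U D₀ D r k p →ₗ[ℝ] U D₀ D' s j p}
    (hH : H ∈ HomSec D₀ D D' r k s j) :
    (fun p => H p ∘ₗ corner D₀ D f p) ∈ HomSec D₀ D D' r k s j :=
  (mem_HomSec_iff D₀ D D').2 fun _ hT =>
    (mem_HomSec_iff D₀ D D').1 hH _ (corner_mem_USec D₀ D f hT)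

theorem corner_comp_mem_HomSec (f : Fn n M) {H : ∀ p : M, U D₀ D r k p →ₗ[ℝ] U D₀ D' s j p}
    (hH : H ∈ HomSec D₀ D D' r k s j) :
    (fun p => corner D₀ D' f p ∘ₗ H p) ∈ HomSec D₀ D D' r k s j :=
  (mem_HomSec_iff D₀ D D').2 fun _ hT =>
    corner_mem_USec D₀ D' f ((mem_HomSec_iff D₀ D D').1 hH _ hT)

/-- The module structure on homomorphisms given by precomposition with `f⌟`. -/
@[reducible]
def preModule : Module (Fn n M) (HomSec D₀ D D' r k s j) where
  smul f H := ⟨fun p => H.1 p ∘ₗ corner D₀ D f p, comp_corner_mem_HomSec D₀ D D' f H.2⟩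
  one_smul H := Subtype.ext <| funext fun p => LinearMap.ext fun S =>
    congrArg (H.1 p) (LinearMap.congr_fun (corner_one D₀ D) S)
  mul_smul f g H := Subtype.ext <| funext fun p => LinearMap.ext fun S =>
    congrArg (H.1 p) (LinearMap.congr_fun
      ((congrArg (fun h => corner D₀ D h p) (mul_comm f g)).trans (corner_mul D₀ D g f)) S)
  smul_zero _ := rfl
  smul_add _ _ _ := rfl
  add_smul f g H := Subtype.ext <| funext fun p => LinearMap.ext fun S =>
    (congrArg (H.1 p) (LinearMap.congr_fun (corner_add D₀ D f g) S)).trans (map_add (H.1 p) _ _)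
  zero_smul H := Subtype.ext <| funext fun p => LinearMap.ext fun S =>
    (congrArg (H.1 p) (LinearMap.congr_fun (corner_zero D₀ D) S)).trans (map_zero (H.1 p))

/-- The module structure on homomorphisms given by postcomposition with `f⌟`. -/
@[reducible]
def postModule : Module (Fn n M) (HomSec D₀ D D' r k s j) where
  smul f H := ⟨fun p => corner D₀ D' f p ∘ₗ H.1 p, corner_comp_mem_HomSec D₀ D D' f H.2⟩
  one_smul H := Subtype.ext <| funext fun p => LinearMap.ext fun S =>
    LinearMap.congr_fun (corner_one D₀ D') (H.1 p S)
  mul_smul f g H := Subtype.ext <| funext fun p => LinearMap.ext fun S =>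
    LinearMap.congr_fun (corner_mul D₀ D' f g) (H.1 p S)
  smul_zero f := Subtype.ext <| funext fun p => LinearMap.ext fun _ => map_zero (corner D₀ D' f p)
  smul_add f G H := Subtype.ext <| funext fun p => LinearMap.ext fun S =>
    map_add (corner D₀ D' f p) (G.1 p S) (H.1 p S)
  add_smul f g H := Subtype.ext <| funext fun p => LinearMap.ext fun S =>
    LinearMap.congr_fun (corner_add D₀ D' f g) (H.1 p S)
  zero_smul H := Subtype.ext <| funext fun p => LinearMap.ext fun S =>
    LinearMap.congr_fun (corner_zero D₀ D') (H.1 p S)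

/-- The family of homomorphisms with matrix entries `a` in the frames selected by `σ`; it vanishes
outside the supports of `a`. -/
def glueHom (σ : Selection (dom₂ n d E d' F)) (a : Idx n d' s j × Idx n d r k → Fn n M) (p : M) :
    U D₀ D r k p →ₗ[ℝ] U D₀ D' s j p :=
  ∑ x, a x p • (LinearMap.proj x.2 ∘ₗ frameCoord D₀ D (σ.index p) p).smulRight
    (frameU D₀ D' (σ.index p) x.1 p)

variable {σ : Selection (dom₂ n d E d' F)} {a : Idx n d' s j × Idx n d r k → Fn n M}

theorem glueHom_apply (S : U D₀ D r k p) : glueHom D₀ D D' σ a p S =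
    ∑ x, (a x p * frameCoord D₀ D (σ.index p) p S x.2) • frameU D₀ D' (σ.index p) x.1 p := by
  simp only [glueHom, LinearMap.sum_apply, mul_smul]
  rfl

theorem glueHom_eq_zero (ha : ∀ x, a x p = 0) : glueHom D₀ D D' σ a p = 0 :=
  Finset.sum_eq_zero fun x _ => by rw [ha, zero_smul]

theorem homCoord_glueHom (hp : p ∈ σ.carrier) :
    homCoord D₀ D D' (σ.index p) p (glueHom D₀ D D' σ a p) = fun x => a x p := by
  classical
  have hσ := σ.mem_dom p hp
  funext x
  rw [homCoord, glueHom_apply, map_sum, Finset.sum_apply]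
  simp only [map_smul, Pi.smul_apply, frameCoord_frameU D₀ D hσ.1, frameCoord_frameU D₀ D' hσ.2,
    smul_eq_mul]
  rw [Finset.sum_eq_single x (fun y _ hy => ?_) (by simp)]
  · simp
  · by_cases hxy : x.2 = y.2
    · rw [if_neg (c := y.1 = x.1) fun h => hy (Prod.ext h hxy.symm), mul_zero]
    · rw [if_neg hxy, mul_zero, zero_mul]

theorem glueHom_mem_HomSec (ha : ∀ x, tsupport (a x) ⊆ σ.carrier) :
    glueHom D₀ D D' σ a ∈ HomSec D₀ D D' r k s j := by
  refine (mem_HomSec_iff D₀ D D').2 fun T hT => (mem_USec_iff D₀ D').2 fun θ =>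
    contMDiff_of_tsupport_subset ha (fun q hq => ?_) fun p hp => ?_
  · have hσ := σ.mem_dom q hq
    have hsum : ContMDiffAt (𝓡 n) 𝓘(ℝ) ∞ (fun p => ∑ x,
        (a x p * frameCoord D₀ D (σ.index q) p (T p) x.2) * frame (σ.index q) x.1 p θ) q :=
      ContMDiffAt.sum fun x _ => ((a x).contMDiff.contMDiffAt.mul
        (contMDiffAt_frameCoord D₀ D ((mem_USec_iff D₀ D).1 hT) hσ.1 x.2)).mul
        (contMDiffAt_frame hσ.2 x.1 θ)
    refine hsum.congr_of_eventuallyEq ?_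
    filter_upwards [σ.eventually_index_eq q hq, σ.isOpen_carrier.mem_nhds hq] with p hpq hpσ
    rw [glueHom_apply, hpq, Submodule.coe_sum, LinearMap.sum_apply]
    refine Finset.sum_congr rfl fun x _ => ?_
    rw [Submodule.coe_smul, LinearMap.smul_apply, smul_eq_mul,
      frameU_apply D₀ D' (hpq ▸ (σ.mem_dom p hpσ).2)]
  · rw [glueHom_eq_zero D₀ D D' hp]
    rfl

/-- Matrix entries in the local frames as coordinates on the module of homomorphisms, for a module
structure and a grading that are compatible with each other. -/
def homCoords [Module (Fn n M) (HomSec D₀ D D' r k s j)] (deg : Idx n d' s j × Idx n d r k → ℕ)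
    (hsmul : ∀ (f : Fn n M) (H : HomSec D₀ D D' r k s j) {p₀ p : M}, p ∈ dom₂ n d E d' F p₀ → ∀ x,
      (∀ y, deg x < deg y → homCoord D₀ D D' p₀ p (H.1 p) y = 0) →
      homCoord D₀ D D' p₀ p ((f • H).1 p) x = f p * homCoord D₀ D D' p₀ p (H.1 p) x)
    (hdeg : ∀ (t : ℕ) {p p₀ p₁ : M} (H : U D₀ D r k p →ₗ[ℝ] U D₀ D' s j p),
      p ∈ dom₂ n d E d' F p₀ → p ∈ dom₂ n d E d' F p₁ →
      (∀ x, t ≤ deg x → homCoord D₀ D D' p₀ p H x = 0) →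
      ∀ x, t ≤ deg x → homCoord D₀ D D' p₁ p H x = 0) :
    GradedCoords n M (HomSec D₀ D D' r k s j) (Idx n d' s j × Idx n d r k) where
  dom := dom₂ n d E d' F
  isOpen_dom := isOpen_dom₂
  mem_dom := mem_dom₂_self
  deg := deg
  coord p₀ p :=
    { toFun H := homCoord D₀ D D' p₀ p (H.1 p)
      map_zero' := funext fun x => congrFun (map_zero (frameCoord D₀ D' p₀ p)) x.1
      map_add' G H := funext fun x =>
        congrFun (map_add (frameCoord D₀ D' p₀ p) (G.1 p _) (H.1 p _)) x.1 }
  contMDiffOn_coord p₀ H x :=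
    contMDiffOn_homCoord D₀ D D' ((mem_HomSec_iff D₀ D D').1 H.2) p₀ x
  coord_smul := hsmul
  coord_eq_zero_congr t H _ _ _ := hdeg t (H.1 _)
  eq_zero_of_coord H h := Subtype.ext <| funext fun p =>
    eq_zero_of_homCoord_eq_zero D₀ D D' (mem_dom₂_self p) (congrFun (h p))
  exists_coord_eq σ a ha := by
    refine ⟨⟨_, glueHom_mem_HomSec D₀ D D' ha⟩, fun p hp => homCoord_glueHom D₀ D D' hp,
      fun p hp => funext fun x => ?_⟩
    change homCoord D₀ D D' p p (glueHom D₀ D D' σ a p) x = 0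
    rw [glueHom_eq_zero D₀ D D' fun x =>
      image_eq_zero_of_notMem_tsupport fun h => hp (ha x h), homCoord, LinearMap.zero_apply,
      map_zero, Pi.zero_apply]

theorem homCoord_eq_zero_iff_forall_apply_mem_ULt (hp : p ∈ dom₂ n d E d' F p₀) {t : ℕ}
    {H : U D₀ D r k p →ₗ[ℝ] U D₀ D' s j p} :
    (∀ x : Idx n d' s j × Idx n d r k, t ≤ x.1.1.1 → homCoord D₀ D D' p₀ p H x = 0) ↔
      ∀ S, (H S).1 ∈ ULt D₀ D' t j p := by
  refine ⟨fun h S => (mem_ULt_iff D₀ D' hp.2).2 fun i' hi' => ?_, fun h x hx =>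
    (mem_ULt_iff D₀ D' hp.2).1 (h _) x.1 hx⟩
  rw [frameCoord_apply D₀ D D' hp.1]
  exact Finset.sum_eq_zero fun i _ => by rw [h (i', i) hi', zero_mul]

theorem homCoord_eq_zero_iff_apply_eq_zero_of_mem_ULt (hp : p ∈ dom₂ n d E d' F p₀) {t : ℕ}
    {H : U D₀ D r k p →ₗ[ℝ] U D₀ D' s j p} :
    (∀ x : Idx n d' s j × Idx n d r k, x.2.1.1 < t → homCoord D₀ D D' p₀ p H x = 0) ↔
      ∀ S : U D₀ D r k p, S.1 ∈ ULt D₀ D t k p → H S = 0 := by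
  refine ⟨fun h S hS => frameCoord_injective D₀ D' hp.2 (funext fun i' => ?_), fun h x hx => ?_⟩
  · rw [frameCoord_apply D₀ D D' hp.1, map_zero]
    refine Finset.sum_eq_zero fun i _ => ?_
    by_cases hi : i.1.1 < t
    · rw [h (i', i) hi, zero_mul]
    · rw [(mem_ULt_iff D₀ D hp.1).1 hS i (not_lt.1 hi), mul_zero]
  · rw [homCoord, h _ (frameU_mem_ULt D₀ D p₀ p hx), map_zero, Pi.zero_apply]

theorem homCoord_comp_corner (hp : p ∈ dom₂ n d E d' F p₀) (f : Fn n M)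
    {H : U D₀ D r k p →ₗ[ℝ] U D₀ D' s j p} {x : Idx n d' s j × Idx n d r k}
    (h : ∀ y : Idx n d' s j × Idx n d r k, y.2.1.1 < (x.2.1.1 : ℕ) →
      homCoord D₀ D D' p₀ p H y = 0) :
    homCoord D₀ D D' p₀ p (H ∘ₗ corner D₀ D f p) x = f p * homCoord D₀ D D' p₀ p H x := by
  obtain ⟨R, hR, hcorner⟩ := exists_corner_eq_smul_add D₀ D f (t := x.2.1.1)
    (frameU_mem_ULt D₀ D p₀ p (t := x.2.1.1 + 1) (Nat.lt_succ_self _))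
  have hHR : H R = 0 := (homCoord_eq_zero_iff_apply_eq_zero_of_mem_ULt D₀ D D' hp).1 h R hR
  rw [homCoord, LinearMap.comp_apply, hcorner, map_add, map_smul, hHR, add_zero, map_smul]
  rfl

/-- Matrix entries as coordinates for the action by postcomposition, graded by the order in the
target. -/
def postCoords : letI := postModule D₀ D D' (r := r) (k := k) (s := s) (j := j)
    GradedCoords n M (HomSec D₀ D D' r k s j) (Idx n d' s j × Idx n d r k) :=
  letI := postModule D₀ D D' (r := r) (k := k) (s := s) (j := j)
  homCoords D₀ D D' (fun x => x.1.1.1)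
    (fun f _ _ _ hp x h => frameCoord_corner D₀ D' hp.2 f fun i' hi' => h (i', x.2) hi')
    (fun _ _ _ _ _ hp₀ hp₁ h => (homCoord_eq_zero_iff_forall_apply_mem_ULt D₀ D D' hp₁).2
      ((homCoord_eq_zero_iff_forall_apply_mem_ULt D₀ D D' hp₀).1 h))

/-- Matrix entries as coordinates for the action by precomposition, graded by the codegree of the
source index: lower order terms in the source are mapped to terms of higher degree. -/
def preCoords : letI := preModule D₀ D D' (r := r) (k := k) (s := s) (j := j)
    GradedCoords n M (HomSec D₀ D D' r k s j) (Idx n d' s j × Idx n d r k) :=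
  letI := preModule D₀ D D' (r := r) (k := k) (s := s) (j := j)
  have hlt (t : ℕ) (x : Idx n d' s j × Idx n d r k) :
      t ≤ r - x.2.1.1 ↔ x.2.1.1 < r + 1 - t := by
    have := x.2.1.1.2
    omega
  homCoords D₀ D D' (fun x => r - x.2.1.1)
    (fun f _ _ _ hp x h => homCoord_comp_corner D₀ D D' hp f fun y hy =>
      h y (by have := x.2.1.1.2; omega))
    (fun t _ _ _ _ hp₀ hp₁ h => by
      simp only [hlt] at h ⊢
      exact (homCoord_eq_zero_iff_apply_eq_zero_of_mem_ULt D₀ D D' hp₁).2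
        ((homCoord_eq_zero_iff_apply_eq_zero_of_mem_ULt D₀ D D' hp₀).1 h))

/-- Matrix entries as coordinates for the action by precomposition on homomorphisms from
functionals of order zero, graded by the order in the target. -/
def preCoordsZero : letI := preModule D₀ D D' (r := 0) (k := k) (s := s) (j := j)
    GradedCoords n M (HomSec D₀ D D' 0 k s j) (Idx n d' s j × Idx n d 0 k) :=
  letI := preModule D₀ D D' (r := 0) (k := k) (s := s) (j := j)
  homCoords D₀ D D' (fun x => x.1.1.1)
    (fun f _ _ _ hp x _ => homCoord_comp_corner D₀ D D' hp f fun y hy =>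
      absurd hy (by have := x.2.1.1.2; omega))
    (fun _ _ _ _ _ hp₀ hp₁ h => (homCoord_eq_zero_iff_forall_apply_mem_ULt D₀ D D' hp₁).2
      ((homCoord_eq_zero_iff_forall_apply_mem_ULt D₀ D D' hp₀).1 h))

end HomModules

section VectorDerivSum

variable {𝕜 : Type*} [NontriviallyNormedField 𝕜] {V V' H : Type*} [NormedAddCommGroup V]
  [NormedSpace 𝕜 V] [NormedAddCommGroup V'] [NormedSpace 𝕜 V'] [TopologicalSpace H]
  {I : ModelWithCorners 𝕜 V H} {M : Type*} [TopologicalSpace M] [ChartedSpace H M]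

theorem mvfderiv_sum_apply {ι : Type} {s : Finset ι} {f : ι → M → V'} {p : M}
    (hf : ∀ i ∈ s, MDifferentiableAt I 𝓘(𝕜, V') (f i) p) (v : TangentSpace I p) :
    mvfderiv I (fun q => ∑ i ∈ s, f i q) p v = ∑ i ∈ s, mvfderiv I (f i) p v := by
  have h : mvfderiv I (∑ i ∈ s, f i) p = ∑ i ∈ s, mvfderiv I (f i) p :=
    (HasMFDerivAt.sum fun i hi => (hf i hi).hasMFDerivAt).mfderiv
  rw [← Finset.sum_fn, h, sum_apply]

end VectorDerivSum

section Symbol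

variable {n : ℕ} {M : Type*} [TopologicalSpace M] [ChartedSpace (Rn n) M]
  {d : ℕ} {E : M → Type*} [TopologicalSpace (TotalSpace (Rn d) E)]
  [∀ x, AddCommGroup (E x)] [∀ x, Module ℝ (E x)] [∀ x, TopologicalSpace (E x)]
  [FiberBundle (Rn d) E] {r k : ℕ} {p₀ p q : M}

/-- Prepending the first coordinate to a nondecreasing word, which stays nondecreasing. -/
def Idx.cons (hn : 0 < n) (i : Idx n d r k) : Idx n d (r + 1) k :=
  (⟨⟨i.1.1 + 1, Nat.succ_lt_succ i.1.1.2⟩,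
    ⟨(Fin.cons ⟨0, hn⟩ i.1.2 : Fin (i.1.1 + 1) → Fin n), by
      intro a b hab
      induction a using Fin.cases with
      | zero => exact Nat.zero_le _
      | succ a =>
        induction b using Fin.cases with
        | zero => exact absurd hab (by simp)
        | succ b => simpa using i.1.2.monotone (Fin.succ_le_succ_iff.1 hab)⟩⟩, i.2)

theorem Idx.cons_injective (hn : 0 < n) :
    Function.Injective (Idx.cons hn : Idx n d r k → Idx n d (r + 1) k) := by
  rintro ⟨⟨⟨a, ha⟩, w⟩, K⟩ ⟨⟨⟨b, hb⟩, w'⟩, K'⟩ h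
  have hK : K = K' := congrArg Prod.snd h
  have hab : a = b := Nat.succ_injective (congrArg (fun x => (x.1.1 : ℕ)) h)
  subst hab hK
  have hcons := eq_of_heq (Sigma.mk.inj (congrArg Prod.fst h)).2
  have hw : w = w' := by
    ext l
    exact congrArg (fun u : Fin (a + 1) →o Fin n => (u l.succ : ℕ)) hcons
  rw [hw]

/-- Evaluation of forms on vectors of a fibre. -/
def evL (v : Fin k → E p) : Form n d E k →ₗ[ℝ] ℝ where
  toFun η := η.1 p v
  map_add' _ _ := rfl
  map_smul' _ _ := rfl

variable [T2Space M] [IsManifold (𝓡 n) ∞ M]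
  [∀ x, IsTopologicalAddGroup (E x)] [∀ x, ContinuousSMul ℝ (E x)]
  [VectorBundle ℝ (Rn d) E] [ContMDiffVectorBundle ∞ (Rn d) E (𝓡 n)]
  (D₀ : CovariantDerivative (𝓡 n) (Rn n) (TangentSpace (𝓡 n) : M → Type _))
  [D₀.ContMDiffCovariantDerivative ∞]
  (D : CovariantDerivative (𝓡 n) (Rn d) E) [D.ContMDiffCovariantDerivative ∞]

theorem frameBasis_cons_apply (hp : p ∈ dom n d E p₀) (hn : 0 < n) (i : Idx n d r k)
    (η : Form n d E k) : (frameBasis D₀ D hp (i.cons hn)).1 η =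
      mvfderiv (𝓡 n) (fun q => frame p₀ i q η) p
        (stdFrame (E := TangentSpace (𝓡 n)) p₀ ⟨0, hn⟩ p) := by
  rw [coe_frameBasis, frameL_apply hp]
  exact (mvfderiv_partialDeriv hp _ _ η _).symm

theorem frameCoord_sum_smul_frameBasis_cons (hp : p ∈ dom n d E p₀) (hn : 0 < n)
    (c : Idx n d r k → ℝ) (i : Idx n d r k) :
    frameCoord D₀ D p₀ p (∑ i', c i' • frameBasis D₀ D hp (Idx.cons hn i')) (i.cons hn) = c i := by
  classical
  simp only [map_sum, map_smul, Finset.sum_apply, Pi.smul_apply, frameCoord_frameBasis,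
    (Idx.cons_injective hn).eq_iff, smul_eq_mul, mul_ite, mul_one, mul_zero, Finset.sum_ite_eq',
    Finset.mem_univ, if_true]

theorem mvfderiv_apply_eq_sum (hp : p ∈ dom n d E p₀) (hn : 0 < n) {T : ∀ p : M, U D₀ D r k p}
    (hT : T ∈ USec D₀ D r k) (η : Form n d E k) :
    mvfderiv (𝓡 n) (fun q => (T q).1 η) p (stdFrame (E := TangentSpace (𝓡 n)) p₀ ⟨0, hn⟩ p) =
      ∑ i, (frameCoord D₀ D p₀ p (T p) i * (frameBasis D₀ D hp (Idx.cons hn i)).1 η +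
        frame p₀ i p η * mvfderiv (𝓡 n) (fun q => frameCoord D₀ D p₀ q (T q) i) p
          (stdFrame (E := TangentSpace (𝓡 n)) p₀ ⟨0, hn⟩ p)) := by
  have hcoord (i : Idx n d r k) :
      MDifferentiableAt (𝓡 n) 𝓘(ℝ) (fun q => frameCoord D₀ D p₀ q (T q) i) p :=
    (contMDiffAt_frameCoord D₀ D ((mem_USec_iff D₀ D).1 hT) hp i).mdifferentiableAt (by simp)
  have hframe (i : Idx n d r k) : MDifferentiableAt (𝓡 n) 𝓘(ℝ) (fun q => frame p₀ i q η) p :=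
    (contMDiffAt_frame hp i η).mdifferentiableAt (by simp)
  have hsum : (fun q => (T q).1 η) =ᶠ[nhds p]
      fun q => ∑ i, frameCoord D₀ D p₀ q (T q) i * frame p₀ i q η := by
    filter_upwards [(isOpen_dom p₀).mem_nhds hp] with q hq
    exact apply_eq_sum_frameCoord D₀ D hq (T q) η
  rw [mvfderiv_congr_of_eventuallyEq hsum]
  refine (mvfderiv_sum_apply (f := fun i q => frameCoord D₀ D p₀ q (T q) i * frame p₀ i q η)
    (fun i _ => (hcoord i).mul (hframe i)) _).trans (Finset.sum_congr rfl fun i _ => ?_)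
  rw [frameBasis_cons_apply]
  exact DFunLike.congr_fun (mvfderiv_mul (hcoord i) (hframe i)) _

/-- The derivative of a section in the first coordinate direction raises the order of its leading
part by one. -/
theorem mem_ULt_of_forall_mvfderiv_mem_U (hn : 0 < n) {T : ∀ p : M, U D₀ D r k p}
    (hT : T ∈ USec D₀ D r k) (h : ∀ X : VF n M, ∃ S ∈ U D₀ D r k q, ∀ η,
      S η = mvfderiv (𝓡 n) (fun p => (T p).1 η) q (X q)) : (T q).1 ∈ ULt D₀ D r k q := by
  have hq : q ∈ dom n d E q := mem_dom_self q
  obtain ⟨X, hX⟩ := exists_section_apply_eq (n := n) (d := n) q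
    (stdFrame (E := TangentSpace (𝓡 n)) q ⟨0, hn⟩ q)
  obtain ⟨S, hS, hSX⟩ := h X
  let leading : U D₀ D (r + 1) k q :=
    ∑ i, frameCoord D₀ D q q (T q) i • frameBasis D₀ D hq (Idx.cons hn i)
  let lower : Form n d E k →ₗ[ℝ] ℝ :=
    ∑ i, mvfderiv (𝓡 n) (fun p => frameCoord D₀ D q p (T p) i) q (X q) • frameL q i q
  have hlower : lower ∈ U D₀ D r k q :=
    sum_mem fun i _ => Submodule.smul_mem _ _ (frameL_mem_U D₀ D hq i)
  have hdecomp : leading.1 + lower = S := by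
    refine LinearMap.ext fun η => ?_
    rw [hSX, hX, mvfderiv_apply_eq_sum D₀ D hq hn hT, Finset.sum_add_distrib, LinearMap.add_apply,
      Submodule.coe_sum, LinearMap.sum_apply, LinearMap.sum_apply]
    refine congrArg₂ (· + ·) rfl (Finset.sum_congr rfl fun i _ => ?_)
    rw [LinearMap.smul_apply, frameL_apply hq, smul_eq_mul, mul_comm, hX]
  have hleading : leading.1 ∈ ULt D₀ D (r + 1) k q :=
    eq_sub_of_add_eq hdecomp ▸ sub_mem hS hlower
  refine (mem_ULt_iff D₀ D hq).2 fun i hi => ?_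
  exact (frameCoord_sum_smul_frameBasis_cons D₀ D hq hn _ i).symm.trans
    ((mem_ULt_iff D₀ D hq).1 hleading (i.cons hn) (Nat.succ_le_succ hi))

theorem exists_mem_U_eq_mvfderiv {T : ∀ p : M, U D₀ D r k p} (hT : T ∈ USec D₀ D r k)
    (X : VF n M) (q : M) : ∃ S ∈ U D₀ D (r + 1) k q, ∀ η,
      S η = mvfderiv (𝓡 n) (fun p => (T p).1 η) q (X q) := by
  obtain ⟨P, hP, hPT⟩ := exists_mem_Op_eventuallyEq D₀ D hT q
  obtain ⟨S, hS, hSP⟩ := Op_apply_mem D₀ D q (lie_Op D₀ D X hP)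
  refine ⟨S, hS, fun η => (hSP η).trans (mvfderiv_congr_of_eventuallyEq ?_ (X q)).symm⟩
  filter_upwards [hPT] with p hp using hp η

theorem evL_mem_U (v : Fin k → E p) : evL (n := n) (d := d) v ∈ U D₀ D r k p := by
  choose s hs using fun i => exists_section_apply_eq (n := n) (d := d) p (v i)
  obtain rfl : (fun i => s i p) = v := funext hs
  exact Phi_mem D₀ D (Nat.zero_le r) p Fin.elim0 s

/-- A vector of `⋀ᵏ(E_p)` as a functional of order zero. -/
def evU (v : Fin k → E p) : U D₀ D r k p := ⟨evL v, evL_mem_U D₀ D v⟩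

theorem evU_mem_USec (t : Fin k → Cₛ^∞⟮𝓡 n; Rn d, E⟯) :
    (fun p => evU D₀ D fun i => t i p) ∈ USec D₀ D r k :=
  (mem_USec_iff D₀ D).2 fun η => contMDiff_apply t η

theorem apply_eq_of_forall_apply_evU (L : U D₀ D r k p →ₗ[ℝ] ℝ) (η : Form n d E k)
    (h : ∀ v : Fin k → E p, L (evU D₀ D v) = η.1 p v) (S : U D₀ D r k p)
    (hS : S.1 ∈ U D₀ D 0 k p) : L S = S.1 η := by
  obtain ⟨S, hSr⟩ := S
  change S ∈ _ at hS
  have hle : U D₀ D 0 k p ≤ U D₀ D r k p := U_mono D₀ D (Nat.zero_le r)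
  change L ⟨S, hSr⟩ = S η
  induction hS using Submodule.span_induction with
  | mem S hS =>
    obtain ⟨j, hj, X, s, rfl⟩ := hS
    obtain rfl := Nat.le_zero.1 hj
    exact h fun i => s i p
  | zero => exact map_zero L
  | add S T hS hT ihS ihT =>
    exact (map_add L ⟨S, hle hS⟩ ⟨T, hle hT⟩).trans (congrArg₂ (· + ·) (ihS _) (ihT _))
  | smul c S hS ihS =>
    exact (map_smul L c ⟨S, hle hS⟩).trans (congrArg (c * ·) (ihS _))

theorem mem_U_zero_of_dim_eq_zero (hn : n = 0) (S : U D₀ D r k p) : S.1 ∈ U D₀ D 0 k p := by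
  refine (mem_ULt_iff D₀ D (mem_dom_self p) (t := 1)).2 fun i hi => ?_
  have h := (i.1.2 ⟨0, hi⟩).2
  omega

end Symbol

section Consistent

variable {n : ℕ} {M : Type*} [TopologicalSpace M] [ChartedSpace (Rn n) M]
  {d : ℕ} {E : M → Type*} [TopologicalSpace (TotalSpace (Rn d) E)]
  [∀ x, TopologicalSpace (E x)] [FiberBundle (Rn d) E]
  {d' : ℕ} {F : M → Type*} [TopologicalSpace (TotalSpace (Rn d') F)]
  [∀ x, TopologicalSpace (F x)] [FiberBundle (Rn d') F]
  [IsManifold (𝓡 n) ∞ M]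
  [∀ x, AddCommGroup (E x)] [∀ x, Module ℝ (E x)]
  [∀ x, AddCommGroup (F x)] [∀ x, Module ℝ (F x)]
  [∀ x, IsTopologicalAddGroup (E x)] [∀ x, ContinuousSMul ℝ (E x)]
  [VectorBundle ℝ (Rn d) E] [ContMDiffVectorBundle ∞ (Rn d) E (𝓡 n)]
  [∀ x, IsTopologicalAddGroup (F x)] [∀ x, ContinuousSMul ℝ (F x)]
  [VectorBundle ℝ (Rn d') F] [ContMDiffVectorBundle ∞ (Rn d') F (𝓡 n)]
  (D₀ : CovariantDerivative (𝓡 n) (Rn n) (TangentSpace (𝓡 n) : M → Type _))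
  [D₀.ContMDiffCovariantDerivative ∞]
  (D : CovariantDerivative (𝓡 n) (Rn d) E) [D.ContMDiffCovariantDerivative ∞]
  (D' : CovariantDerivative (𝓡 n) (Rn d') F) [D'.ContMDiffCovariantDerivative ∞]
  {r k s j : ℕ} {p : M}

theorem isConsistent_iff_exists {H : ∀ p : M, U D₀ D r k p →ₗ[ℝ] U D₀ D' s j p} :
    IsConsistent D₀ D D' H ↔ ∃ Hstar : Form n d' F j → Form n d E k,
      ∀ (p : M) (S : U D₀ D r k p) (θ : Form n d' F j), (H p S).1 θ = S.1 (Hstar θ) :=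
  ⟨fun ⟨Hstar, _, h⟩ => ⟨Hstar, h⟩, fun ⟨Hstar, h⟩ => ⟨Hstar, fun θ p t =>
    (h p ⟨Phi D₀ D p 0 Fin.elim0 t, Phi_mem D₀ D (Nat.zero_le r) p _ t⟩ θ).symm, h⟩⟩

theorem isConsistent_zero : IsConsistent D₀ D D' (0 : HomSec D₀ D D' r k s j).1 :=
  (isConsistent_iff_exists D₀ D D').2 ⟨fun _ => 0, fun _ S _ => (map_zero S.1).symm⟩

theorem isConsistent_add {G H : ∀ p : M, U D₀ D r k p →ₗ[ℝ] U D₀ D' s j p}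
    (hG : IsConsistent D₀ D D' G) (hH : IsConsistent D₀ D D' H) :
    IsConsistent D₀ D D' (G + H) := by
  obtain ⟨Gstar, hGstar⟩ := (isConsistent_iff_exists D₀ D D').1 hG
  obtain ⟨Hstar, hHstar⟩ := (isConsistent_iff_exists D₀ D D').1 hH
  exact (isConsistent_iff_exists D₀ D D').2 ⟨Gstar + Hstar, fun p S θ =>
    (congrArg₂ (· + ·) (hGstar p S θ) (hHstar p S θ)).trans (map_add S.1 _ _).symm⟩

theorem isConsistent_comp_corner (f : Fn n M) {H : ∀ p : M, U D₀ D r k p →ₗ[ℝ] U D₀ D' s j p}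
    (hH : IsConsistent D₀ D D' H) : IsConsistent D₀ D D' fun p => H p ∘ₗ corner D₀ D f p := by
  obtain ⟨Hstar, hstar⟩ := (isConsistent_iff_exists D₀ D D').1 hH
  exact (isConsistent_iff_exists D₀ D D').2
    ⟨fun θ => mulForm f (Hstar θ), fun p S θ => hstar p _ θ⟩

theorem isConsistent_corner_comp (f : Fn n M) {H : ∀ p : M, U D₀ D r k p →ₗ[ℝ] U D₀ D' s j p}
    (hH : IsConsistent D₀ D D' H) : IsConsistent D₀ D D' fun p => corner D₀ D' f p ∘ₗ H p := by
  obtain ⟨Hstar, hstar⟩ := (isConsistent_iff_exists D₀ D D').1 hH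
  exact (isConsistent_iff_exists D₀ D D').2
    ⟨fun θ => Hstar (mulForm f θ), fun p S θ => hstar p S _⟩

variable [T2Space M]

/-- The alternating form `α ↦ H(α)(θ)` on `E_p`. -/
def dualAt (H : U D₀ D r k p →ₗ[ℝ] U D₀ D' s j p) (θ : Form n d' F j) :
    E p [⋀^Fin k]→ₗ[ℝ] ℝ where
  toFun v := (H (evU D₀ D v)).1 θ
  map_update_add' v i x y := by
    have h : (evU D₀ D (Function.update v i (x + y)) : U D₀ D r k p) =
        evU D₀ D (Function.update v i x) + evU D₀ D (Function.update v i y) :=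
      Subtype.ext (LinearMap.ext fun η => (η.1 p).map_update_add v i x y)
    rw [h, map_add]
    rfl
  map_update_smul' v i c x := by
    have h : (evU D₀ D (Function.update v i (c • x)) : U D₀ D r k p) =
        c • evU D₀ D (Function.update v i x) :=
      Subtype.ext (LinearMap.ext fun η => (η.1 p).map_update_smul v i c x)
    rw [h, map_smul]
    rfl
  map_eq_zero_of_eq' v i i' hv hi := by
    have h : (evU D₀ D v : U D₀ D r k p) = 0 :=
      Subtype.ext (LinearMap.ext fun η => (η.1 p).map_eq_zero_of_eq v hv hi)
    rw [h, map_zero]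
    rfl

theorem contMDiffOn_dualAt (H : HomSec D₀ D D' r k s j) (θ : Form n d' F j) (p₀ : M)
    (v : Fin k → Rn d) : ContMDiffOn (𝓡 n) 𝓘(ℝ) ∞
      (fun p => dualAt D₀ D D' (H.1 p) θ fun i => (trivializationAt (Rn d) E p₀).symm p (v i))
      (trivializationAt (Rn d) E p₀).baseSet := by
  intro q hq
  choose t ht using fun i => exists_section_eventuallyEq_symm (n := n) (E := E) hq (v i)
  have hsmooth := (mem_USec_iff D₀ D').1
    ((mem_HomSec_iff D₀ D D').1 H.2 _ (evU_mem_USec D₀ D t)) θ q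
  refine (hsmooth.congr_of_eventuallyEq ?_).contMDiffWithinAt
  filter_upwards [Filter.eventually_all.2 ht] with p hp
  rw [← funext hp]
  rfl

/-- The operator `H* : C^∞(⋀ʲ(F*)) → C^∞(⋀ᵏ(E*))`. -/
def dualOp (H : HomSec D₀ D D' r k s j) : Form n d' F j →ₗ[ℝ] Form n d E k where
  toFun θ := ⟨fun p => dualAt D₀ D D' (H.1 p) θ, contMDiffOn_dualAt D₀ D D' H θ⟩
  map_add' θ θ' := Subtype.ext <| funext fun p => AlternatingMap.ext fun v =>
    map_add (H.1 p (evU D₀ D v)).1 θ θ'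
  map_smul' c θ := Subtype.ext <| funext fun p => AlternatingMap.ext fun v =>
    map_smul (H.1 p (evU D₀ D v)).1 c θ

theorem isConsistent_iff (H : HomSec D₀ D D' r k s j) : IsConsistent D₀ D D' H.1 ↔
    ∀ (p : M) (S : U D₀ D r k p) (θ : Form n d' F j),
      (H.1 p S).1 θ = S.1 (dualOp D₀ D D' H θ) := by
  rw [isConsistent_iff_exists]
  refine ⟨fun ⟨Hstar, h⟩ p S θ => ?_, fun h => ⟨_, h⟩⟩
  have hstar : Hstar θ = dualOp D₀ D D' H θ :=
    Subtype.ext <| funext fun p => AlternatingMap.ext fun v => (h p (evU D₀ D v) θ).symm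
  rw [h, hstar]

theorem apply_eq_dualOp_of_mem_U_zero (H : HomSec D₀ D D' r k s j) {S : U D₀ D r k p}
    (hS : S.1 ∈ U D₀ D 0 k p) (θ : Form n d' F j) :
    (H.1 p S).1 θ = S.1 (dualOp D₀ D D' H θ) :=
  apply_eq_of_forall_apply_evU D₀ D
    (LinearMap.applyₗ θ ∘ₗ (U D₀ D' s j p).subtype ∘ₗ H.1 p) _ (fun _ => rfl) S hS

/-- Differentiating `q ↦ H (T q)` along vector fields amounts to differentiating `T`, which costs
one order in the source; in the target it gains one order unless the leading part vanishes. -/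
theorem apply_mem_ULt_pred_of_mem_U {H : ∀ p : M, U D₀ D r k p →ₗ[ℝ] U D₀ D' s j p}
    (hn : 0 < n) (hH : IsConsistent D₀ D D' H) {ρ t : ℕ} (hρ : ρ + 1 ≤ r)
    (hU : ∀ p S, S.1 ∈ U D₀ D (ρ + 1) k p → (H p S).1 ∈ ULt D₀ D' t j p) (S : U D₀ D r k p)
    (hS : S.1 ∈ U D₀ D ρ k p) : (H p S).1 ∈ ULt D₀ D' (t - 1) j p := by
  obtain ⟨Hstar, hstar⟩ := (isConsistent_iff_exists D₀ D D').1 hH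
  cases t with
  | zero => exact hU p S (U_mono D₀ D (Nat.le_succ ρ) hS)
  | succ σ =>
    obtain ⟨P, hP, hPS⟩ := exists_mem_Op_apply_eq D₀ D (⟨S.1, hS⟩ : U D₀ D ρ k p)
    obtain ⟨T, -, hTP⟩ := exists_mem_USec_of_mem_Op D₀ D hP
    let T' (q : M) : U D₀ D r k q := ⟨T q, U_mono D₀ D (by omega) (T q).2⟩
    let G (q : M) : U D₀ D' σ j q :=
      ⟨(H q (T' q)).1, hU q (T' q) (U_mono D₀ D (Nat.le_succ ρ) (T q).2)⟩
    have hG (q : M) (θ : Form n d' F j) : (G q).1 θ = P (Hstar θ) q :=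
      (hstar q (T' q) θ).trans (hTP q _)
    have hGsmooth : G ∈ USec D₀ D' σ j := (mem_USec_iff D₀ D').2 fun θ =>
      (P (Hstar θ)).contMDiff.congr fun q => hG q θ
    obtain rfl : T' p = S := Subtype.ext (LinearMap.ext fun η => (hTP p η).trans (hPS η).symm)
    refine mem_ULt_of_forall_mvfderiv_mem_U D₀ D' hn hGsmooth fun X => ?_
    obtain ⟨V, hV, hVP⟩ := Op_apply_mem D₀ D p (lie_Op D₀ D X hP)
    refine ⟨_, hU p ⟨V, U_mono D₀ D hρ hV⟩ hV, fun θ => ?_⟩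
    rw [hstar, funext fun q => hG q θ]
    exact hVP _

theorem apply_mem_ULt_of_mem_U {H : ∀ p : M, U D₀ D r k p →ₗ[ℝ] U D₀ D' s j p} (hn : 0 < n)
    (hH : IsConsistent D₀ D D' H) {m : ℕ} (hm : m ≤ r) (S : U D₀ D r k p)
    (hS : S.1 ∈ U D₀ D (r - m) k p) : (H p S).1 ∈ ULt D₀ D' (s + 1 - m) j p := by
  induction m generalizing p with
  | zero => exact (H p S).2
  | succ m ih =>
    refine apply_mem_ULt_pred_of_mem_U D₀ D D' hn hH (by omega) (fun p S hS => ?_) S hS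
    refine ih (by omega) S ?_
    rwa [show r - m = r - (m + 1) + 1 by omega]

/-- The restriction of a homomorphism to functionals of order zero. -/
def restrict (H : HomSec D₀ D D' r k s j) : HomSec D₀ D D' 0 k s j :=
  ⟨fun p => H.1 p ∘ₗ Submodule.inclusion (U_mono D₀ D (Nat.zero_le r)),
    (mem_HomSec_iff D₀ D D').2 fun T hT => (mem_HomSec_iff D₀ D D').1 H.2
      (fun p => Submodule.inclusion (U_mono D₀ D (Nat.zero_le r)) (T p))
      ((mem_USec_iff D₀ D).2 fun η => (mem_USec_iff D₀ D).1 hT η)⟩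

theorem dualOp_restrict (H : HomSec D₀ D D' r k s j) :
    dualOp D₀ D D' (restrict D₀ D D' H) = dualOp D₀ D D' H := rfl

theorem eq_of_restrict_eq {G H : HomSec D₀ D D' r k s j} (hG : IsConsistent D₀ D D' G.1)
    (hH : IsConsistent D₀ D D' H.1) (h : restrict D₀ D D' G = restrict D₀ D D' H) : G = H := by
  refine Subtype.ext <| funext fun p => LinearMap.ext fun S => Subtype.ext <|
    LinearMap.ext fun θ => ?_
  rw [(isConsistent_iff D₀ D D' G).1 hG, (isConsistent_iff D₀ D D' H).1 hH, ← dualOp_restrict, h,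
    dualOp_restrict]

theorem restrict_apply_mem_ULt (hn : 0 < n) {H : HomSec D₀ D D' r k s j}
    (hH : IsConsistent D₀ D D' H.1) (S : U D₀ D 0 k p) :
    ((restrict D₀ D D' H).1 p S).1 ∈ ULt D₀ D' (s + 1 - r) j p := by
  refine apply_mem_ULt_of_mem_U D₀ D D' hn hH le_rfl _ ?_
  rw [Nat.sub_self]
  exact S.2

theorem Phi_comp_dualOp_mem_U {G : HomSec D₀ D D' 0 k s j} {σ : ℕ}
    (hG : ∀ p S, (G.1 p S).1 ∈ U D₀ D' σ j p) (i : ℕ) (X : Fin i → VF n M)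
    (t : Fin k → Cₛ^∞⟮𝓡 n; Rn d, E⟯) :
    Phi D₀ D p i X t ∘ₗ dualOp D₀ D D' G ∈ U D₀ D' (σ + i) j p := by
  induction i generalizing t p with
  | zero => exact hG p (evU D₀ D fun l => t l p)
  | succ i ih =>
    have hle : U D₀ D' (σ + i) j p ≤ U D₀ D' (σ + (i + 1)) j p := U_mono D₀ D' (by omega)
    let T (q : M) : U D₀ D' (σ + i) j q := ⟨_, ih (Fin.tail X) t⟩
    have hT : T ∈ USec D₀ D' (σ + i) j := (mem_USec_iff D₀ D').2 fun θ =>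
      (higherCov D₀ D i (Fin.tail X) t (dualOp D₀ D D' G θ)).contMDiff
    obtain ⟨V, hV, hVT⟩ := exists_mem_U_eq_mvfderiv D₀ D' hT (X 0) p
    have hrec : Phi D₀ D p (i + 1) X t ∘ₗ dualOp D₀ D D' G = V
        - ∑ l : Fin k, Phi D₀ D p i (Fin.tail X) (Function.update t l (cov D (X 0) (t l))) ∘ₗ
          dualOp D₀ D D' G
        - ∑ l : Fin i, Phi D₀ D p i
          (Function.update (Fin.tail X) l (cov D₀ (X 0) (Fin.tail X l))) t ∘ₗ
          dualOp D₀ D D' G := by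
      refine LinearMap.ext fun θ => ?_
      simp only [Phi, higherCov, LinearMap.comp_apply, LinearMap.sub_apply, LinearMap.sum_apply,
        map_sub, map_sum, hVT]
      rfl
    rw [hrec]
    exact sub_mem (sub_mem hV (sum_mem fun _ _ => hle (ih _ _)))
      (sum_mem fun _ _ => hle (ih _ _))

theorem comp_dualOp_mem_U {G : HomSec D₀ D D' 0 k s j} {σ : ℕ}
    (hG : ∀ p S, (G.1 p S).1 ∈ U D₀ D' σ j p) {S : Form n d E k →ₗ[ℝ] ℝ}
    (hS : S ∈ U D₀ D r k p) : S ∘ₗ dualOp D₀ D D' G ∈ U D₀ D' (σ + r) j p := by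
  refine Submodule.span_le (p := (U D₀ D' (σ + r) j p).comap
    (LinearMap.lcomp ℝ ℝ (dualOp D₀ D D' G))) |>.2 ?_ hS
  rintro _ ⟨i, hi, X, t, rfl⟩
  exact U_mono D₀ D' (by omega) (Phi_comp_dualOp_mem_U D₀ D D' hG i X t)

theorem exists_isConsistent_restrict_eq (hrs : r ≤ s) {G : HomSec D₀ D D' 0 k s j}
    (hG : ∀ p S, (G.1 p S).1 ∈ ULt D₀ D' (s + 1 - r) j p) :
    ∃ H : HomSec D₀ D D' r k s j, IsConsistent D₀ D D' H.1 ∧ restrict D₀ D D' H = G := by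
  obtain ⟨σ, rfl⟩ : ∃ σ, s = σ + r := ⟨s - r, by omega⟩
  rw [show σ + r + 1 - r = σ + 1 by omega] at hG
  let H (p : M) : U D₀ D r k p →ₗ[ℝ] U D₀ D' (σ + r) j p :=
    { toFun S := ⟨S.1 ∘ₗ dualOp D₀ D D' G, comp_dualOp_mem_U D₀ D D' hG S.2⟩
      map_add' _ _ := rfl
      map_smul' _ _ := rfl }
  have hH : H ∈ HomSec D₀ D D' r k (σ + r) j := (mem_HomSec_iff D₀ D D').2 fun T hT =>
    (mem_USec_iff D₀ D').2 fun θ => (mem_USec_iff D₀ D).1 hT (dualOp D₀ D D' G θ)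
  refine ⟨⟨H, hH⟩, (isConsistent_iff_exists D₀ D D').2 ⟨dualOp D₀ D D' G, fun _ _ _ => rfl⟩, ?_⟩
  exact Subtype.ext <| funext fun p => LinearMap.ext fun S => Subtype.ext <|
    LinearMap.ext fun θ => (apply_eq_dualOp_of_mem_U_zero D₀ D D' G S.2 θ).symm

theorem isConsistent_of_dim_eq_zero (hn : n = 0) (H : HomSec D₀ D D' r k s j) :
    IsConsistent D₀ D D' H.1 :=
  (isConsistent_iff D₀ D D' H).2 fun _ S θ =>
    apply_eq_dualOp_of_mem_U_zero D₀ D D' H (mem_U_zero_of_dim_eq_zero D₀ D hn S) θ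

theorem eq_zero_of_isConsistent_of_lt (hn : 0 < n) (hsr : s < r) {H : HomSec D₀ D D' r k s j}
    (hH : IsConsistent D₀ D D' H.1) : H = 0 := by
  refine eq_of_restrict_eq D₀ D D' hH (isConsistent_zero D₀ D D') ?_
  refine Subtype.ext <| funext fun p => LinearMap.ext fun S => Subtype.ext ?_
  have h := restrict_apply_mem_ULt D₀ D D' hn hH S
  rwa [Nat.sub_eq_zero_of_le hsr] at h

/-- The submodule of consistent homomorphisms, for an action of functions that preserves
consistency. -/
def consistentSubmodule [Module (Fn n M) (HomSec D₀ D D' r k s j)]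
    (hsmul : ∀ (f : Fn n M) (H : HomSec D₀ D D' r k s j), IsConsistent D₀ D D' H.1 →
      IsConsistent D₀ D D' (f • H).1) : Submodule (Fn n M) (HomSec D₀ D D' r k s j) where
  carrier := {H | IsConsistent D₀ D D' H.1}
  zero_mem' := isConsistent_zero D₀ D D'
  add_mem' := isConsistent_add D₀ D D'
  smul_mem' := hsmul

theorem exists_isCompl_of_forall_mem_iff_isConsistent
    (m : Module (Fn n M) (HomSec D₀ D D' r k s j))
    (m₀ : Module (Fn n M) (HomSec D₀ D D' 0 k s j))
    (hrestrict : ∀ (f : Fn n M) (H : HomSec D₀ D D' r k s j),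
      restrict D₀ D D' (f • H) = f • restrict D₀ D D' H)
    (hcompl : ∀ t, ∃ Q Q' : Submodule (Fn n M) (HomSec D₀ D D' 0 k s j), IsCompl Q Q' ∧
      ∀ G, G ∈ Q ↔ ∀ p S, (G.1 p S).1 ∈ ULt D₀ D' t j p)
    {N : Submodule (Fn n M) (HomSec D₀ D D' r k s j)}
    (hN : ∀ H, H ∈ N ↔ IsConsistent D₀ D D' H.1) : ∃ N', IsCompl N N' := by
  rcases Nat.eq_zero_or_pos n with hn | hn
  · obtain rfl : N = ⊤ :=
      eq_top_iff.2 fun H _ => (hN H).2 (isConsistent_of_dim_eq_zero D₀ D D' hn H)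
    exact ⟨⊥, isCompl_top_bot⟩
  rcases lt_or_ge s r with hsr | hrs
  · obtain rfl : N = ⊥ :=
      eq_bot_iff.2 fun H hH => eq_zero_of_isConsistent_of_lt D₀ D D' hn hsr ((hN H).1 hH)
    exact ⟨⊤, isCompl_bot_top⟩
  obtain ⟨Q, Q', hQQ', hQ⟩ := hcompl (s + 1 - r)
  let R : HomSec D₀ D D' r k s j →ₗ[Fn n M] HomSec D₀ D D' 0 k s j :=
    { toFun := restrict D₀ D D'
      map_add' _ _ := rfl
      map_smul' := hrestrict }
  refine exists_isCompl_of_bijOn R hQQ' ⟨fun H hH => ?_, fun G hG H hH h => ?_, fun G hG => ?_⟩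
  · exact (hQ _).2 fun _ S => restrict_apply_mem_ULt D₀ D D' hn ((hN H).1 hH) S
  · exact eq_of_restrict_eq D₀ D D' ((hN G).1 hG) ((hN H).1 hH) h
  · obtain ⟨H, hH, rfl⟩ := exists_isConsistent_restrict_eq D₀ D D' hrs ((hQ G).1 hG)
    exact ⟨H, (hN H).2 hH, rfl⟩

theorem mem_filt_homCoords_iff [Module (Fn n M) (HomSec D₀ D D' r k s j)] {hsmul hdeg} {t : ℕ}
    {G : HomSec D₀ D D' r k s j} :
    G ∈ (homCoords D₀ D D' (fun x => x.1.1.1) hsmul hdeg).filt t ↔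
      ∀ p S, (G.1 p S).1 ∈ ULt D₀ D' t j p :=
  ⟨fun h p => (homCoord_eq_zero_iff_forall_apply_mem_ULt D₀ D D' (mem_dom₂_self p)).1
    (h p p (mem_dom₂_self p)), fun h p _ hp =>
    (homCoord_eq_zero_iff_forall_apply_mem_ULt D₀ D D' hp).2 (h p)⟩

end Consistent

section Complements

variable {n : ℕ} {M : Type*} [TopologicalSpace M] [T2Space M] [SecondCountableTopology M]
  [ChartedSpace (Rn n) M] [IsManifold (𝓡 n) ∞ M]
  {d : ℕ} {E : M → Type*} [TopologicalSpace (TotalSpace (Rn d) E)]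
  [∀ x, AddCommGroup (E x)] [∀ x, Module ℝ (E x)] [∀ x, TopologicalSpace (E x)]
  [∀ x, IsTopologicalAddGroup (E x)] [∀ x, ContinuousSMul ℝ (E x)]
  [FiberBundle (Rn d) E] [VectorBundle ℝ (Rn d) E] [ContMDiffVectorBundle ∞ (Rn d) E (𝓡 n)]
  {d' : ℕ} {F : M → Type*} [TopologicalSpace (TotalSpace (Rn d') F)]
  [∀ x, AddCommGroup (F x)] [∀ x, Module ℝ (F x)] [∀ x, TopologicalSpace (F x)]
  [∀ x, IsTopologicalAddGroup (F x)] [∀ x, ContinuousSMul ℝ (F x)]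
  [FiberBundle (Rn d') F] [VectorBundle ℝ (Rn d') F] [ContMDiffVectorBundle ∞ (Rn d') F (𝓡 n)]
  (D₀ : CovariantDerivative (𝓡 n) (Rn n) (TangentSpace (𝓡 n) : M → Type _))
  [D₀.ContMDiffCovariantDerivative ∞]
  (D : CovariantDerivative (𝓡 n) (Rn d) E) [D.ContMDiffCovariantDerivative ∞]
  (D' : CovariantDerivative (𝓡 n) (Rn d') F) [D'.ContMDiffCovariantDerivative ∞]
  {r k s j : ℕ}

theorem finite_projective_preModule :
    letI := preModule D₀ D D' (r := r) (k := k) (s := s) (j := j)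
    Module.Finite (Fn n M) (HomSec D₀ D D' r k s j) ∧
      Module.Projective (Fn n M) (HomSec D₀ D D' r k s j) :=
  letI := preModule D₀ D D' (r := r) (k := k) (s := s) (j := j)
  (preCoords D₀ D D' (r := r) (k := k) (s := s) (j := j)).finite_projective

theorem finite_projective_postModule :
    letI := postModule D₀ D D' (r := r) (k := k) (s := s) (j := j)
    Module.Finite (Fn n M) (HomSec D₀ D D' r k s j) ∧
      Module.Projective (Fn n M) (HomSec D₀ D D' r k s j) :=
  letI := postModule D₀ D D' (r := r) (k := k) (s := s) (j := j)
  (postCoords D₀ D D' (r := r) (k := k) (s := s) (j := j)).finite_projective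

theorem exists_isCompl_consistent_preModule :
    letI := preModule D₀ D D' (r := r) (k := k) (s := s) (j := j)
    ∃ N : Submodule (Fn n M) (HomSec D₀ D D' r k s j),
      (∀ H, H ∈ N ↔ IsConsistent D₀ D D' H.1) ∧ ∃ N', IsCompl N N' := by
  let m := preModule D₀ D D' (r := r) (k := k) (s := s) (j := j)
  let m₀ := preModule D₀ D D' (r := 0) (k := k) (s := s) (j := j)
  refine ⟨consistentSubmodule D₀ D D' fun f _ => isConsistent_comp_corner D₀ D D' f,
    fun _ => Iff.rfl, exists_isCompl_of_forall_mem_iff_isConsistent D₀ D D' m m₀ (fun _ _ => rfl)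
      (fun t => ?_) fun _ => Iff.rfl⟩
  obtain ⟨Q', hQ'⟩ := (preCoordsZero D₀ D D' (k := k) (s := s) (j := j)).exists_isCompl_filt t
  exact ⟨_, Q', hQ', fun _ => mem_filt_homCoords_iff D₀ D D'⟩

theorem exists_isCompl_consistent_postModule :
    letI := postModule D₀ D D' (r := r) (k := k) (s := s) (j := j)
    ∃ N : Submodule (Fn n M) (HomSec D₀ D D' r k s j),
      (∀ H, H ∈ N ↔ IsConsistent D₀ D D' H.1) ∧ ∃ N', IsCompl N N' := by
  let m := postModule D₀ D D' (r := r) (k := k) (s := s) (j := j)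
  let m₀ := postModule D₀ D D' (r := 0) (k := k) (s := s) (j := j)
  refine ⟨consistentSubmodule D₀ D D' fun f _ => isConsistent_corner_comp D₀ D D' f,
    fun _ => Iff.rfl, exists_isCompl_of_forall_mem_iff_isConsistent D₀ D D' m m₀ (fun _ _ => rfl)
      (fun t => ?_) fun _ => Iff.rfl⟩
  obtain ⟨Q', hQ'⟩ := (postCoords D₀ D D' (r := 0) (k := k) (s := s) (j := j)).exists_isCompl_filt t
  exact ⟨_, Q', hQ', fun _ => mem_filt_homCoords_iff D₀ D D'⟩

end Complements

end UBundle

end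

open UBundle in
theorem mainTheorem10_general {n d d' : ℕ}
    {M : Type*} [TopologicalSpace M] [T2Space M] [SecondCountableTopology M]
    [ChartedSpace (Rn n) M] [IsManifold (𝓡 n) ∞ M]
    {E : M → Type*} [TopologicalSpace (TotalSpace (Rn d) E)]
    [∀ x, AddCommGroup (E x)] [∀ x, Module ℝ (E x)] [∀ x, TopologicalSpace (E x)]
    [∀ x, IsTopologicalAddGroup (E x)] [∀ x, ContinuousSMul ℝ (E x)]
    [FiberBundle (Rn d) E] [VectorBundle ℝ (Rn d) E] [ContMDiffVectorBundle ∞ (Rn d) E (𝓡 n)]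
    {F : M → Type*} [TopologicalSpace (TotalSpace (Rn d') F)]
    [∀ x, AddCommGroup (F x)] [∀ x, Module ℝ (F x)] [∀ x, TopologicalSpace (F x)]
    [∀ x, IsTopologicalAddGroup (F x)] [∀ x, ContinuousSMul ℝ (F x)]
    [FiberBundle (Rn d') F] [VectorBundle ℝ (Rn d') F] [ContMDiffVectorBundle ∞ (Rn d') F (𝓡 n)]
    (D₀ : CovariantDerivative (𝓡 n) (Rn n) (TangentSpace (𝓡 n) : M → Type _))
    [D₀.ContMDiffCovariantDerivative ∞]
    (D : CovariantDerivative (𝓡 n) (Rn d) E) [D.ContMDiffCovariantDerivative ∞]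
    (D' : CovariantDerivative (𝓡 n) (Rn d') F) [D'.ContMDiffCovariantDerivative ∞]
    (r k s j : ℕ) :
    (∃ _ : Module (Fn n M) (USec D₀ D r k),
      (∀ (f : Fn n M) (T : USec D₀ D r k) (p : M), (f • T).1 p = corner D₀ D f p (T.1 p)) ∧
      Module.Finite (Fn n M) (USec D₀ D r k) ∧
      Module.Projective (Fn n M) (USec D₀ D r k)) ∧
    (∃ _ : Module (Fn n M) (HomSec D₀ D D' r k s j),
      (∀ (f : Fn n M) (H : HomSec D₀ D D' r k s j) (p : M),
        (f • H).1 p = H.1 p ∘ₗ corner D₀ D f p) ∧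
      Module.Finite (Fn n M) (HomSec D₀ D D' r k s j) ∧
      Module.Projective (Fn n M) (HomSec D₀ D D' r k s j) ∧
      ∃ N : Submodule (Fn n M) (HomSec D₀ D D' r k s j),
        (∀ H, H ∈ N ↔ IsConsistent D₀ D D' H.1) ∧ ∃ N', IsCompl N N') ∧
    (∃ _ : Module (Fn n M) (HomSec D₀ D D' r k s j),
      (∀ (f : Fn n M) (H : HomSec D₀ D D' r k s j) (p : M),
        (f • H).1 p = corner D₀ D' f p ∘ₗ H.1 p) ∧
      Module.Finite (Fn n M) (HomSec D₀ D D' r k s j) ∧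
      Module.Projective (Fn n M) (HomSec D₀ D D' r k s j) ∧
      ∃ N : Submodule (Fn n M) (HomSec D₀ D D' r k s j),
        (∀ H, H ∈ N ↔ IsConsistent D₀ D D' H.1) ∧ ∃ N', IsCompl N N') :=
  ⟨⟨cornerModule D₀ D, fun _ _ _ => rfl, (uCoords D₀ D).finite_projective⟩,
    ⟨preModule D₀ D D', fun _ _ _ => rfl, (finite_projective_preModule D₀ D D').1,
      (finite_projective_preModule D₀ D D').2, exists_isCompl_consistent_preModule D₀ D D'⟩,
    ⟨postModule D₀ D D', fun _ _ _ => rfl, (finite_projective_postModule D₀ D D').1,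
      (finite_projective_postModule D₀ D D').2, exists_isCompl_consistent_postModule D₀ D D'⟩⟩

open UBundle in
theorem mainTheorem10 {n d d' : ℕ}
    {M : Type*} [TopologicalSpace M] [T2Space M] [SecondCountableTopology M]
    [ChartedSpace (Rn n) M] [IsManifold (𝓡 n) ∞ M]
    {E : M → Type*} [TopologicalSpace (TotalSpace (Rn d) E)]
    [∀ x, AddCommGroup (E x)] [∀ x, Module ℝ (E x)] [∀ x, TopologicalSpace (E x)]
    [∀ x, IsTopologicalAddGroup (E x)] [∀ x, ContinuousSMul ℝ (E x)]
    [FiberBundle (Rn d) E] [VectorBundle ℝ (Rn d) E] [ContMDiffVectorBundle ∞ (Rn d) E (𝓡 n)]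
    {F : M → Type*} [TopologicalSpace (TotalSpace (Rn d') F)]
    [∀ x, AddCommGroup (F x)] [∀ x, Module ℝ (F x)] [∀ x, TopologicalSpace (F x)]
    [∀ x, IsTopologicalAddGroup (F x)] [∀ x, ContinuousSMul ℝ (F x)]
    [FiberBundle (Rn d') F] [VectorBundle ℝ (Rn d') F] [ContMDiffVectorBundle ∞ (Rn d') F (𝓡 n)]
    (D₀ : CovariantDerivative (𝓡 n) (Rn n) (TangentSpace (𝓡 n) : M → Type _))
    [D₀.ContMDiffCovariantDerivative ∞] (_hD₀ : D₀.torsion = 0)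
    (D : CovariantDerivative (𝓡 n) (Rn d) E) [D.ContMDiffCovariantDerivative ∞]
    (D' : CovariantDerivative (𝓡 n) (Rn d') F) [D'.ContMDiffCovariantDerivative ∞]
    (r k s j : ℕ) :
    -- the sections of `𝒰_k^r(E)` with the action `f⌟`
    (∃ _ : Module (Fn n M) (USec D₀ D r k),
      (∀ (f : Fn n M) (T : USec D₀ D r k) (p : M), (f • T).1 p = corner D₀ D f p (T.1 p)) ∧
      Module.Finite (Fn n M) (USec D₀ D r k) ∧
      Module.Projective (Fn n M) (USec D₀ D r k)) ∧
    -- the sections of `Hom(𝒰_k^r(E), 𝒰_j^s(F))` with the action by precomposition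
    (∃ _ : Module (Fn n M) (HomSec D₀ D D' r k s j),
      (∀ (f : Fn n M) (H : HomSec D₀ D D' r k s j) (p : M),
        (f • H).1 p = H.1 p ∘ₗ corner D₀ D f p) ∧
      Module.Finite (Fn n M) (HomSec D₀ D D' r k s j) ∧
      Module.Projective (Fn n M) (HomSec D₀ D D' r k s j) ∧
      ∃ N : Submodule (Fn n M) (HomSec D₀ D D' r k s j),
        (∀ H, H ∈ N ↔ IsConsistent D₀ D D' H.1) ∧ ∃ N', IsCompl N N') ∧
    -- the sections of `Hom(𝒰_k^r(E), 𝒰_j^s(F))` with the action by postcomposition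
    (∃ _ : Module (Fn n M) (HomSec D₀ D D' r k s j),
      (∀ (f : Fn n M) (H : HomSec D₀ D D' r k s j) (p : M),
        (f • H).1 p = corner D₀ D' f p ∘ₗ H.1 p) ∧
      Module.Finite (Fn n M) (HomSec D₀ D D' r k s j) ∧
      Module.Projective (Fn n M) (HomSec D₀ D D' r k s j) ∧
      ∃ N : Submodule (Fn n M) (HomSec D₀ D D' r k s j),
        (∀ H, H ∈ N ↔ IsConsistent D₀ D D' H.1) ∧ ∃ N', IsCompl N N') :=
  mainTheorem10_general D₀ D D' r k s j
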